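/- **Setting.** A *convenient algebra* is a unital real algebra $\mathfrak A$ with a filtration by linear subspaces $\mathfrak A=\mathfrak A^{(0)}\supset\mathfrak A^{(1)}\supset\cdots$ such that $\mathfrak A^{(i)}\mathfrak A^{(j)}\subset\mathfrak A^{(i+j)}$, $\mathfrak A$ is complete and Hausdorff ($\bigcap_i\mathfrak A^{(i)}=0$) with respect to the filtration, and all $\mathfrak A/\mathfrak A^{(i)}$ are finite-dimensional. Its $\infty$-topology is the one induced from all quotients $\mathfrak A/\mathfrak A^{(i)}$; its $0$-topology is the one induced from $\mathfrak A/\mathfrak A^{(1)}$ only; integrals are computed in all quotients. The direct sum of two convenient algebras is filtered componentwise, and homomorphisms are unital homomorphisms of real algebras. An $n$-tuple $(Q_1,\dots,Q_n)$ in $\mathfrak A$ is a *Clifford system* if $Q_iQ_j+Q_jQ_i=-2\delta_{ij}1$ for all $i,j$; for $n\ge 1$ it is a *floating Clifford system* if $Q_1$ is invertible and $\tilde Q=(Q_2Q_1^{-1},\dots,Q_nQ_1^{-1})$ is a Clifford system. An *operation* $\Psi$ assigns, in each convenient algebra $\mathfrak A$, to some $n$-tuples $A\in\mathfrak A^n$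 an $n$-tuple $\Psi(A)\in\mathfrak A^n$ (this is (vR)); "$\Psi(A)=B$" includes that $\Psi(A)$ is defined. For $m\in\mathbb N$, $\iota\in\{0,1\}^m$ and an $m$-tuple $Q$, write $Q^\iota=Q_1^{\iota_1}\cdots Q_m^{\iota_m}$. **Definitions.** For $S\in\mathfrak A$ let $S^{-1/2}=\int_0^{2\pi}(\cos^2t+S\sin^2t)^{-1}\frac{dt}{2\pi}$, defined if $\cos^2t+S\sin^2t$ is invertible for all real $t$, and let $\operatorname{pol}H=H(-H^2)^{-1/2}$, defined if $(-H^2)^{-1/2}$ is. Let $R_Q^1=\frac12(R-Q^{-1}RQ)$ and $R^1_{Q_1\dots Q_s}=(\cdots(R^1_{Q_1})^1_{Q_2}\cdots)^1_{Q_s}$. The *Gram–Schmidt orthogonalization* is $\mathcal O^{\mathrm{GS}}(A_1,\dots,A_n)=(Q_1,\dots,Q_n)$, where recursively $Q_k=\operatorname{pol}\big((A_k)^1_{Q_1\dots Q_{k-1}}\big)$; it is defined if all these polarizations are. For $n\ge1$, the *Gram–Schmidt conform-orthogonalization* is $\mathcal O^{\mathrm{fGS}}(A_1,\dots,A_n)=(A_1,\tilde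 Q_2A_1,\dots,\tilde Q_nA_1)$, where $(\tilde Q_2,\dots,\tilde Q_n)=\mathcal O^{\mathrm{GS}}(A_2A_1^{-1},\dots,A_nA_1^{-1})$; it is defined if $A_1$ is invertible and this $\mathcal O^{\mathrm{GS}}$ is defined. **Theorem 3.5.** (a) For every $n$, $\Psi=\mathcal O^{\mathrm{GS}}$ on $n$-tuples is an FQ orthogonalization procedure, i.e. it satisfies (Nat), (Ana), (CP); moreover it satisfies (vC), (vL), (H$^0$), (PGS), (Fil), (Par) and (FSt), where - (Nat) if $\Psi(A)=B$ in $\mathfrak A$ and $\phi:\mathfrak A\to\tilde{\mathfrak A}$ is a homomorphism of convenient algebras, then $\Psi(\phi(A_1),\dots,\phi(A_n))=(\phi(B_1),\dots,\phi(B_n))$; and the domain of $\Psi$ on $\mathfrak A\oplus\mathfrak B$ contains the direct product of the domains on $\mathfrak A$ and on $\mathfrak B$; - (Ana) there are real numbers $\psi^{[k];j_1,\dots,j_r}_{\iota_0,\dots,\iota_r}$ ($r\ge0$, $j_s\in\{1,\dots,n\}$, $\iota_s\in\{0,1\}^n$), independent of $\mathfrak A$ and $Q$, such that for each Clifford system $Q$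 in each $\mathfrak A$, if $R\in\mathfrak A^n$ has components sufficiently close to $0$ in the $0$-topology, then $\Psi(Q+R)$ is defined and its $k$-th component is $\sum_{r=0}^\infty E_k^{(r)}$, convergent in the $\infty$-topology, with $E_k^{(r)}=\sum_{\iota_0,\dots,\iota_r,\,j_1,\dots,j_r}\psi^{[k];j_1,\dots,j_r}_{\iota_0,\dots,\iota_r}Q^{\iota_0}R_{j_1}Q^{\iota_1}R_{j_2}\cdots R_{j_r}Q^{\iota_r}$; - (CP) all values of $\Psi$ are Clifford systems; - (vC) $\Psi(Q)=Q$ for every Clifford system $Q$; - (vL) if $\Psi(A)=B$ and $\iota\in\{0,1\}^n$, then $\Psi((-1)^{\iota_1}A_1,\dots,(-1)^{\iota_n}A_n)=((-1)^{\iota_1}B_1,\dots,(-1)^{\iota_n}B_n)$; - (H$^0$) if $\Psi(A)=B$ and $t>0$, then $\Psi(tA)=B$; - (PGS) if $V$ is a finite-dimensional real vector space with positive definite metric $q$, and $a_1,\dots,a_n\in V$ are linearly independent with (classical) Gram–Schmidt orthonormalization $\hat a_1,\dots,\hat a_n$, then $\Psi(\mathrm{cl}(a_1),\dots,\mathrm{cl}(a_n))=(\mathrm{cl}(\hat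 a_1),\dots,\mathrm{cl}(\hat a_n))$ in the Clifford algebra $\mathrm{Cl}(V,q)$, where $\mathrm{cl}(v)^2=-q(v,v)1$, with the filtration $\mathfrak A^{(i)}=0$ for $i\ge1$; - (Fil) if $\Psi(A)=B$, $\Psi(A')=B'$ and $A_i=A'_i$ for all $i\le k$, then $B_k=B'_k$; and the data $\psi$ in (Ana) can be chosen so that the expansion of the $k$-th component involves only $Q_1,\dots,Q_k$ and $R_1,\dots,R_k$; - (Par) if $\Psi(A)=B$ and $U$ is a real lower triangular matrix with positive diagonal, then $\Psi(UA)=B$, where $(UA)_k=\sum_jU_{kj}A_j$; - (FSt) if $\Psi(A)=B$ and $t\in[0,1]$, then $\Psi(tA+(1-t)B)=B$. (b) For every $n\ge1$, $\Psi=\mathcal O^{\mathrm{fGS}}$ on $n$-tuples is an FQ conform-orthogonalization procedure, i.e. it satisfies (Nat), (Biv'), (Ana'), (CP'); moreover it satisfies (vC'), (vL), (PGS'), (Fil), (Par') and (FSt), where (Nat), (vL), (FSt) are as above and - (Biv') if $\Psi(A)=B$ and $\theta_1,\theta_2\in\mathfrak A$ are invertible, then $\Psi(\theta_1A_1\theta_2,\dots,\theta_1A_n\theta_2)=(\theta_1B_1\theta_2,\dots,\theta_1B_n\theta_2)$;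 - (Ana') is as (Ana), but for floating Clifford systems $Q$, with $\iota_s\in\{0,1\}^{n-1}$ and with $E_k^{(r)}=\sum\psi^{[k];j_1,\dots,j_r}_{\iota_0,\dots,\iota_r}\tilde Q^{\iota_0}\tilde R_{j_1}\tilde Q^{\iota_1}\tilde R_{j_2}\cdots\tilde R_{j_r}\tilde Q^{\iota_r}Q_1$, where $\tilde R_j=R_jQ_1^{-1}$ and $\tilde Q=(Q_2Q_1^{-1},\dots,Q_nQ_1^{-1})$; - (CP') all values of $\Psi$ are floating Clifford systems; - (vC') $\Psi(Q)=Q$ for every floating Clifford system $Q$; - (PGS') is as (PGS), with $\hat a_k$ replaced by $\check a_k=\sqrt{q(\tilde a_1,\tilde a_1)/q(\tilde a_k,\tilde a_k)}\,\tilde a_k$, where $\tilde a_1,\dots,\tilde a_n$ are the orthogonal vectors produced by the Gram–Schmidt process without normalization; - (Fil) is as above, with the expansion of (Ana') in place of that of (Ana): that of the $k$-th component involves only $Q_2Q_1^{-1},\dots,Q_kQ_1^{-1}$ and $\tilde R_1,\dots,\tilde R_k$, besides the factor $Q_1$; - (Par') is as (Par), for matrices $U$ with $U_{11}=1$. (c)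 For every convenient algebra $\mathfrak A$, the domains of $\mathcal O^{\mathrm{GS}}$ and $\mathcal O^{\mathrm{fGS}}$ in $\mathfrak A^n$ are $0$-open, i.e. open in the product of the $0$-topologies. -/

import Mathlib

universe u

noncomputable section

namespace FQ

/-- The structure of a "convenient algebra" on a unital real algebra: a decreasing multiplicative
filtration, complete and Hausdorff, with finite-dimensional filtration quotients. -/
class ConvenientAlgebra (A : Type u) [Ring A] [Algebra ℝ A] where
  /-- the filtration `A = filt 0 ⊇ filt 1 ⊇ ...` -/
  filt : ℕ → Submodule ℝ A
  filt_zero : filt 0 = ⊤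
  filt_antitone : Antitone filt
  mul_mem_filt : ∀ {i j : ℕ} {a b : A}, a ∈ filt i → b ∈ filt j → a * b ∈ filt (i + j)
  /-- completeness: every coherent sequence of classes in the quotients comes from an element -/
  complete : ∀ x : ℕ → A, (∀ i, x (i + 1) - x i ∈ filt i) → ∃ a : A, ∀ i, a - x i ∈ filt i
  hausdorff : ⨅ i, filt i = ⊥
  finite_quotient : ∀ i, FiniteDimensional ℝ (A ⧸ filt i)

/-- The filtration of a convenient algebra. -/
abbrev filt (A : Type u) [Ring A] [Algebra ℝ A] [ConvenientAlgebra A] (i : ℕ) : Submodule ℝ A :=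
  ConvenientAlgebra.filt i

/-- The topology on `A` induced from the filtration quotient `A ⧸ filt A i`, which carries its
canonical topology as a finite-dimensional real vector space. -/
abbrev levelTopology (A : Type u) [Ring A] [Algebra ℝ A] [ConvenientAlgebra A] (i : ℕ) :
    TopologicalSpace A :=
  TopologicalSpace.induced (filt A i).mkQ (moduleTopology ℝ (A ⧸ filt A i))

/-- The `∞`-topology, induced from all filtration quotients. -/
abbrev infTopology (A : Type u) [Ring A] [Algebra ℝ A] [ConvenientAlgebra A] : TopologicalSpace A :=
  ⨅ i, levelTopology A i

/-- The `0`-topology, induced from the filtration quotient `A ⧸ filt A 1` only. -/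
abbrev zeroTopology (A : Type u) [Ring A] [Algebra ℝ A] [ConvenientAlgebra A] : TopologicalSpace A :=
  levelTopology A 1

/-- A subset of `A ^ n` is `0`-open if it is open for the product of the `0`-topologies. -/
def IsZeroOpen {A : Type u} [Ring A] [Algebra ℝ A] [ConvenientAlgebra A] {n : ℕ}
    (s : Set (Fin n → A)) : Prop :=
  @IsOpen (Fin n → A) (@Pi.topologicalSpace (Fin n) (fun _ => A) (fun _ => zeroTopology A)) s

/-- The direct sum of two convenient algebras, filtered componentwise. -/
instance instProd (A B : Type u) [Ring A] [Algebra ℝ A] [ConvenientAlgebra A]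
    [Ring B] [Algebra ℝ B] [ConvenientAlgebra B] : ConvenientAlgebra (A × B) where
  filt i := (filt A i).prod (filt B i)
  filt_zero := by
    simp [filt, ConvenientAlgebra.filt_zero]
  filt_antitone i j h := Submodule.prod_mono
    (ConvenientAlgebra.filt_antitone h) (ConvenientAlgebra.filt_antitone h)
  mul_mem_filt ha hb :=
    ⟨ConvenientAlgebra.mul_mem_filt ha.1 hb.1, ConvenientAlgebra.mul_mem_filt ha.2 hb.2⟩
  complete x hx := by
    obtain ⟨a, ha⟩ := ConvenientAlgebra.complete (fun i => (x i).1) (fun i => (hx i).1)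
    obtain ⟨b, hb⟩ := ConvenientAlgebra.complete (fun i => (x i).2) (fun i => (hx i).2)
    exact ⟨(a, b), fun i => ⟨ha i, hb i⟩⟩
  hausdorff := by
    rw [eq_bot_iff]
    intro x hx
    simp only [Submodule.mem_iInf, Submodule.mem_prod] at hx
    have h1 : x.1 ∈ ⨅ i, filt A i := (Submodule.mem_iInf _).2 fun i => (hx i).1
    have h2 : x.2 ∈ ⨅ i, filt B i := (Submodule.mem_iInf _).2 fun i => (hx i).2
    rw [ConvenientAlgebra.hausdorff, Submodule.mem_bot] at h1 h2
    exact (Submodule.mem_bot ℝ).2 (Prod.ext h1 h2)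
  finite_quotient i := by
    have := ConvenientAlgebra.finite_quotient (A := A) i
    have := ConvenientAlgebra.finite_quotient (A := B) i
    let f : (A × B) →ₗ[ℝ] (A ⧸ filt A i) × (B ⧸ filt B i) :=
      (filt A i).mkQ.prodMap (filt B i).mkQ
    have hk : LinearMap.ker f = (filt A i).prod (filt B i) := by
      simp [f, LinearMap.ker_prodMap]
    exact Module.Finite.of_injective (((filt A i).prod (filt B i)).liftQ f hk.ge)
      (LinearMap.ker_eq_bot.1 (Submodule.ker_liftQ_eq_bot _ _ _ hk.le))

/-- A finite-dimensional algebra with the trivial filtration `A ⊇ 0 ⊇ 0 ⊇ ...`. -/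
@[reducible]
def trivialFiltration (A : Type u) [Ring A] [Algebra ℝ A] [FiniteDimensional ℝ A] :
    ConvenientAlgebra A where
  filt i := if i = 0 then ⊤ else ⊥
  filt_zero := by simp
  filt_antitone i j h := by
    by_cases hi : i = 0
    · simp [hi]
    · have hj : j ≠ 0 := by omega
      simp [hi, hj]
  mul_mem_filt {i j a b} ha hb := by
    by_cases hi : i = 0
    · by_cases hj : j = 0
      · simp [hi, hj]
      · have : b = 0 := by simpa [hj] using hb
        simp [this]
    · have : a = 0 := by simpa [hi] using ha
      simp [this]
  complete x hx := by
    refine ⟨x 1, fun i => ?_⟩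
    rcases i with _ | i
    · simp
    · have : x 1 = x (i + 1) := by
        induction i with
        | zero => rfl
        | succ k ih =>
          rw [ih]
          have := hx (k + 1)
          simp only [Nat.add_eq_zero_iff, one_ne_zero, and_false, if_false,
            Submodule.mem_bot] at this
          exact (sub_eq_zero.1 this).symm
      simp [this]
  hausdorff := by
    rw [eq_bot_iff]
    exact (iInf_le _ 1).trans (by simp)
  finite_quotient i := inferInstance

/-! ### Polarization -/

/-- `x` is the integral of `f` over `[a, b]`, computed in every filtration quotient, that is,
after applying any linear functional on any of these finite-dimensional quotients. -/
def IsAlgIntegral {A : Type u} [Ring A] [Algebra ℝ A] [ConvenientAlgebra A]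
    (f : ℝ → A) (a b : ℝ) (x : A) : Prop :=
  ∀ (i : ℕ) (l : Module.Dual ℝ (A ⧸ filt A i)),
    IntervalIntegrable (fun t => l ((filt A i).mkQ (f t))) MeasureTheory.volume a b ∧
      ∫ t in a..b, l ((filt A i).mkQ (f t)) = l ((filt A i).mkQ x)

theorem IsAlgIntegral.unique {A : Type u} [Ring A] [Algebra ℝ A] [ConvenientAlgebra A]
    {f : ℝ → A} {a b : ℝ} {x y : A} (hx : IsAlgIntegral f a b x) (hy : IsAlgIntegral f a b y) :
    x = y := by
  have h : x - y ∈ ⨅ i, filt A i := by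
    refine (Submodule.mem_iInf _).2 fun i => ?_
    rw [← Submodule.Quotient.mk_eq_zero, ← Module.forall_dual_apply_eq_zero_iff ℝ]
    intro l
    have := (hx i l).2.symm.trans (hy i l).2
    simpa [sub_eq_zero] using this
  rw [ConvenientAlgebra.hausdorff, Submodule.mem_bot] at h
  exact sub_eq_zero.1 h

open Classical in
/-- The integral of an `A`-valued function (`0` if it does not exist). -/
def algIntegral {A : Type u} [Ring A] [Algebra ℝ A] [ConvenientAlgebra A]
    (f : ℝ → A) (a b : ℝ) : A :=
  if h : ∃ x, IsAlgIntegral f a b x then h.choose else 0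

/-- The element `cos² t + S sin² t`. -/
def sqrtKernel {A : Type u} [Ring A] [Algebra ℝ A] (S : A) (t : ℝ) : A :=
  algebraMap ℝ A (Real.cos t ^ 2) + (Real.sin t ^ 2) • S

/-- `S ^ (-1/2)` is defined if and only if all `cos² t + S sin² t` are invertible. -/
def InvSqrtDom {A : Type u} [Ring A] [Algebra ℝ A] (S : A) : Prop :=
  ∀ t : ℝ, IsUnit (sqrtKernel S t)

/-- `S ^ (-1/2) = ∫_{0}^{2π} (cos² t + S sin² t)⁻¹ dt / 2π`. -/
def invSqrt {A : Type u} [Ring A] [Algebra ℝ A] [ConvenientAlgebra A] (S : A) : A :=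
  algIntegral (fun t => (2 * Real.pi)⁻¹ • Ring.inverse (sqrtKernel S t)) 0 (2 * Real.pi)

/-- The domain of the polarization. -/
def PolDom {A : Type u} [Ring A] [Algebra ℝ A] (H : A) : Prop :=
  InvSqrtDom (-H ^ 2)

/-- The polarization `pol H = H (-H²) ^ (-1/2)`. -/
def pol {A : Type u} [Ring A] [Algebra ℝ A] [ConvenientAlgebra A] (H : A) : A :=
  H * invSqrt (-H ^ 2)

/-! ### Clifford systems and (partially defined) operations -/

/-- `Q_i Q_j + Q_j Q_i = -2 δ_{ij} 1`. -/
def IsClifford {A : Type u} [Ring A] {n : ℕ} (Q : Fin n → A) : Prop :=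
  ∀ i j, Q i * Q j + Q j * Q i = if i = j then -2 else 0

/-- For `Q = (Q_1, ..., Q_{n+1})`, the `n`-tuple `(Q_2 Q_1⁻¹, ..., Q_{n+1} Q_1⁻¹)`. -/
def unfloat {A : Type u} [Ring A] {n : ℕ} (Q : Fin (n + 1) → A) : Fin n → A :=
  fun i => Q i.succ * Ring.inverse (Q 0)

/-- Floating Clifford systems: `(Q_2 Q_1⁻¹, ..., Q_{n+1} Q_1⁻¹)` is a Clifford system. -/
def IsFloatingClifford {A : Type u} [Ring A] {n : ℕ} (Q : Fin (n + 1) → A) : Prop :=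
  IsUnit (Q 0) ∧ IsClifford (unfloat Q)

/-- A (partially defined) operation assigning `n`-tuples to `n`-tuples in each convenient algebra.
`B ∈ Ψ A a` means that `Ψ` is defined at `a ∈ A ^ n` and takes the value `B` there. -/
abbrev Op (n : ℕ) : Type (u + 1) :=
  ∀ (A : Type u) [Ring A] [Algebra ℝ A] [ConvenientAlgebra A], (Fin n → A) →. (Fin n → A)

/-- The antisymmetrization `R_Q^1 = (R - Q⁻¹ R Q) / 2`. -/
def antisymm {A : Type u} [Ring A] [Algebra ℝ A] (R Q : A) : A :=
  (2⁻¹ : ℝ) • (R - Ring.inverse Q * R * Q)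

/-- The iterated antisymmetrization `R_{Q_1 ... Q_s}^1` with respect to `Q_1`, ..., `Q_s`. -/
def antisymmList {A : Type u} [Ring A] [Algebra ℝ A] (R : A) (Q : List A) : A :=
  Q.foldl antisymm R

/-- The recursion `Q_k = pol ((A_k)_{Q_1 ... Q_{k-1}}^1)`. -/
def gsSeq {A : Type u} [Ring A] [Algebra ℝ A] [ConvenientAlgebra A] {n : ℕ} (a : Fin n → A)
    (k : Fin n) : A :=
  pol (antisymmList (a k) (List.ofFn fun i : Fin k.val => gsSeq a ⟨i.val, i.isLt.trans k.isLt⟩))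
termination_by k.val

/-- The term `(A_k)_{Q_1 ... Q_{k-1}}^1` to be polarized in the `k`-th step. -/
def gsTerm {A : Type u} [Ring A] [Algebra ℝ A] [ConvenientAlgebra A] {n : ℕ} (a : Fin n → A)
    (k : Fin n) : A :=
  antisymmList (a k) (List.ofFn fun i : Fin k.val => gsSeq a ⟨i.val, i.isLt.trans k.isLt⟩)

/-- The Gram-Schmidt orthogonalization; it is defined if all polarizations in the recursion are. -/
def gramSchmidt (n : ℕ) : Op.{u} n :=
  fun _ _ _ _ a => ⟨∀ k, PolDom (gsTerm a k), fun _ => gsSeq a⟩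

/-- The Gram-Schmidt conform-orthogonalization `(A_1, Q̃_2 A_1, ..., Q̃_{n+1} A_1)`, where
`(Q̃_2, ..., Q̃_{n+1})` is the Gram-Schmidt orthogonalization of
`(A_2 A_1⁻¹, ..., A_{n+1} A_1⁻¹)`. -/
def conformGramSchmidt (n : ℕ) : Op.{u} (n + 1) :=
  fun A _ _ _ a => ⟨IsUnit (a 0) ∧ (gramSchmidt n A (unfloat a)).Dom,
    fun h => Fin.cons (a 0) fun i => (gramSchmidt n A (unfloat a)).get h.2 i * a 0⟩

/-! ### Analytic expansions -/

/-- The multipower `Q ^ ι = Q_1 ^ ι_1 ... Q_m ^ ι_m`, `ι ∈ {0, 1} ^ m`. -/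
def mpow {A : Type u} [Ring A] {m : ℕ} (Q : Fin m → A) (e : Fin m → Fin 2) : A :=
  (List.ofFn fun i => Q i ^ (e i).val).prod

/-- The word `Q ^ ι_0 R_{j_1} Q ^ ι_1 R_{j_2} ... R_{j_r} Q ^ ι_r`. -/
def word {A : Type u} [Ring A] {m n r : ℕ} (Q : Fin m → A) (R : Fin n → A)
    (e : Fin (r + 1) → Fin m → Fin 2) (j : Fin r → Fin n) : A :=
  mpow Q (e 0) * (List.ofFn fun s : Fin r => R (j s) * mpow Q (e s.succ)).prod

/-- Power series data `ψ^{[k]; j_1, ..., j_r}_{ι_0, ..., ι_r}`, with `j_s ∈ {1, ..., n}`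
and `ι_s ∈ {0, 1} ^ m`. -/
abbrev Coeff (m n : ℕ) : Type :=
  Fin n → (r : ℕ) → (Fin (r + 1) → Fin m → Fin 2) → (Fin r → Fin n) → ℝ

/-- The homogeneous term of degree `r` in the `k`-th component of the expansion. -/
def expTerm {A : Type u} [Ring A] [Algebra ℝ A] {m n : ℕ} (c : Coeff m n)
    (Q : Fin m → A) (R : Fin n → A) (k : Fin n) (r : ℕ) : A :=
  ∑ e : Fin (r + 1) → Fin m → Fin 2, ∑ j : Fin r → Fin n, c k r e j • word Q R e j

/-- The power series with data `c` represents `Ψ` around all Clifford systems `Q`: for all `R` with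
components sufficiently close to `0` modulo `filt A 1`, `Ψ (Q + R)` is defined, and it is given
by the series, convergent in the `∞`-topology. -/
def HasExpansion {n : ℕ} (Ψ : Op.{u} n) (c : Coeff n n) : Prop :=
  ∀ (A : Type u) [Ring A] [Algebra ℝ A] [ConvenientAlgebra A] (Q : Fin n → A), IsClifford Q →
    ∃ U : Set A, @IsOpen A (zeroTopology A) U ∧ 0 ∈ U ∧ ∀ R : Fin n → A, (∀ i, R i ∈ U) →
      ∃ B ∈ Ψ A (Q + R), ∀ k, @HasSum A ℕ _ (infTopology A) (expTerm c Q R k) (B k) (.unconditional ℕ)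

/-- The power series with data `c` represents `Ψ` around all floating Clifford systems `Q`, where
the series is written in terms of `R_j Q_1⁻¹` and `Q_2 Q_1⁻¹, ..., Q_{n+1} Q_1⁻¹`, and
multiplied by `Q_1` from the right. -/
def HasFloatingExpansion {n : ℕ} (Ψ : Op.{u} (n + 1)) (c : Coeff n (n + 1)) : Prop :=
  ∀ (A : Type u) [Ring A] [Algebra ℝ A] [ConvenientAlgebra A] (Q : Fin (n + 1) → A),
    IsFloatingClifford Q →
    ∃ U : Set A, @IsOpen A (zeroTopology A) U ∧ 0 ∈ U ∧ ∀ R : Fin (n + 1) → A, (∀ i, R i ∈ U) →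
      ∃ B ∈ Ψ A (Q + R), ∀ k, @HasSum A ℕ _ (infTopology A)
        (fun r => expTerm c (unfloat Q) (fun j => R j * Ring.inverse (Q 0)) k r * Q 0) (B k)
        (.unconditional ℕ)

/-! ### The conditions on FQ operations -/

/-- (Nat) Algebraic naturality: (i) compatibility with homomorphisms; (ii) the domain on a direct
sum contains the product of the domains. -/
def Natural {n : ℕ} (Ψ : Op.{u} n) : Prop :=
  (∀ (A A' : Type u) [Ring A] [Algebra ℝ A] [ConvenientAlgebra A]
      [Ring A'] [Algebra ℝ A'] [ConvenientAlgebra A'] (φ : A →ₐ[ℝ] A') (a B : Fin n → A),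
      B ∈ Ψ A a → (fun i => φ (B i)) ∈ Ψ A' (fun i => φ (a i))) ∧
  ∀ (A A' : Type u) [Ring A] [Algebra ℝ A] [ConvenientAlgebra A]
      [Ring A'] [Algebra ℝ A'] [ConvenientAlgebra A'] (a : Fin n → A) (a' : Fin n → A'),
      a ∈ (Ψ A).Dom → a' ∈ (Ψ A').Dom → (fun i => (a i, a' i)) ∈ (Ψ (A × A')).Dom

/-- (Ana) Analyticity around Clifford systems. -/
def Analytic {n : ℕ} (Ψ : Op.{u} n) : Prop :=
  ∃ c, HasExpansion Ψ c

/-- (Ana') Floating analyticity. -/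
def FloatingAnalytic {n : ℕ} (Ψ : Op.{u} (n + 1)) : Prop :=
  ∃ c, HasFloatingExpansion Ψ c

/-- (CP) `Ψ` yields Clifford systems. -/
def CliffordProductive {n : ℕ} (Ψ : Op.{u} n) : Prop :=
  ∀ (A : Type u) [Ring A] [Algebra ℝ A] [ConvenientAlgebra A] (a B : Fin n → A),
    B ∈ Ψ A a → IsClifford B

/-- (CP') `Ψ` yields floating Clifford systems. -/
def FloatingCliffordProductive {n : ℕ} (Ψ : Op.{u} (n + 1)) : Prop :=
  ∀ (A : Type u) [Ring A] [Algebra ℝ A] [ConvenientAlgebra A] (a B : Fin (n + 1) → A),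
    B ∈ Ψ A a → IsFloatingClifford B

/-- (Biv') Bivariance. -/
def Bivariant {n : ℕ} (Ψ : Op.{u} n) : Prop :=
  ∀ (A : Type u) [Ring A] [Algebra ℝ A] [ConvenientAlgebra A] (a B : Fin n → A) (x y : A),
    IsUnit x → IsUnit y → B ∈ Ψ A a → (fun i => x * B i * y) ∈ Ψ A (fun i => x * a i * y)

/-- FQ orthogonalization procedures: (Nat), (Ana), (CP); the domain and range condition is part
of the type `Op n`. -/
def IsOrthogonalization {n : ℕ} (Ψ : Op.{u} n) : Prop :=
  Natural Ψ ∧ Analytic Ψ ∧ CliffordProductive Ψ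

/-- FQ conform-orthogonalization procedures: (Nat), (Biv'), (Ana'), (CP'). -/
def IsConformOrthogonalization {n : ℕ} (Ψ : Op.{u} (n + 1)) : Prop :=
  Natural Ψ ∧ Bivariant Ψ ∧ FloatingAnalytic Ψ ∧ FloatingCliffordProductive Ψ

/-- (vC) `Ψ` fixes Clifford systems. -/
def CliffordConservative {n : ℕ} (Ψ : Op.{u} n) : Prop :=
  ∀ (A : Type u) [Ring A] [Algebra ℝ A] [ConvenientAlgebra A] (Q : Fin n → A),
    IsClifford Q → Q ∈ Ψ A Q

/-- (vC') `Ψ` fixes floating Clifford systems. -/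
def FloatingCliffordConservative {n : ℕ} (Ψ : Op.{u} (n + 1)) : Prop :=
  ∀ (A : Type u) [Ring A] [Algebra ℝ A] [ConvenientAlgebra A] (Q : Fin (n + 1) → A),
    IsFloatingClifford Q → Q ∈ Ψ A Q

/-- (vL) Vectorial sign linearity. -/
def SignLinear {n : ℕ} (Ψ : Op.{u} n) : Prop :=
  ∀ (A : Type u) [Ring A] [Algebra ℝ A] [ConvenientAlgebra A] (a B : Fin n → A)
    (e : Fin n → Fin 2), B ∈ Ψ A a →
    (fun i => (-1) ^ (e i).val * B i) ∈ Ψ A (fun i => (-1) ^ (e i).val * a i)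

/-- (H⁰) Real scalar `0`-homogeneity. -/
def ZeroHomogeneous {n : ℕ} (Ψ : Op.{u} n) : Prop :=
  ∀ (A : Type u) [Ring A] [Algebra ℝ A] [ConvenientAlgebra A] (a B : Fin n → A) (t : ℝ),
    0 < t → B ∈ Ψ A a → B ∈ Ψ A (t • a)

/-- (FSt) Fiber-star property. -/
def FiberStar {n : ℕ} (Ψ : Op.{u} n) : Prop :=
  ∀ (A : Type u) [Ring A] [Algebra ℝ A] [ConvenientAlgebra A] (a B : Fin n → A) (t : ℝ),
    t ∈ Set.Icc (0 : ℝ) 1 → B ∈ Ψ A a → B ∈ Ψ A (t • a + (1 - t) • B)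

/-- Lower triangular real matrices with positive diagonal. -/
def IsLowerPos {n : ℕ} (U : Matrix (Fin n) (Fin n) ℝ) : Prop :=
  (∀ i j, i < j → U i j = 0) ∧ ∀ i, 0 < U i i

/-- (Par) Parabolic property: invariance under lower triangular matrices with positive
diagonal. -/
def Parabolic {n : ℕ} (Ψ : Op.{u} n) : Prop :=
  ∀ (A : Type u) [Ring A] [Algebra ℝ A] [ConvenientAlgebra A] (a B : Fin n → A)
    (U : Matrix (Fin n) (Fin n) ℝ), IsLowerPos U →
    B ∈ Ψ A a → B ∈ Ψ A (fun k => ∑ j, U k j • a j)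

/-- (Par') Parabolic property for conform-operations: invariance under lower triangular matrices
with positive diagonal and upper left entry `1`. -/
def ConformParabolic {n : ℕ} (Ψ : Op.{u} (n + 1)) : Prop :=
  ∀ (A : Type u) [Ring A] [Algebra ℝ A] [ConvenientAlgebra A] (a B : Fin (n + 1) → A)
    (U : Matrix (Fin (n + 1)) (Fin (n + 1)) ℝ), IsLowerPos U → U 0 0 = 1 →
    B ∈ Ψ A a → B ∈ Ψ A (fun k => ∑ j, U k j • a j)

/-- The `k`-th term of the result depends only on the first `k` terms of the argument. -/
def PointwiseFiltered {n : ℕ} (Ψ : Op.{u} n) : Prop :=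
  ∀ (A : Type u) [Ring A] [Algebra ℝ A] [ConvenientAlgebra A] (a a' B B' : Fin n → A) (k : Fin n),
    B ∈ Ψ A a → B' ∈ Ψ A a' → (∀ i ≤ k, a i = a' i) → B k = B' k

/-- (Fil) Filtration property: the `k`-th component depends only on the first `k` terms, also in
the expansion, which involves only `Q_1, ..., Q_k` and `R_1, ..., R_k`. -/
def Filtered {n : ℕ} (Ψ : Op.{u} n) : Prop :=
  PointwiseFiltered Ψ ∧ ∃ c, HasExpansion Ψ c ∧
    ∀ k r e j, c k r e j ≠ 0 → (∀ s, j s ≤ k) ∧ ∀ s i, e s i ≠ 0 → i ≤ k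

/-- (Fil) for conform-operations; here the index `i` of the `n`-tuple
`(Q_2 Q_1⁻¹, ..., Q_{n+1} Q_1⁻¹)` corresponds to the index `i.succ` of `Q`. -/
def ConformFiltered {n : ℕ} (Ψ : Op.{u} (n + 1)) : Prop :=
  PointwiseFiltered Ψ ∧ ∃ c, HasFloatingExpansion Ψ c ∧
    ∀ k r e j, c k r e j ≠ 0 → (∀ s, j s ≤ k) ∧ ∀ s i, e s i ≠ 0 → i.succ ≤ k

/-! ### Classical Gram-Schmidt procedures -/

/-- The quadratic form `-q`. In its Clifford algebra in Mathlib's convention, which is `Cl(V, q)`,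
one has `cl(v)² = -q(v, v)`, so that orthonormal systems give Clifford systems. -/
def negForm (V : Type u) [NormedAddCommGroup V] [InnerProductSpace ℝ V] : QuadraticForm ℝ V :=
  -(LinearMap.BilinMap.toQuadraticMap (innerₗ V))

instance cliffordFinite (V : Type u) [NormedAddCommGroup V] [InnerProductSpace ℝ V]
    [FiniteDimensional ℝ V] : FiniteDimensional ℝ (CliffordAlgebra (negForm V)) := by
  have : FiniteDimensional ℝ (ExteriorAlgebra ℝ V) :=
    Module.Finite.of_basis (Module.finBasis ℝ V).ExteriorAlgebra
  let _ : Invertible (2 : ℝ) := invertibleTwo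
  exact Module.Finite.equiv (CliffordAlgebra.equivExterior (negForm V)).symm

/-- `Cl(V, q)`, as a finite-dimensional algebra, is a convenient algebra. -/
instance cliffordConvenient (V : Type u) [NormedAddCommGroup V] [InnerProductSpace ℝ V]
    [FiniteDimensional ℝ V] : ConvenientAlgebra (CliffordAlgebra (negForm V)) :=
  trivialFiltration _

/-- The canonical map `cl : V → Cl(V, q)`. -/
def cl {V : Type u} [NormedAddCommGroup V] [InnerProductSpace ℝ V] (v : V) :
    CliffordAlgebra (negForm V) :=
  CliffordAlgebra.ι (negForm V) v

/-- (PGS) Permanence with respect to the Gram-Schmidt orthogonalization. -/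
def PermanenceGS {n : ℕ} (Ψ : Op.{u} n) : Prop :=
  ∀ (V : Type u) [NormedAddCommGroup V] [InnerProductSpace ℝ V] [FiniteDimensional ℝ V]
    (a : Fin n → V), LinearIndependent ℝ a →
    (fun k => cl (InnerProductSpace.gramSchmidtNormed ℝ a k)) ∈
      Ψ (CliffordAlgebra (negForm V)) (fun k => cl (a k))

/-- (PGS') Permanence with respect to the Gram-Schmidt conform-orthogonalization
`ǎ_k = (q(ã_1, ã_1) / q(ã_k, ã_k)) ^ (1/2) ã_k`, where `ã_1, ..., ã_{n+1}` are the orthogonal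
vectors obtained from the Gram-Schmidt process without normalization. -/
def PermanenceConformGS {n : ℕ} (Ψ : Op.{u} (n + 1)) : Prop :=
  ∀ (V : Type u) [NormedAddCommGroup V] [InnerProductSpace ℝ V] [FiniteDimensional ℝ V]
    (a : Fin (n + 1) → V), LinearIndependent ℝ a →
    (fun k => cl (Real.sqrt
        (inner ℝ (InnerProductSpace.gramSchmidt ℝ a 0) (InnerProductSpace.gramSchmidt ℝ a 0) /
          inner ℝ (InnerProductSpace.gramSchmidt ℝ a k) (InnerProductSpace.gramSchmidt ℝ a k)) •
        InnerProductSpace.gramSchmidt ℝ a k)) ∈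
      Ψ (CliffordAlgebra (negForm V)) (fun k => cl (a k))

end FQ

end

/-! The integral defining the inverse square root is traded for an algebraic description of
polarization. On each filtration quotient, realized inside a Banach algebra of operators (`rep`),
the integral F = S^(-1/2) satisfies F²S = 1 (`banachInvSqrt_sq_mul`), commutes with whatever
commutes with S, and SF has spectrum in the open right half-plane (`re_banachInvSqrt_pos`).
Therefore Q = pol H holds exactly when Q² = -1, Q commutes with H, and H + aQ - r is invertible for
all real r and a ≥ 0 (`IsPol`, `isPol_iff`). The last condition says that H has spectrum in the
upper half-plane where Q = i and in the lower half-plane where Q = -i. Uniqueness follows because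
two different candidates would be opposite on a nonzero piece, on which H could have no spectrum at
all.

This description is visibly stable under homomorphisms, positive scaling, real shifts, a common sign
change of H and Q, and addition of nonnegative multiples of Q. Gram-Schmidt becomes a list of such
conditions (`IsGS`), and the formal properties are short algebra. Values are Clifford systems
because conjugation by an X with X² = -1 that anticommutes with H turns pol H into pol(-H) = -pol H.
The parabolic property holds because antisymmetrization is linear and an earlier A_j is annihilated
by the antisymmetrization with respect to its own Q_j. Permanence combines the parabolic property
with the fixing of Clifford systems. The conform version is the same procedure for A_j A_1⁻¹, where
the first column of a triangular matrix contributes only harmless real scalars. Openness rests on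
the fact that invertibility is decided modulo `filt A 1` (`isUnit_iff_rep`), by geometric series.

For analyticity the recursion is run on formal power series over the free monoid algebra in letters
for Q_i and R_j, with the binomial series of exponent -1/2 in place of the integral. Clifford
relations reduce every word to the required form without changing its number of R-letters. A
weighted ℓ¹-norm controls the series on level 1. On higher levels, products that are small on level
1 lose only a polynomial factor in their length (`exists_norm_rep_list_prod_le`), so a smaller
radius gives convergence on all levels. The sum is recognized as the Gram-Schmidt value by `IsPol`
once more: its two equations are formal identities, and its invertibility condition follows from
closeness to Q on level 1 (`isPol_of_norm_le`). -/

noncomputable section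
namespace FQ

/-! ### Filtration quotients represented in Banach algebras. -/

section Levels

variable {A : Type u} [Ring A] [Algebra ℝ A] [ConvenientAlgebra A]

instance (i : ℕ) : FiniteDimensional ℝ (A ⧸ filt A i) := ConvenientAlgebra.finite_quotient i

theorem mul_mem_filt_left {i : ℕ} (a : A) {b : A} (hb : b ∈ filt A i) : a * b ∈ filt A i := by
  have := ConvenientAlgebra.mul_mem_filt (i := 0) (j := i) (a := a) (b := b)
    (by rw [ConvenientAlgebra.filt_zero]; trivial) hb
  rwa [zero_add] at this

theorem mul_mem_filt_right {i : ℕ} {a : A} (ha : a ∈ filt A i) (b : A) : a * b ∈ filt A i := by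
  have := ConvenientAlgebra.mul_mem_filt (i := i) (j := 0) (a := a) (b := b) ha
    (by rw [ConvenientAlgebra.filt_zero]; trivial)
  rwa [add_zero] at this

theorem eq_zero_of_forall_mem_filt {a : A} (h : ∀ i, a ∈ filt A i) : a = 0 := by
  have : a ∈ ⨅ i, filt A i := (Submodule.mem_iInf _).2 h
  rwa [ConvenientAlgebra.hausdorff, Submodule.mem_bot] at this

theorem pow_mem_filt {a : A} (ha : a ∈ filt A 1) (n : ℕ) : a ^ n ∈ filt A n := by
  induction n with
  | zero => simp [ConvenientAlgebra.filt_zero]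
  | succ n ih => rw [pow_succ]; exact ConvenientAlgebra.mul_mem_filt ih ha

variable (A) in
/-- The left regular representation on the `i`-th filtration quotient. -/
def quotientLmul (i : ℕ) : A →ₐ[ℝ] Module.End ℝ (A ⧸ filt A i) :=
  AlgHom.ofLinearMap
    { toFun := fun a => (filt A i).mapQ (filt A i) (LinearMap.mulLeft ℝ a)
        fun _ hx => mul_mem_filt_left a hx
      map_add' := fun a b => by
        refine Submodule.linearMap_qext _ (LinearMap.ext fun x => ?_)
        change (filt A i).mkQ ((a + b) * x) = (filt A i).mkQ (a * x) + (filt A i).mkQ (b * x)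
        rw [add_mul, map_add]
      map_smul' := fun c a => by
        refine Submodule.linearMap_qext _ (LinearMap.ext fun x => ?_)
        change (filt A i).mkQ ((c • a) * x) = c • (filt A i).mkQ (a * x)
        rw [smul_mul_assoc, map_smul] }
    (by
      refine Submodule.linearMap_qext _ (LinearMap.ext fun x => ?_)
      simp)
    (fun a b => by
      refine Submodule.linearMap_qext _ (LinearMap.ext fun x => ?_)
      change (filt A i).mkQ ((a * b) * x) = (filt A i).mkQ (a * (b * x))
      rw [mul_assoc])

theorem quotientLmul_mk (i : ℕ) (a b : A) :
    quotientLmul A i a ((filt A i).mkQ b) = (filt A i).mkQ (a * b) := rfl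

variable (A) in
/-- A finite-dimensional Banach algebra containing the `i`-th filtration quotient. -/
abbrev Level (i : ℕ) : Type :=
  EuclideanSpace ℝ (Fin (Module.finrank ℝ (A ⧸ filt A i))) →L[ℝ]
    EuclideanSpace ℝ (Fin (Module.finrank ℝ (A ⧸ filt A i)))

variable (A) in
/-- Coordinates on the `i`-th filtration quotient. -/
def quotientCoord (i : ℕ) :
    (A ⧸ filt A i) ≃ₗ[ℝ] EuclideanSpace ℝ (Fin (Module.finrank ℝ (A ⧸ filt A i))) :=
  (Module.finBasis ℝ (A ⧸ filt A i)).equivFun.trans (WithLp.linearEquiv 2 ℝ _).symm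

variable (A) in
/-- The left regular representation on the `i`-th filtration quotient, with values in a
Banach algebra. -/
def rep (i : ℕ) : A →ₐ[ℝ] Level A i :=
  ((Module.End.toContinuousLinearMap _).toAlgHom.comp
    ((quotientCoord A i).conjAlgEquiv ℝ).toAlgHom).comp (quotientLmul A i)

theorem rep_apply (i : ℕ) (a b : A) :
    rep A i a (quotientCoord A i ((filt A i).mkQ b)) =
      quotientCoord A i ((filt A i).mkQ (a * b)) := by
  change quotientCoord A i (quotientLmul A i a ((quotientCoord A i).symm
    (quotientCoord A i ((filt A i).mkQ b)))) = _
  rw [LinearEquiv.symm_apply_apply, quotientLmul_mk]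

variable (A) in
/-- The class of an element in the quotient can be read off from its representation. -/
def levelClass (i : ℕ) : Level A i →ₗ[ℝ] A ⧸ filt A i where
  toFun T := (quotientCoord A i).symm (T (quotientCoord A i ((filt A i).mkQ 1)))
  map_add' S T := by simp
  map_smul' c T := by simp

@[simp] theorem levelClass_rep (i : ℕ) (a : A) : levelClass A i (rep A i a) = (filt A i).mkQ a := by
  change (quotientCoord A i).symm (rep A i a _) = _
  rw [rep_apply, LinearEquiv.symm_apply_apply, mul_one]

/-- The image of the class of 1 recovers the class of a, and conversely `filt A i` is a right ideal,
so its elements act by zero. -/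
theorem rep_eq_zero_iff {i : ℕ} {a : A} : rep A i a = 0 ↔ a ∈ filt A i := by
  constructor
  · intro h
    have := levelClass_rep i a
    rw [h, map_zero, eq_comm, Submodule.mkQ_apply, Submodule.Quotient.mk_eq_zero] at this
    exact this
  · intro h
    ext1 x
    obtain ⟨y, rfl⟩ := (quotientCoord A i).surjective x
    obtain ⟨b, rfl⟩ := (filt A i).mkQ_surjective y
    have hb : (filt A i).mkQ (a * b) = 0 :=
      (Submodule.Quotient.mk_eq_zero _).2 (mul_mem_filt_right h b)
    rw [rep_apply, hb]
    simp

theorem rep_eq_iff {i : ℕ} {a b : A} : rep A i a = rep A i b ↔ a - b ∈ filt A i := by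
  rw [← rep_eq_zero_iff, map_sub, sub_eq_zero]

theorem eq_of_forall_rep {a b : A} (h : ∀ i, rep A i a = rep A i b) : a = b :=
  sub_eq_zero.1 (eq_zero_of_forall_mem_filt fun i => rep_eq_iff.1 (h i))

/-- Lifting of elements of the levels. -/
theorem exists_section (i : ℕ) : ∃ s : Level A i →ₗ[ℝ] A, ∀ a, rep A i (s (rep A i a)) = rep A i a := by
  obtain ⟨g, hg⟩ := (filt A i).mkQ.exists_rightInverse_of_surjective
    (LinearMap.range_eq_top.2 (filt A i).mkQ_surjective)
  refine ⟨g ∘ₗ levelClass A i, fun a => ?_⟩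
  rw [rep_eq_iff, ← Submodule.Quotient.mk_eq_zero, ← Submodule.mkQ_apply, map_sub, sub_eq_zero]
  simpa using LinearMap.congr_fun hg ((filt A i).mkQ a)

/-- Coherent elements of the levels come from an element of the algebra. -/
theorem exists_rep_eq (x : ℕ → A) (h : ∀ i, rep A i (x (i + 1)) = rep A i (x i)) :
    ∃ a : A, ∀ i, rep A i a = rep A i (x i) := by
  obtain ⟨a, ha⟩ := ConvenientAlgebra.complete x fun i => rep_eq_iff.1 (h i)
  exact ⟨a, fun i => rep_eq_iff.2 (ha i)⟩

theorem rep_eq_of_le {i j : ℕ} (hij : i ≤ j) {a b : A} (h : rep A j a = rep A j b) :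
    rep A i a = rep A i b :=
  rep_eq_iff.2 (ConvenientAlgebra.filt_antitone hij (rep_eq_iff.1 h))

/-- The partial geometric sums are coherent because n ^ i lies in `filt A i`; completeness supplies
their limit. -/
theorem isUnit_one_sub_of_mem_filt {n : A} (hn : n ∈ filt A 1) : IsUnit (1 - n) := by
  obtain ⟨a, ha⟩ := ConvenientAlgebra.complete (fun i => ∑ k ∈ Finset.range i, n ^ k) fun i => by
    simpa [Finset.sum_range_succ] using pow_mem_filt hn i
  have key : ∀ i, a - ∑ k ∈ Finset.range i, n ^ k ∈ filt A i := ha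
  have h1 : a * (1 - n) = 1 := by
    refine sub_eq_zero.1 (eq_zero_of_forall_mem_filt fun i => ?_)
    have : a * (1 - n) - 1 = (a - ∑ k ∈ Finset.range i, n ^ k) * (1 - n) - n ^ i := by
      rw [sub_mul, geom_sum_mul_neg]; abel
    rw [this]
    exact sub_mem (mul_mem_filt_right (key i) _) (pow_mem_filt hn i)
  have h2 : (1 - n) * a = 1 := by
    refine sub_eq_zero.1 (eq_zero_of_forall_mem_filt fun i => ?_)
    have : (1 - n) * a - 1 = (1 - n) * (a - ∑ k ∈ Finset.range i, n ^ k) - n ^ i := by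
      rw [mul_sub, mul_neg_geom_sum]; abel
    rw [this]
    exact sub_mem (mul_mem_filt_left _ (key i)) (pow_mem_filt hn i)
  exact ⟨⟨1 - n, a, h2, h1⟩, rfl⟩

/-- An inverse modulo `filt A 1` can be corrected to a true inverse by geometric series. This is why
domains depend only on the first quotient. -/
theorem isUnit_iff_rep {a : A} : IsUnit a ↔ IsUnit (rep A 1 a) := by
  refine ⟨fun h => h.map _, fun h => ?_⟩
  obtain ⟨u, hu⟩ := h
  let v := quotientCoord A 1 ((filt A 1).mkQ 1)
  -- The inverse operator need not come from the algebra a priori, but its value at the class of 1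
  -- is the class of some b, and then ab ≡ 1.
  obtain ⟨y, hy⟩ := (quotientCoord A 1).surjective ((↑u⁻¹ : Level A 1) v)
  obtain ⟨b, rfl⟩ := (filt A 1).mkQ_surjective y
  have hab : rep A 1 a * rep A 1 b = 1 := by
    rw [← map_mul, ← map_one (rep A 1), rep_eq_iff, ← Submodule.Quotient.mk_eq_zero,
      ← Submodule.mkQ_apply, map_sub, sub_eq_zero]
    apply (quotientCoord A 1).injective
    rw [← rep_apply, hy, ← hu, ← mul_apply_eq_comp, Units.mul_inv]
    rfl
  have hba : rep A 1 b * rep A 1 a = 1 := by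
    rw [← hu] at hab ⊢
    rw [← Units.mul_right_inj u, ← mul_assoc, hab]; simp
  have hab' : IsUnit (a * b) := by
    have := isUnit_one_sub_of_mem_filt (n := 1 - a * b)
      (rep_eq_iff.1 (by rw [map_one, map_mul, hab]))
    simpa using this
  have hba' : IsUnit (b * a) := by
    have := isUnit_one_sub_of_mem_filt (n := 1 - b * a)
      (rep_eq_iff.1 (by rw [map_one, map_mul, hba]))
    simpa using this
  obtain ⟨c, hc⟩ := hab'.exists_right_inv
  obtain ⟨d, hd⟩ := hba'.exists_left_inv
  have e : b * c = d * b := by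
    calc b * c = (d * (b * a)) * (b * c) := by rw [hd, one_mul]
      _ = d * b * (a * b * c) := by simp only [mul_assoc]
      _ = d * b := by rw [hc, mul_one]
  exact ⟨⟨a, b * c, by rw [← mul_assoc, hc], by rw [e, mul_assoc, hd]⟩, rfl⟩

theorem rep_inverse (i : ℕ) {a : A} (ha : IsUnit a) :
    rep A i (Ring.inverse a) = Ring.inverse (rep A i a) := by
  obtain ⟨u, rfl⟩ := ha
  rw [Ring.inverse_unit]
  exact (Ring.inverse_unit (Units.map (rep A i : A →* Level A i) u)).symm

/-- Since level 1 detects units, the default value 0 of `Ring.inverse` is matched as well, and no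
invertibility has to be assumed. -/
theorem rep_one_inverse (a : A) : rep A 1 (Ring.inverse a) = Ring.inverse (rep A 1 a) := by
  by_cases ha : IsUnit a
  · exact rep_inverse 1 ha
  · rw [Ring.inverse_non_unit _ ha, map_zero, Ring.inverse_non_unit _ (mt isUnit_iff_rep.2 ha)]

/-- Linear maps that vanish on `filt A i` are bounded by the norm on the `i`-th level. -/
theorem exists_bound_of_filt_le_ker {E : Type*} [NormedAddCommGroup E] [NormedSpace ℝ E] (i : ℕ)
    (g : A →ₗ[ℝ] E) (hg : ∀ a ∈ filt A i, g a = 0) : ∃ C, 0 ≤ C ∧ ∀ a, ‖g a‖ ≤ C * ‖rep A i a‖ := by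
  obtain ⟨s, hs⟩ := exists_section (A := A) i
  refine ⟨‖LinearMap.toContinuousLinearMap (g ∘ₗ s)‖, by positivity, fun a => ?_⟩
  have : g a = LinearMap.toContinuousLinearMap (g ∘ₗ s) (rep A i a) := by
    change g a = g (s (rep A i a))
    rw [← sub_eq_zero, ← map_sub]
    exact hg _ (rep_eq_iff.1 (hs a).symm)
  rw [this]
  exact ContinuousLinearMap.le_opNorm _ _

/-- Bilinear maps that vanish on `filt A i` and `filt A j` are bounded. -/
theorem exists_bound_of_filt_le_ker₂ {E : Type*} [NormedAddCommGroup E] [NormedSpace ℝ E]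
    (i j : ℕ) (g : A →ₗ[ℝ] A →ₗ[ℝ] E) (hi : ∀ a ∈ filt A i, g a = 0)
    (hj : ∀ a, ∀ b ∈ filt A j, g a b = 0) :
    ∃ C, 0 ≤ C ∧ ∀ a b, ‖g a b‖ ≤ C * ‖rep A i a‖ * ‖rep A j b‖ := by
  obtain ⟨s, hs⟩ := exists_section (A := A) j
  let G : A →ₗ[ℝ] (Level A j →L[ℝ] E) :=
    LinearMap.toContinuousLinearMap.toLinearMap ∘ₗ (LinearMap.lcomp ℝ E s) ∘ₗ g
  have hG : ∀ a ∈ filt A i, G a = 0 := fun a ha => by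
    ext x
    change g a (s x) = 0
    rw [hi a ha]
    rfl
  obtain ⟨C, hC, h⟩ := exists_bound_of_filt_le_ker (E := Level A j →L[ℝ] E) i G hG
  refine ⟨C, hC, fun a b => ?_⟩
  have : g a b = G a (rep A j b) := by
    change g a b = g a (s (rep A j b))
    rw [← sub_eq_zero, ← map_sub]
    exact hj _ _ (rep_eq_iff.1 (hs b).symm)
  rw [this]
  exact ((G a).le_opNorm _).trans (by gcongr; exact h a)

variable (A) in
theorem continuous_rep_levelTopology (i : ℕ) :
    @Continuous A (Level A i) (levelTopology A i) _ (rep A i) := by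
  let _ : TopologicalSpace (A ⧸ filt A i) := moduleTopology ℝ (A ⧸ filt A i)
  have : IsModuleTopology ℝ (A ⧸ filt A i) := ⟨rfl⟩
  let _ : TopologicalSpace A := levelTopology A i
  have hm : Continuous (filt A i).mkQ := continuous_induced_dom
  let g : (A ⧸ filt A i) →ₗ[ℝ] Level A i := (filt A i).liftQ (rep A i).toLinearMap
    fun a ha => rep_eq_zero_iff.2 ha
  have hg : Continuous g := IsModuleTopology.continuous_of_linearMap g
  exact hg.comp hm

variable (A) in
-- The quotient and its operator image are related by linear maps of finite-dimensional spaces in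
-- both directions, so the topologies of a convenient algebra can be handled by norms.
theorem levelTopology_eq_induced (i : ℕ) :
    levelTopology A i = TopologicalSpace.induced (rep A i) inferInstance := by
  apply le_antisymm
  · exact continuous_iff_le_induced.1 (continuous_rep_levelTopology A i)
  · let _ : TopologicalSpace (A ⧸ filt A i) := moduleTopology ℝ (A ⧸ filt A i)
    have : IsModuleTopology ℝ (A ⧸ filt A i) := ⟨rfl⟩
    have : ContinuousAdd (A ⧸ filt A i) := IsModuleTopology.toContinuousAdd ℝ _
    have : ContinuousSMul ℝ (A ⧸ filt A i) := inferInstance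
    have : IsTopologicalAddGroup (A ⧸ filt A i) := IsModuleTopology.topologicalAddGroup ℝ _
    have hc : Continuous (levelClass A i) := LinearMap.continuous_of_finiteDimensional _
    have : (filt A i).mkQ = fun a => levelClass A i (rep A i a) := by ext; simp
    change TopologicalSpace.induced (rep A i) inferInstance ≤
      TopologicalSpace.induced (filt A i).mkQ inferInstance
    rw [this, ← continuous_iff_le_induced]
    let _ : TopologicalSpace A := TopologicalSpace.induced (rep A i) inferInstance
    exact hc.comp continuous_induced_dom

theorem hasSum_infTopology {f : ℕ → A} {b : A}
    (h : ∀ i, HasSum (fun r => rep A i (f r)) (rep A i b)) :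
    @HasSum A ℕ _ (infTopology A) f b (.unconditional ℕ) := by
  unfold HasSum
  rw [nhds_iInf, Filter.tendsto_iInf]
  intro i
  rw [levelTopology_eq_induced, nhds_induced, Filter.tendsto_comap_iff]
  refine (h i).congr fun s => ?_
  simp

end Levels
end FQ
end

/-! ### The inverse square root integral in Banach algebras. -/

noncomputable section
namespace FQ
open Real Set Filter Topology MeasureTheory intervalIntegral

section Kernel

theorem sqrtKernel_eq {A : Type*} [Ring A] [Algebra ℝ A] (S : A) (t : ℝ) :
    sqrtKernel S t = 1 + (sin t ^ 2) • (S - 1) := by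
  rw [sqrtKernel, Algebra.algebraMap_eq_smul_one, cos_sq', sub_smul, one_smul, smul_sub]
  abel

/-- The number r sin² t is again a squared sine, so the kernels of the new element are among those
of S. This provides a path from 1 to S inside the domain. -/
theorem InvSqrtDom.segment {A : Type*} [Ring A] [Algebra ℝ A] {S : A} (hS : InvSqrtDom S) {r : ℝ}
    (hr : r ∈ Icc (0 : ℝ) 1) : InvSqrtDom (1 + r • (S - 1)) := by
  intro t
  have h1 : (1 : ℝ) - (sin t ^ 2 * r) ≥ 0 := by nlinarith [sin_sq_le_one t, sq_nonneg (sin t), hr.1, hr.2]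
  have h0 : 0 ≤ sin t ^ 2 * r := mul_nonneg (sq_nonneg _) hr.1
  have := hS (arcsin (sqrt (sin t ^ 2 * r)))
  rw [sqrtKernel_eq, sin_arcsin (by linarith [sqrt_nonneg (sin t ^ 2 * r)])
    (sqrt_le_one.2 (by linarith)), sq_sqrt h0] at this
  rw [sqrtKernel_eq]
  simpa [mul_smul] using this

theorem map_sqrtKernel {A B : Type*} [Ring A] [Algebra ℝ A] [Ring B] [Algebra ℝ B] (φ : A →ₐ[ℝ] B)
    (S : A) (t : ℝ) : φ (sqrtKernel S t) = sqrtKernel (φ S) t := by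
  simp [sqrtKernel]

theorem InvSqrtDom.map {A B : Type*} [Ring A] [Algebra ℝ A] [Ring B] [Algebra ℝ B]
    (φ : A →ₐ[ℝ] B) {S : A} (hS : InvSqrtDom S) : InvSqrtDom (φ S) := fun t => by
  rw [← map_sqrtKernel]
  exact (hS t).map φ

theorem map_ringInverse {A B : Type*} [Ring A] [Ring B]
    (φ : A →+* B) {a : A} (ha : IsUnit a) : φ (Ring.inverse a) = Ring.inverse (φ a) := by
  obtain ⟨u, rfl⟩ := ha
  rw [Ring.inverse_unit]
  exact (Ring.inverse_unit (Units.map (φ : A →* B) u)).symm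

end Kernel

section Banach

variable {E : Type*} [NormedRing E] [NormedAlgebra ℝ E]

/-- The integral `∫ (cos² t + S sin² t)⁻¹ dt / 2π` in a Banach algebra. -/
def banachInvSqrt (S : E) : E :=
  ∫ t in (0)..(2 * π), (2 * π)⁻¹ • Ring.inverse (sqrtKernel S t)

theorem continuous_sqrtKernel : Continuous fun p : E × ℝ => sqrtKernel p.1 p.2 := by
  simp only [sqrtKernel_eq]
  fun_prop

theorem continuous_ringInverse_comp {X E : Type*} [NormedRing E] [CompleteSpace E]
    [TopologicalSpace X] {f : X → E} (hf : Continuous f) (h : ∀ x, IsUnit (f x)) :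
    Continuous fun x => Ring.inverse (f x) := by
  refine continuous_iff_continuousAt.2 fun x => ?_
  obtain ⟨u, hu⟩ := h x
  exact ContinuousAt.comp (hu ▸ NormedRing.inverse_continuousAt u) hf.continuousAt

variable [CompleteSpace E]

theorem continuous_inverse_sqrtKernel {X : Type*} [TopologicalSpace X] {S : X → E}
    (hS : Continuous S) (h : ∀ x, InvSqrtDom (S x)) :
    Continuous fun p : X × ℝ => Ring.inverse (sqrtKernel (S p.1) p.2) :=
  continuous_ringInverse_comp (by simp only [sqrtKernel_eq]; fun_prop) fun p => h p.1 p.2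

theorem continuous_inverse_sqrtKernel_right {S : E} (hS : InvSqrtDom S) :
    Continuous fun t : ℝ => Ring.inverse (sqrtKernel S t) :=
  continuous_ringInverse_comp
    (by rw [show sqrtKernel S = _ from funext (sqrtKernel_eq S)]; fun_prop) hS

theorem intervalIntegrable_inverse_sqrtKernel {S : E} (hS : InvSqrtDom S) (c a b : ℝ) :
    IntervalIntegrable (fun t : ℝ => c • Ring.inverse (sqrtKernel S t)) volume a b :=
  ((continuous_inverse_sqrtKernel_right hS).const_smul _).intervalIntegrable _ _

theorem continuous_banachInvSqrt_comp {X : Type*} [TopologicalSpace X] [FirstCountableTopology X]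
    {S : X → E} (hS : Continuous S) (h : ∀ x, InvSqrtDom (S x)) :
    Continuous fun x => banachInvSqrt (S x) :=
  continuous_parametric_intervalIntegral_of_continuous'
    (f := fun x t => (2 * π)⁻¹ • Ring.inverse (sqrtKernel (S x) t))
    ((continuous_inverse_sqrtKernel hS h).const_smul _) _ _

/-- By periodicity only a compact interval of t matters, and the units form an open set. -/
theorem isOpen_invSqrtDom : IsOpen {S : E | InvSqrtDom S} := by
  have h : {S : E | InvSqrtDom S} = {S : E | ∀ t ∈ Icc (0 : ℝ) (2 * π), IsUnit (sqrtKernel S t)} := by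
    ext S
    refine ⟨fun h t _ => h t, fun h t => ?_⟩
    have hp : Function.Periodic (sqrtKernel S) (2 * π) := fun t => by simp [sqrtKernel]
    obtain ⟨y, hy, e⟩ := hp.exists_mem_Ico₀ two_pi_pos t
    rw [e]
    exact h y ⟨hy.1, hy.2.le⟩
  rw [h, isOpen_iff_eventually]
  intro S hS
  refine isCompact_Icc.eventually_forall_of_forall_eventually fun t ht => ?_
  exact (continuous_sqrtKernel (E := E)).continuousAt.eventually
    (Units.isOpen.mem_nhds (hS t ht))

theorem continuousAt_banachInvSqrt {S : E} (hS : InvSqrtDom S) : ContinuousAt banachInvSqrt S := by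
  have := continuous_banachInvSqrt_comp (X := {S : E | InvSqrtDom S}) continuous_subtype_val
    fun x => x.2
  exact (continuousOn_iff_continuous_domRestrict.2 this).continuousAt (isOpen_invSqrtDom.mem_nhds hS)

theorem map_banachInvSqrt {E' : Type*} [NormedRing E'] [NormedAlgebra ℝ E'] [CompleteSpace E']
    (φ : E →ₐ[ℝ] E') (hφ : Continuous φ) {S : E} (hS : InvSqrtDom S) :
    φ (banachInvSqrt S) = banachInvSqrt (φ S) := by
  let ψ : E →L[ℝ] E' := ⟨φ.toLinearMap, hφ⟩
  change ψ _ = _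
  rw [banachInvSqrt, ← ψ.intervalIntegral_comp_comm (intervalIntegrable_inverse_sqrtKernel hS _ _ _)]
  refine integral_congr fun t _ => ?_
  change φ _ = _
  rw [map_smul, ← map_sqrtKernel]
  congr 1
  exact map_ringInverse φ.toRingHom (hS t)

theorem Commute.banachInvSqrt_right {S T : E} (h : Commute T S) (hS : InvSqrtDom S) :
    Commute T (banachInvSqrt S) := by
  have hi := intervalIntegrable_inverse_sqrtKernel hS (2 * π)⁻¹ 0 (2 * π)
  have h1 := (ContinuousLinearMap.mul ℝ E T).intervalIntegral_comp_comm hi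
  have h2 := ((ContinuousLinearMap.mul ℝ E).flip T).intervalIntegral_comp_comm hi
  change T * banachInvSqrt S = banachInvSqrt S * T
  refine (h1.symm.trans (integral_congr fun t _ => ?_)).trans h2
  have hc : Commute T (sqrtKernel S t) := by
    rw [sqrtKernel_eq]
    exact (Commute.one_right T).add_right ((h.sub_right (Commute.one_right T)).smul_right _)
  have : Commute T (Ring.inverse (sqrtKernel S t)) := by
    obtain ⟨u, hu⟩ := hS t
    rw [← hu] at hc ⊢
    rw [Ring.inverse_unit]
    exact hc.units_inv_right
  simpa using (this.smul_right (2 * π)⁻¹).eq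

end Banach

section Comm

variable {E : Type*} [NormedCommRing E] [NormedAlgebra ℝ E] [CompleteSpace E]

theorem hasDerivAt_inverse_sqrtKernel {S : E} (hS : InvSqrtDom S) (t : ℝ) :
    HasDerivAt (fun t => Ring.inverse (sqrtKernel S t))
      (-(2 * sin t * cos t) • ((S - 1) * Ring.inverse (sqrtKernel S t) ^ 2)) t := by
  have hk : HasDerivAt (sqrtKernel S) ((2 * sin t * cos t) • (S - 1)) t := by
    have : sqrtKernel S = fun t => 1 + (sin t ^ 2) • (S - 1) := funext (sqrtKernel_eq S)
    rw [this]
    have h := (((hasDerivAt_sin t).pow 2).smul_const (S - 1)).const_add 1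
    simpa using h
  obtain ⟨u, hu⟩ := hS t
  have h1 := hasFDerivAt_ringInverse (𝕜 := ℝ) u
  rw [hu] at h1
  have h2 := h1.comp_hasDerivAt t hk
  refine h2.congr_deriv ?_
  rw [← hu, Ring.inverse_unit]
  simp only [neg_apply, ContinuousLinearMap.mulLeftRight_apply, neg_smul,
    mul_smul_comm, smul_mul_assoc]
  congr 2
  ring

/-- With R = (cos² t + S sin² t)⁻¹, the periodic function sin t cos t R has derivative R - 2S sin² t
R², whose integral over a period vanishes. -/
theorem two_mul_integral_sin_sq {S : E} (hS : InvSqrtDom S) :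
    banachInvSqrt S = 2 * S * ∫ t in (0)..(2 * π),
      (2 * π)⁻¹ • (sin t ^ 2) • Ring.inverse (sqrtKernel S t) ^ 2 := by
  have hR := continuous_inverse_sqrtKernel_right hS
  have hd : ∀ t ∈ uIcc 0 (2 * π), HasDerivAt (fun t => (sin t * cos t) • Ring.inverse (sqrtKernel S t))
      (Ring.inverse (sqrtKernel S t) -
        (2 * S) * ((sin t ^ 2) • Ring.inverse (sqrtKernel S t) ^ 2)) t := by
    intro t _
    have h1 := ((hasDerivAt_sin t).mul (hasDerivAt_cos t)).smul (hasDerivAt_inverse_sqrtKernel hS t)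
    refine h1.congr_deriv ?_
    set R := Ring.inverse (sqrtKernel S t) with hRdef
    have hu : sqrtKernel S t * R = 1 := Ring.mul_inverse_cancel _ (hS t)
    have hk : (algebraMap ℝ E (cos t) ^ 2 + algebraMap ℝ E (sin t) ^ 2 * S) * R = 1 := by
      rw [← hu, sqrtKernel, Algebra.smul_def, map_pow, map_pow]
    have hcs : algebraMap ℝ E (cos t) ^ 2 + algebraMap ℝ E (sin t) ^ 2 = 1 := by
      rw [← map_pow, ← map_pow, ← map_add, cos_sq_add_sin_sq, map_one]
    simp only [Algebra.smul_def, map_mul, map_neg, map_pow, map_add, map_ofNat, Pi.mul_apply]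
    generalize algebraMap ℝ E (cos t) = c at *
    generalize algebraMap ℝ E (sin t) = s at *
    clear_value R
    linear_combination (R - 2 * s ^ 2 * S * R ^ 2) * hcs + 2 * s ^ 2 * R * hk
  have h0 := integral_eq_sub_of_hasDerivAt hd (by
    refine Continuous.intervalIntegrable ?_ _ _
    fun_prop)
  have hi1 : IntervalIntegrable (fun t => Ring.inverse (sqrtKernel S t)) volume 0 (2 * π) :=
    hR.intervalIntegrable _ _
  have hi2 : IntervalIntegrable (fun t => (sin t ^ 2) • Ring.inverse (sqrtKernel S t) ^ 2) volume
    0 (2 * π) := Continuous.intervalIntegrable (by fun_prop) _ _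
  have h3 := (ContinuousLinearMap.mul ℝ E (2 * S)).intervalIntegral_comp_comm hi2
  simp only [ContinuousLinearMap.mul_apply'] at h3
  rw [integral_sub hi1 (Continuous.intervalIntegrable (by fun_prop) _ _), h3] at h0
  simp only [sin_two_pi, sin_zero, zero_mul, zero_smul, sub_zero] at h0
  rw [banachInvSqrt, intervalIntegral.integral_smul, intervalIntegral.integral_smul, sub_eq_zero.1 h0, mul_smul_comm]

theorem banachInvSqrt_one : banachInvSqrt (1 : E) = 1 := by
  have : ∀ t, sqrtKernel (1 : E) t = 1 := fun t => by simp [sqrtKernel_eq]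
  simp only [banachInvSqrt, this, Ring.inverse_one, intervalIntegral.integral_const, sub_zero, smul_smul]
  rw [mul_inv_cancel₀ two_pi_pos.ne', one_smul]

/-- Along the segment T from 1 to S the function T^(-1/2) squared times T has derivative zero, and
it equals 1 at the start. -/
theorem banachInvSqrt_sq_mul {S : E} (hS : InvSqrtDom S) : banachInvSqrt S ^ 2 * S = 1 := by
  let T : ℝ → E := fun r => 1 + r • (S - 1)
  have hT : ∀ r ∈ Icc (0 : ℝ) 1, InvSqrtDom (T r) := fun r hr => hS.segment hr
  have hTc : Continuous T := by fun_prop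
  let Ψ : ℝ → ℝ → E := fun r s => ∫ t in (0)..(2 * π), (2 * π)⁻¹ • (sin t ^ 2) •
    (Ring.inverse (sqrtKernel (T r) t) * Ring.inverse (sqrtKernel (T s) t))
  have hΨ : ∀ r ∈ Icc (0 : ℝ) 1, ContinuousOn (Ψ r) (Icc (0 : ℝ) 1) := by
    intro r hr
    rw [continuousOn_iff_continuous_domRestrict]
    have h2 := continuous_inverse_sqrtKernel (X := Icc (0 : ℝ) 1) (S := fun x => T x)
      (hTc.comp continuous_subtype_val) (fun x => hT x x.2)
    have h1 := continuous_inverse_sqrtKernel_right (hT r hr)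
    refine continuous_parametric_intervalIntegral_of_continuous'
      (f := fun (s : Icc (0 : ℝ) 1) t => (2 * π)⁻¹ • (sin t ^ 2) •
        (Ring.inverse (sqrtKernel (T r) t) * Ring.inverse (sqrtKernel (T s) t))) ?_ _ _
    change Continuous fun p : Icc (0 : ℝ) 1 × ℝ => (2 * π)⁻¹ • (sin p.2 ^ 2) •
        (Ring.inverse (sqrtKernel (T r) p.2) * Ring.inverse (sqrtKernel (T p.1) p.2))
    have h3 := h1.comp (continuous_snd (X := Icc (0 : ℝ) 1) (Y := ℝ))
    simp only [Function.comp_def] at h3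
    fun_prop
  -- Resolvent identity under the integral: it gives an exact difference quotient, so the derivative
  -- needs only continuity of `Ψ r`.
  have hdiff : ∀ r ∈ Icc (0 : ℝ) 1, ∀ s ∈ Icc (0 : ℝ) 1,
      banachInvSqrt (T s) - banachInvSqrt (T r) = (s - r) • (-(S - 1) * Ψ r s) := by
    intro r hr s hs
    have hi := intervalIntegrable_inverse_sqrtKernel (hT r hr) (2 * π)⁻¹ 0 (2 * π)
    have hi' := intervalIntegrable_inverse_sqrtKernel (hT s hs) (2 * π)⁻¹ 0 (2 * π)
    have hc1 := continuous_inverse_sqrtKernel_right (hT r hr)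
    have hc2 := continuous_inverse_sqrtKernel_right (hT s hs)
    have hi2 : IntervalIntegrable (fun t => (2 * π)⁻¹ • (sin t ^ 2) •
      (Ring.inverse (sqrtKernel (T r) t) * Ring.inverse (sqrtKernel (T s) t))) volume
      0 (2 * π) := Continuous.intervalIntegrable (by fun_prop) _ _
    have h3 := (ContinuousLinearMap.mul ℝ E ((s - r) • -(S - 1))).intervalIntegral_comp_comm hi2
    simp only [ContinuousLinearMap.mul_apply'] at h3
    rw [banachInvSqrt, banachInvSqrt, ← integral_sub hi' hi, ← smul_mul_assoc, ← h3]
    refine integral_congr fun t _ => ?_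
    rw [← smul_sub, Ring.inverse_sub_inverse (iff_of_true (hT s hs t) (hT r hr t))]
    simp only [sqrtKernel_eq, T, Algebra.smul_def, map_sub]
    ring
  have hder : ∀ r ∈ Icc (0 : ℝ) 1, HasDerivWithinAt (fun s => banachInvSqrt (T s))
      (-(S - 1) * Ψ r r) (Icc 0 1) r := by
    intro r hr
    rw [hasDerivWithinAt_iff_tendsto_slope]
    have : Tendsto (fun s => -(S - 1) * Ψ r s) (𝓝[Icc 0 1 \ {r}] r) (𝓝 (-(S - 1) * Ψ r r)) :=
      (((hΨ r hr) r hr).mono sdiff_subset).const_mul _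
    refine this.congr' ?_
    filter_upwards [self_mem_nhdsWithin] with s hs
    rw [slope_def_module, hdiff r hr s hs.1, inv_smul_smul₀ (sub_ne_zero.2 hs.2)]
  have hder2 : ∀ r ∈ Icc (0 : ℝ) 1, HasDerivWithinAt (fun s => banachInvSqrt (T s) ^ 2 * T s)
      0 (Icc 0 1) r := by
    intro r hr
    have hT' : HasDerivWithinAt T (S - 1) (Icc 0 1) r := by
      have := (((hasDerivAt_id r).smul_const (S - 1)).const_add 1).hasDerivWithinAt (s := Icc 0 1)
      simpa [T] using this
    have h := ((hder r hr).pow 2).mul hT'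
    refine h.congr_deriv ?_
    -- Replacing one factor of the square by the integration-by-parts formula makes the two terms of
    -- the product rule cancel.
    have e : banachInvSqrt (T r) = 2 * T r * Ψ r r := by
      rw [two_mul_integral_sin_sq (hT r hr)]
      simp only [Ψ, pow_two]
    simp only [Pi.pow_apply]
    rw [show banachInvSqrt (T r) ^ 2 * (S - 1) =
      banachInvSqrt (T r) * (2 * T r * Ψ r r) * (S - 1) by rw [← e]; ring]
    norm_num
    ring
  have hconst := constant_of_derivWithin_zero (f := fun s => banachInvSqrt (T s) ^ 2 * T s)
    (a := 0) (b := 1) (fun r hr => (hder2 r hr).differentiableWithinAt)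
    (fun r hr => (hder2 r (Ico_subset_Icc_self hr)).derivWithin
      (uniqueDiffOn_Icc zero_lt_one r (Ico_subset_Icc_self hr))) 1 (right_mem_Icc.2 zero_le_one)
  simpa [T, banachInvSqrt_one] using hconst

end Comm
end FQ
end

/-! ### Location of the spectrum of the square root. -/

noncomputable section
namespace FQ
open Real Set Filter Topology MeasureTheory intervalIntegral

section Positivity

/-- The integrand shows that Im f and Im z have opposite signs, while f² = 1/z makes the same true
of Re f · Im f and Im z; hence Re f > 0 off the real axis. For real z, f is real, so f²z = 1 forces
z > 0 and the integrand is nonnegative. -/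
theorem re_banachInvSqrt_pos {z : ℂ} (hz : InvSqrtDom z) : 0 < (banachInvSqrt z).re := by
  set f := banachInvSqrt z with hf
  have hfz : f ^ 2 * z = 1 := banachInvSqrt_sq_mul hz
  have hi := intervalIntegrable_inverse_sqrtKernel hz (2 * π)⁻¹ 0 (2 * π)
  have hk : ∀ t, sqrtKernel z t = ⟨cos t ^ 2 + sin t ^ 2 * z.re, sin t ^ 2 * z.im⟩ := fun t => by
    rw [sqrtKernel]
    apply Complex.ext <;> simp [-Complex.ofReal_pow]
  have him : f.im = ∫ t in (0)..(2 * π),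
      (2 * π)⁻¹ * (-(sin t ^ 2 * z.im) / Complex.normSq (sqrtKernel z t)) := by
    rw [hf, banachInvSqrt, ← Complex.imCLM_apply, ← Complex.imCLM.intervalIntegral_comp_comm hi]
    refine integral_congr fun t _ => ?_
    simp only [Ring.inverse_eq_inv', Complex.imCLM_apply, Complex.smul_im, Complex.inv_im, hk,
      smul_eq_mul]
  have hre : f.re = ∫ t in (0)..(2 * π),
      (2 * π)⁻¹ * ((cos t ^ 2 + sin t ^ 2 * z.re) / Complex.normSq (sqrtKernel z t)) := by
    rw [hf, banachInvSqrt, ← Complex.reCLM_apply, ← Complex.reCLM.intervalIntegral_comp_comm hi]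
    refine integral_congr fun t _ => ?_
    simp only [Ring.inverse_eq_inv', Complex.reCLM_apply, Complex.smul_re, Complex.inv_re, hk,
      smul_eq_mul]
  have h1 : z.im ≤ 0 → 0 ≤ f.im := fun h => by
    rw [him]
    refine integral_nonneg two_pi_pos.le fun t _ => ?_
    exact mul_nonneg (by positivity) (div_nonneg (by nlinarith [sq_nonneg (sin t)])
      (Complex.normSq_nonneg _))
  have h2 : 0 ≤ z.im → f.im ≤ 0 := fun h => by
    rw [← neg_nonneg, him, ← intervalIntegral.integral_neg]
    refine integral_nonneg two_pi_pos.le fun t _ => ?_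
    rw [← mul_neg, ← neg_div, neg_neg]
    exact mul_nonneg (by positivity) (div_nonneg (by positivity) (Complex.normSq_nonneg _))
  have h3 : 0 < z.re → 0 ≤ f.re := fun h => by
    rw [hre]
    refine integral_nonneg two_pi_pos.le fun t _ => ?_
    exact mul_nonneg (by positivity) (div_nonneg (by positivity) (Complex.normSq_nonneg _))
  have e1 := congrArg Complex.re hfz
  have e2 := congrArg Complex.im hfz
  simp only [pow_two, Complex.mul_re, Complex.mul_im, Complex.one_re, Complex.one_im] at e1 e2
  -- This is the imaginary part of f² = z̄ / |z|².
  have e3 : 0 = z.im + 2 * f.re * f.im * Complex.normSq z := by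
    rw [Complex.normSq_apply]; linear_combination z.im * e1 - z.re * e2
  have hz0 : 0 < Complex.normSq z := Complex.normSq_pos.2 fun h => by simp [h] at hfz
  rcases lt_trichotomy z.im 0 with h | h | h
  · have := h1 h.le
    by_contra! hc
    nlinarith [mul_nonneg (mul_nonneg (neg_nonneg.2 hc) this) hz0.le]
  · have hf0 : f.im = 0 := le_antisymm (h2 h.ge) (h1 h.le)
    rw [hf0, h] at e1
    have e4 : f.re ^ 2 * z.re = 1 := by linear_combination e1
    have hfr : f.re ≠ 0 := fun h0 => by simp [h0] at e4
    have : 0 < z.re := by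
      by_contra! hc
      nlinarith [mul_nonneg (sq_nonneg f.re) (neg_nonneg.2 hc)]
    exact lt_of_le_of_ne (h3 this) hfr.symm
  · have := h2 h.le
    by_contra! hc
    nlinarith [mul_nonneg (mul_nonneg (neg_nonneg.2 hc) (neg_nonneg.2 this)) hz0.le]

/-- A non-unit lies in a maximal ideal, hence in the kernel of a character χ to ℂ. With f =
χ(S)^(-1/2), the element would map to (1/f + a)² + r², whose factors 1/f + a ± ir have positive real
part. -/
theorem isUnit_sqrt_add_sq_add_sq_of_comm {E : Type*} [NormedCommRing E] [NormedAlgebra ℝ E]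
    [FiniteDimensional ℝ E] [CompleteSpace E] {S : E} (hS : InvSqrtDom S) {a : ℝ} (ha : 0 ≤ a)
    (r : ℝ) :
    IsUnit ((S * banachInvSqrt S + algebraMap ℝ E a) ^ 2 + algebraMap ℝ E r ^ 2) := by
  by_contra hn
  obtain ⟨m, hm, hmem⟩ := exists_max_ideal_of_mem_nonunits hn
  let _ : Field (E ⧸ m) := Ideal.Quotient.field m
  have : FiniteDimensional ℝ (E ⧸ m) :=
    Module.Finite.of_surjective (Ideal.Quotient.mkₐ ℝ m).toLinearMap Ideal.Quotient.mk_surjective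
  let χ : E →ₐ[ℝ] ℂ := (IsAlgClosed.lift (R := ℝ) (S := E ⧸ m) (M := ℂ)).comp (Ideal.Quotient.mkₐ ℝ m)
  have hχ : Continuous χ := χ.toLinearMap.continuous_of_finiteDimensional
  have h0 : χ ((S * banachInvSqrt S + algebraMap ℝ E a) ^ 2 + algebraMap ℝ E r ^ 2) = 0 := by
    have h : Ideal.Quotient.mkₐ ℝ m
        ((S * banachInvSqrt S + algebraMap ℝ E a) ^ 2 + algebraMap ℝ E r ^ 2) = 0 :=
      Ideal.Quotient.eq_zero_iff_mem.2 hmem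
    rw [AlgHom.comp_apply, h, map_zero]
  have hz : InvSqrtDom (χ S) := hS.map χ
  have hpos := re_banachInvSqrt_pos hz
  have hsq := banachInvSqrt_sq_mul hz
  rw [map_add, map_pow, map_add, map_mul, map_banachInvSqrt χ hχ hS, map_pow, AlgHom.commutes,
    AlgHom.commutes] at h0
  set f := banachInvSqrt (χ S)
  have hf : f ≠ 0 := fun h => by simp [h] at hpos
  have hSf : χ S * f = f⁻¹ := by
    field_simp
    linear_combination hsq
  have hp : 0 < (f⁻¹).re := by
    rw [Complex.inv_re]
    exact div_pos hpos (Complex.normSq_pos.2 hf)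
  rw [hSf] at h0
  have h1 : (f⁻¹ + a + r * Complex.I) * (f⁻¹ + a - r * Complex.I) = 0 := by
    have hI := Complex.I_sq
    simp only [Complex.coe_algebraMap] at h0
    linear_combination h0 - (r : ℂ) ^ 2 * hI
  rcases mul_eq_zero.1 h1 with h | h
  · have := congrArg Complex.re h
    simp at this
    linarith [Complex.inv_re f]
  · have := congrArg Complex.re h
    simp at this
    linarith [Complex.inv_re f]

/-- Multiplication by x is injective on the subalgebra, hence surjective by finite dimension, so the
inverse stays inside. -/
theorem _root_.Subalgebra.isUnit_of_finiteDimensional {E : Type*} [Ring E] [Algebra ℝ E]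
    [FiniteDimensional ℝ E] (C : Subalgebra ℝ E) {x : C} (hx : IsUnit (x : E)) : IsUnit x := by
  have hinj : Function.Injective (LinearMap.mulLeft ℝ x) := fun y z h => by
    have : (x : E) * y = x * z := congrArg Subtype.val h
    exact Subtype.ext (hx.mul_left_cancel this)
  obtain ⟨y, hy⟩ := LinearMap.surjective_of_injective hinj 1
  have hxy : x * y = 1 := hy
  refine ⟨⟨x, y, hxy, Subtype.ext (hx.mul_left_cancel ?_)⟩, rfl⟩
  have : (x : E) * y = 1 := congrArg Subtype.val hxy
  change (x : E) * (y * x) = x * 1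
  rw [← mul_assoc, this, one_mul, mul_one]

/-- The integral can be computed in the closed subalgebra generated by S, which is commutative. -/
theorem banachInvSqrt_properties {E : Type*} [NormedRing E] [NormedAlgebra ℝ E]
    [FiniteDimensional ℝ E] [CompleteSpace E] {S : E} (hS : InvSqrtDom S) :
    banachInvSqrt S ^ 2 * S = 1 ∧ ∀ a : ℝ, 0 ≤ a → ∀ r : ℝ,
      IsUnit ((S * banachInvSqrt S + algebraMap ℝ E a) ^ 2 + algebraMap ℝ E r ^ 2) := by
  let C := Algebra.elemental ℝ S
  let _ : NormedCommRing C :=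
    { (inferInstance : NormedRing C) with mul_comm := mul_comm }
  let T : C := ⟨S, Algebra.elemental.self_mem ℝ S⟩
  have hT : InvSqrtDom T := fun t => by
    refine C.isUnit_of_finiteDimensional ?_
    have := map_sqrtKernel C.val T t
    change IsUnit (C.val (sqrtKernel T t))
    rw [this]
    exact hS t
  have e := map_banachInvSqrt C.val continuous_subtype_val hT
  change C.val (banachInvSqrt T) = banachInvSqrt S at e
  constructor
  · rw [← e]
    exact congrArg C.val (banachInvSqrt_sq_mul hT)
  · intro a ha r
    have := (isUnit_sqrt_add_sq_add_sq_of_comm hT ha r).map C.val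
    simp only [map_add, map_pow, map_mul, AlgHom.commutes, e] at this
    exact this

end Positivity

/-! ### The inverse square root in convenient algebras. -/

section Convenient

variable {A : Type u} [Ring A] [Algebra ℝ A] [ConvenientAlgebra A]

theorem InvSqrtDom.rep {S : A} (hS : InvSqrtDom S) (i : ℕ) : InvSqrtDom (rep A i S) :=
  hS.map _

theorem invSqrtDom_iff_rep {S : A} : InvSqrtDom S ↔ InvSqrtDom (rep A 1 S) := by
  refine ⟨fun h => h.rep 1, fun h t => ?_⟩
  rw [isUnit_iff_rep, map_sqrtKernel]
  exact h t

/-- Functionals on a quotient factor through the Banach level, where they commute with the integral,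
and they separate points. -/
theorem isAlgIntegral_iff {S x : A} (hS : InvSqrtDom S) :
    IsAlgIntegral (fun t => (2 * π)⁻¹ • Ring.inverse (sqrtKernel S t)) 0 (2 * π) x ↔
      ∀ i, levelClass A i (banachInvSqrt (rep A i S)) = (filt A i).mkQ x := by
  have key : ∀ (i : ℕ) (l : Module.Dual ℝ (A ⧸ filt A i)), IntervalIntegrable
      (fun t => l ((filt A i).mkQ ((2 * π)⁻¹ • Ring.inverse (sqrtKernel S t)))) volume 0 (2 * π) ∧
      ∫ t in (0)..(2 * π), l ((filt A i).mkQ ((2 * π)⁻¹ • Ring.inverse (sqrtKernel S t))) =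
        l (levelClass A i (banachInvSqrt (rep A i S))) := by
    intro i l
    let g : Level A i →L[ℝ] ℝ := LinearMap.toContinuousLinearMap (l ∘ₗ levelClass A i)
    have hi := intervalIntegrable_inverse_sqrtKernel (hS.rep i) (2 * π)⁻¹ 0 (2 * π)
    have e : (fun t => l ((filt A i).mkQ ((2 * π)⁻¹ • Ring.inverse (sqrtKernel S t)))) =
        fun t => g ((2 * π)⁻¹ • Ring.inverse (sqrtKernel (FQ.rep A i S) t)) := by
      funext t
      rw [← map_sqrtKernel, ← rep_inverse i (hS t), ← map_smul]
      change _ = l (levelClass A i (FQ.rep A i _))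
      rw [levelClass_rep]
    have hc := continuous_inverse_sqrtKernel_right (hS.rep i)
    have hgc : Continuous fun t => g ((2 * π)⁻¹ • Ring.inverse (sqrtKernel (FQ.rep A i S) t)) :=
      g.continuous.comp (hc.const_smul (2 * π)⁻¹)
    rw [e]
    exact ⟨hgc.intervalIntegrable _ _, g.intervalIntegral_comp_comm hi⟩
  constructor
  · intro h i
    rw [← sub_eq_zero, ← Module.forall_dual_apply_eq_zero_iff ℝ]
    intro l
    rw [map_sub, sub_eq_zero, ← (key i l).2, (h i l).2]
  · intro h i l
    refine ⟨(key i l).1, ?_⟩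
    rw [(key i l).2, h]

/-- The quotient maps between levels carry the level integrals into each other, so completeness
produces a common lift. Thus the default value of `algIntegral` does not occur. -/
theorem isAlgIntegral_invSqrt {S : A} (hS : InvSqrtDom S) :
    IsAlgIntegral (fun t => (2 * π)⁻¹ • Ring.inverse (sqrtKernel S t)) 0 (2 * π) (invSqrt S) := by
  have hex : ∃ x, IsAlgIntegral (fun t => (2 * π)⁻¹ • Ring.inverse (sqrtKernel S t)) 0 (2 * π) x := by
    choose x hx using fun i => (filt A i).mkQ_surjective
      (levelClass A i (banachInvSqrt (FQ.rep A i S)))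
    have hcoh : ∀ i, FQ.rep A i (x (i + 1)) = FQ.rep A i (x i) := by
      intro i
      rw [rep_eq_iff, ← Submodule.Quotient.mk_eq_zero, ← Submodule.mkQ_apply, map_sub,
        sub_eq_zero, hx i]
      let φ : (A ⧸ filt A (i + 1)) →ₗ[ℝ] A ⧸ filt A i :=
        Submodule.factor (ConvenientAlgebra.filt_antitone (Nat.le_succ i))
      have e1 : (filt A i).mkQ (x (i + 1)) = φ ((filt A (i + 1)).mkQ (x (i + 1))) := rfl
      rw [e1, hx (i + 1)]
      let g1 : Level A (i + 1) →L[ℝ] EuclideanSpace ℝ (Fin (Module.finrank ℝ (A ⧸ filt A i))) :=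
        LinearMap.toContinuousLinearMap ((quotientCoord A i).toLinearMap ∘ₗ φ ∘ₗ levelClass A (i + 1))
      let g2 : Level A i →L[ℝ] EuclideanSpace ℝ (Fin (Module.finrank ℝ (A ⧸ filt A i))) :=
        LinearMap.toContinuousLinearMap ((quotientCoord A i).toLinearMap ∘ₗ levelClass A i)
      apply (quotientCoord A i).injective
      change g1 _ = g2 _
      rw [banachInvSqrt, banachInvSqrt, ← g1.intervalIntegral_comp_comm
        (intervalIntegrable_inverse_sqrtKernel (hS.rep (i + 1)) _ _ _),
        ← g2.intervalIntegral_comp_comm (intervalIntegrable_inverse_sqrtKernel (hS.rep i) _ _ _)]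
      refine integral_congr fun t _ => ?_
      rw [← map_sqrtKernel, ← map_sqrtKernel, ← rep_inverse _ (hS t), ← rep_inverse _ (hS t),
        ← map_smul, ← map_smul]
      change quotientCoord A i (φ (levelClass A (i + 1) (FQ.rep A (i + 1) _))) =
        quotientCoord A i (levelClass A i (FQ.rep A i _))
      rw [levelClass_rep, levelClass_rep]
      rfl
    obtain ⟨a, ha⟩ := exists_rep_eq x hcoh
    refine ⟨a, (isAlgIntegral_iff hS).2 fun i => ?_⟩
    rw [← hx, ← levelClass_rep, ← levelClass_rep, ha]
  rw [invSqrt, algIntegral, dif_pos hex]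
  exact hex.choose_spec

/-- The quotient integral determines only the action on the class of 1; the action on the class of b
follows by multiplying by b from the right under the integral. -/
theorem rep_invSqrt {S : A} (hS : InvSqrtDom S) (i : ℕ) :
    rep A i (invSqrt S) = banachInvSqrt (rep A i S) := by
  have h := isAlgIntegral_invSqrt hS
  ext1 v
  obtain ⟨y, rfl⟩ := (quotientCoord A i).surjective v
  obtain ⟨b, rfl⟩ := (filt A i).mkQ_surjective y
  set V := EuclideanSpace ℝ (Fin (Module.finrank ℝ (A ⧸ filt A i)))
  let w : V := quotientCoord A i ((filt A i).mkQ b)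
  let ev : Level A i →L[ℝ] V := ContinuousLinearMap.apply ℝ V w
  let ρ : (A ⧸ filt A i) →ₗ[ℝ] A ⧸ filt A i := (filt A i).mapQ (filt A i) (LinearMap.mulRight ℝ b)
        fun _ hx => mul_mem_filt_right hx b
  let g : Level A i →L[ℝ] V := LinearMap.toContinuousLinearMap
    ((quotientCoord A i).toLinearMap ∘ₗ ρ ∘ₗ levelClass A i)
  have hg : ∀ a, g (FQ.rep A i a) = ev (FQ.rep A i a) := fun a => by
    change quotientCoord A i (ρ (levelClass A i (FQ.rep A i a))) =
      FQ.rep A i a (quotientCoord A i ((filt A i).mkQ b))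
    rw [levelClass_rep, rep_apply]
    rfl
  have h1 : g (banachInvSqrt (FQ.rep A i S)) = ev (banachInvSqrt (FQ.rep A i S)) := by
    have hi := intervalIntegrable_inverse_sqrtKernel (hS.rep i) (2 * π)⁻¹ 0 (2 * π)
    rw [banachInvSqrt, ← g.intervalIntegral_comp_comm hi, ← ev.intervalIntegral_comp_comm hi]
    refine integral_congr fun t _ => ?_
    rw [← map_sqrtKernel, ← rep_inverse _ (hS t), ← map_smul, hg]
  change ev (FQ.rep A i (invSqrt S)) = ev (banachInvSqrt (FQ.rep A i S))
  rw [← h1, ← hg]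
  change quotientCoord A i (ρ (levelClass A i _)) = quotientCoord A i (ρ (levelClass A i _))
  rw [levelClass_rep, (isAlgIntegral_iff hS).1 h i]

theorem invSqrt_sq_mul {S : A} (hS : InvSqrtDom S) : invSqrt S ^ 2 * S = 1 := by
  refine eq_of_forall_rep fun i => ?_
  rw [map_mul, map_pow, rep_invSqrt hS, map_one]
  exact (banachInvSqrt_properties (hS.rep i)).1

theorem commute_invSqrt {S T : A} (hS : InvSqrtDom S) (h : Commute T S) :
    Commute T (invSqrt S) := by
  refine eq_of_forall_rep fun i => ?_
  rw [map_mul, map_mul, rep_invSqrt hS]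
  exact Commute.banachInvSqrt_right (h.map (FQ.rep A i)) (hS.rep i)

theorem isUnit_sqrt_add_sq_add_sq {S : A} (hS : InvSqrtDom S) {a : ℝ} (ha : 0 ≤ a) (r : ℝ) :
    IsUnit ((S * invSqrt S + algebraMap ℝ A a) ^ 2 + algebraMap ℝ A r ^ 2) := by
  rw [isUnit_iff_rep]
  simp only [map_add, map_pow, map_mul, AlgHom.commutes, rep_invSqrt hS]
  exact (banachInvSqrt_properties (hS.rep 1)).2 a ha r

end Convenient
end FQ
end

/-! ### Algebraic characterization of polarization. -/

noncomputable section
namespace FQ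
open Real

/-- The algebraic characterization of `Q = pol H`. -/
def IsPol {A : Type*} [Ring A] [Algebra ℝ A] (H Q : A) : Prop :=
  Q * Q = -1 ∧ Commute Q H ∧ ∀ a : ℝ, 0 ≤ a → ∀ r : ℝ, IsUnit (H + a • Q - algebraMap ℝ A r)

section Algebraic

variable {A : Type*} [Ring A] [Algebra ℝ A]

theorem IsPol.map {B : Type*} [Ring B] [Algebra ℝ B] (φ : A →ₐ[ℝ] B) {H Q : A} (h : IsPol H Q) :
    IsPol (φ H) (φ Q) := by
  refine ⟨by rw [← map_mul, h.1, map_neg, map_one], h.2.1.map φ, fun a ha r => ?_⟩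
  simpa using (h.2.2 a ha r).map φ

/-- The product of aQ - r and aQ + r is the nonzero scalar -(a² + r²). -/
theorem isUnit_smul_sub_algebraMap {Q : A} (hQ : Q * Q = -1) {a : ℝ} (ha : a ≠ 0) (r : ℝ) :
    IsUnit (a • Q - algebraMap ℝ A r) := by
  have hpos : a ^ 2 + r ^ 2 ≠ 0 := by positivity
  have e1 : (a • Q - algebraMap ℝ A r) * (a • Q + algebraMap ℝ A r) =
      algebraMap ℝ A (-(a ^ 2 + r ^ 2)) := by
    simp only [Algebra.algebraMap_eq_smul_one, sub_mul, mul_add, smul_mul_smul_comm, hQ, mul_one,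
      one_mul, neg_add, add_smul, neg_smul, smul_neg, pow_two, mul_comm r a]
    abel
  have hr : Commute (a • Q) (algebraMap ℝ A r) := (Algebra.commutes r _).symm
  have e2 : Commute (a • Q - algebraMap ℝ A r) (a • Q + algebraMap ℝ A r) :=
    ((Commute.refl _).sub_left hr.symm).add_right (hr.sub_left (Commute.refl _))
  refine (e2.isUnit_mul_iff.1 ?_).1
  rw [e1]
  exact (IsUnit.mk0 _ (neg_ne_zero.2 hpos)).map _

theorem isPol_self {Q : A} (hQ : Q * Q = -1) : IsPol Q Q := by
  refine ⟨hQ, Commute.refl _, fun a ha r => ?_⟩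
  have := isUnit_smul_sub_algebraMap hQ (a := 1 + a) (by positivity) r
  rwa [add_smul, one_smul] at this

theorem IsPol.smul {H Q : A} (h : IsPol H Q) {t : ℝ} (ht : 0 < t) : IsPol (t • H) Q := by
  refine ⟨h.1, h.2.1.smul_right t, fun a ha r => ?_⟩
  have := (h.2.2 (t⁻¹ * a) (by positivity) (t⁻¹ * r)).smul (Units.mk0 t ht.ne')
  simpa [Units.smul_def, smul_sub, smul_add, smul_smul, ht.ne', Algebra.algebraMap_eq_smul_one]
    using this

theorem IsPol.add_smul {H Q : A} (h : IsPol H Q) {t : ℝ} (ht : 0 ≤ t) : IsPol (H + t • Q) Q := by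
  refine ⟨h.1, h.2.1.add_right ((Commute.refl Q).smul_right t), fun a ha r => ?_⟩
  have := h.2.2 (t + a) (by positivity) r
  rwa [_root_.add_smul, ← add_assoc] at this

theorem IsPol.add_algebraMap {H Q : A} (h : IsPol H Q) (c : ℝ) :
    IsPol (H + algebraMap ℝ A c) Q := by
  refine ⟨h.1, h.2.1.add_right (Algebra.commutes c Q).symm, fun a ha r => ?_⟩
  have := h.2.2 a ha (r - c)
  rw [map_sub] at this
  convert this using 1
  abel

theorem IsPol.neg {H Q : A} (h : IsPol H Q) : IsPol (-H) (-Q) := by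
  refine ⟨by rw [neg_mul_neg, h.1], (h.2.1.neg_left).neg_right, fun a ha r => ?_⟩
  have := (h.2.2 a ha (-r)).neg
  convert this using 1
  rw [map_neg, smul_neg]
  abel

/-- The source of the fiber-star property: scaling by t > 0 followed by adding a nonnegative
multiple of Q. At t = 0 only Q remains. -/
theorem IsPol.convex {H Q : A} (h : IsPol H Q) {t : ℝ} (ht : t ∈ Set.Icc (0 : ℝ) 1) :
    IsPol (t • H + (1 - t) • Q) Q := by
  rcases ht.1.eq_or_lt with rfl | h0
  · simpa using isPol_self h.1
  · exact (h.smul h0).add_smul (sub_nonneg.2 ht.2)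

theorem isUnit_of_mul_self_eq_neg_one {A : Type*} [Ring A] {Q : A} (hQ : Q * Q = -1) : IsUnit Q :=
  ⟨⟨Q, -Q, by rw [mul_neg, hQ, neg_neg], by rw [neg_mul, hQ, neg_neg]⟩, rfl⟩

theorem inverse_of_mul_self_eq_neg_one {A : Type*} [Ring A] {Q : A} (hQ : Q * Q = -1) : Ring.inverse Q = -Q :=
  Ring.inverse_unit ⟨Q, -Q, by rw [mul_neg, hQ, neg_neg], by rw [neg_mul, hQ, neg_neg]⟩

/-- Inner automorphisms. -/
def innerAlgHom (u : Aˣ) : A →ₐ[ℝ] A :=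
  AlgHom.ofLinearMap
    { toFun := fun a => u * a * ↑u⁻¹
      map_add' := fun a b => by rw [mul_add, add_mul]
      map_smul' := fun c a => by simp }
    (by simp)
    (fun a b => by
      change (u : A) * (a * b) * ↑u⁻¹ = (u * a * ↑u⁻¹) * (u * b * ↑u⁻¹)
      simp [mul_assoc])

theorem innerAlgHom_apply (u : Aˣ) (a : A) : innerAlgHom u a = u * a * ↑u⁻¹ := rfl

/-- For sin t ≠ 0 the kernel of -H² factors as -sin² t (H - cot t)(H + cot t), so only the case a =
0 of the invertibility condition enters. -/
theorem IsPol.polDom {H Q : A} (h : IsPol H Q) : PolDom H := by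
  intro t
  rw [sqrtKernel]
  by_cases hs : sin t = 0
  · have hc : cos t ^ 2 = 1 := by rw [cos_sq', hs]; norm_num
    simp [hs, hc]
  · have h1 := h.2.2 0 le_rfl (cos t / sin t)
    have h2 := h.2.2 0 le_rfl (-(cos t / sin t))
    have h3 := (h1.mul h2).smul (Units.mk0 (-(sin t ^ 2)) (neg_ne_zero.2 (pow_ne_zero 2 hs)))
    convert h3 using 1
    simp only [Units.smul_def, Units.val_mk0, zero_smul, add_zero, map_neg, sub_neg_eq_add, sub_mul,
      mul_add, Algebra.algebraMap_eq_smul_one, mul_smul_comm, smul_mul_assoc,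
      mul_one, one_mul, smul_sub, smul_add, smul_smul, smul_neg, neg_smul, pow_two, neg_mul]
    rw [show sin t * sin t * (cos t / sin t * (cos t / sin t)) = cos t * cos t by field_simp]
    abel

end Algebraic

section Convenient

variable {A : Type u} [Ring A] [Algebra ℝ A] [ConvenientAlgebra A]

theorem commute_pol {H T : A} (hH : PolDom H) (h : Commute T H) : Commute T (pol H) :=
  h.mul_right (commute_invSqrt hH (h.pow_right 2).neg_right)

/-- The square root of -H² is -QH. With P = -QH + a, the unit P² + r² splits as (P + rQ)(P - rQ),
and Q(P + rQ) is H + aQ - r. -/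
theorem isPol_pol {H : A} (hH : PolDom H) : IsPol H (pol H) := by
  set F := invSqrt (-H ^ 2) with hF
  have hc : Commute H F := commute_invSqrt hH ((Commute.refl H).pow_right 2).neg_right
  have hF1 : F ^ 2 * (-H ^ 2) = 1 := invSqrt_sq_mul hH
  have hQ : pol H = H * F := rfl
  have hQQ : pol H * pol H = -1 := by
    rw [hQ, show H * F * (H * F) = F ^ 2 * H ^ 2 by
      rw [← (hc.pow_pow 2 2).eq, ← hc.mul_pow, pow_two]]
    rw [← hF1]; simp
  have hQH : Commute (pol H) H := (commute_pol hH (Commute.refl H)).symm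
  refine ⟨hQQ, hQH, fun a ha r => ?_⟩
  have hu := isUnit_sqrt_add_sq_add_sq hH ha r
  rw [← hF] at hu
  have hP : -H ^ 2 * F = -(pol H * H) := by
    rw [hQH.eq, hQ, neg_mul, pow_two, mul_assoc]
  rw [hP] at hu
  generalize pol H = Q at *
  obtain ⟨P, hPdef⟩ : ∃ P, P = -(Q * H) + algebraMap ℝ A a := ⟨_, rfl⟩
  rw [← hPdef] at hu
  have hQP : Commute Q P :=
    hPdef ▸ (((Commute.refl Q).mul_right hQH).neg_right).add_right (Algebra.commutes a Q).symm
  have hf : P ^ 2 + algebraMap ℝ A r ^ 2 = (P + r • Q) * (P - r • Q) := by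
    rw [mul_sub, add_mul, add_mul, smul_mul_smul_comm, hQQ, mul_smul_comm, smul_mul_assoc,
      hQP.eq, ← map_pow, Algebra.algebraMap_eq_smul_one, pow_two, smul_neg, pow_two]
    abel
  have hcomm : Commute (P + r • Q) (P - r • Q) := by
    have := (hQP.smul_left r)
    exact ((Commute.refl P).sub_right this.symm).add_left (this.sub_right (Commute.refl _))
  rw [hf, hcomm.isUnit_mul_iff] at hu
  have := (isUnit_of_mul_self_eq_neg_one hQQ).mul hu.1
  convert this using 1
  rw [mul_add, hPdef, mul_add, mul_neg, ← mul_assoc, hQQ, mul_smul_comm, hQQ,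
    Algebra.algebraMap_eq_smul_one, Algebra.algebraMap_eq_smul_one, mul_smul_comm, mul_one, smul_neg,
    neg_mul, one_mul, neg_neg, sub_eq_add_neg]

/-- An idempotent on which two polarizations of `H` are opposite is zero modulo `filt A i`
as soon as it is annihilated by a nonzero polynomial in `H` modulo `filt A i`. -/
theorem mem_filt_of_aeval_mem {H Q R e : A} (hQ : IsPol H Q) (hR : IsPol H R)
    (heH : Commute e H) (heQ : Commute e Q) (heR : Commute e R) (he : e * Q = -(e * R)) (i : ℕ) :
    ∀ (n : ℕ) (p : Polynomial ℝ), p.natDegree ≤ n → p ≠ 0 →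
      e * Polynomial.aeval H p ∈ filt A i → e ∈ filt A i := by
  have cancel : ∀ u x : A, IsUnit u → Commute e u → e * (u * x) ∈ filt A i → e * x ∈ filt A i := by
    rintro _ x ⟨u, rfl⟩ hc hm
    have := mul_mem_filt_left (↑u⁻¹ : A) hm
    rwa [← mul_assoc e, hc.eq, mul_assoc, Units.inv_mul_cancel_left] at this
  intro n
  induction n with
  | zero =>
    intro p hp hp0 hm
    rw [Polynomial.eq_C_of_natDegree_le_zero hp] at hm hp0
    rw [Polynomial.aeval_C] at hm
    have hc : p.coeff 0 ≠ 0 := fun h => hp0 (by rw [h, map_zero])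
    have := cancel (algebraMap ℝ A (p.coeff 0)) 1 ((IsUnit.mk0 _ hc).map _)
      (Algebra.commutes _ e).symm (by rwa [mul_one])
    rwa [mul_one] at this
  | succ n ih =>
    intro p hp hp0 hm
    by_cases hdeg : p.degree = 0
    · exact ih p (by rw [Polynomial.natDegree_eq_zero_iff_degree_le_zero.2 hdeg.le]; omega) hp0 hm
    obtain ⟨z, hz⟩ := IsAlgClosed.exists_aeval_eq_zero ℂ p hdeg
    have hl : ∀ a : ℝ, 0 ≤ a → ∀ r : ℝ, Commute e (H + a • Q - algebraMap ℝ A r) := fun a _ r =>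
      (heH.add_right (heQ.smul_right a)).sub_right (Algebra.commutes _ e).symm
    have hl' : ∀ a : ℝ, 0 ≤ a → ∀ r : ℝ, Commute e (H + a • R - algebraMap ℝ A r) := fun a _ r =>
      (heH.add_right (heR.smul_right a)).sub_right (Algebra.commutes _ e).symm
    -- Each irreducible real factor of p is a unit on the part cut out by e, so the factors can be
    -- removed one at a time.
    by_cases him : z.im = 0
    · have hroot : p.IsRoot z.re := by
        have hz' : z = algebraMap ℝ ℂ z.re := Complex.ext (by simp) (by simp [him])
        rw [hz', Polynomial.aeval_algebraMap_apply] at hz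
        simpa using hz
      obtain ⟨q, rfl⟩ := Polynomial.dvd_iff_isRoot.2 hroot
      have hq0 : q ≠ 0 := right_ne_zero_of_mul hp0
      rw [Polynomial.natDegree_mul (Polynomial.X_sub_C_ne_zero _) hq0,
        Polynomial.natDegree_X_sub_C] at hp
      refine ih q (by omega) hq0 (cancel _ _ (hQ.2.2 0 le_rfl z.re) (hl 0 le_rfl z.re) ?_)
      simpa using hm
    · obtain ⟨q, rfl⟩ := p.quadratic_dvd_of_aeval_eq_zero_im_ne_zero hz him
      have hq0 : q ≠ 0 := right_ne_zero_of_mul hp0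
      have hd : (Polynomial.X ^ 2 - Polynomial.C (2 * z.re) * Polynomial.X +
          Polynomial.C (‖z‖ ^ 2) : Polynomial ℝ).natDegree = 2 := by compute_degree!
      rw [Polynomial.natDegree_mul (left_ne_zero_of_mul hp0) hq0, hd] at hp
      have ha := abs_nonneg z.im
      -- After multiplication by e, where Q + R becomes 0 and QR becomes 1, the product of H + |Im
      -- z| Q - Re z and H + |Im z| R - Re z equals the quadratic factor evaluated at H.
      refine ih q (by omega) hq0 (cancel _ _ ((hQ.2.2 _ ha z.re).mul (hR.2.2 _ ha z.re))
        ((hl _ ha _).mul_right (hl' _ ha _)) ?_)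
      rw [map_mul, ← mul_assoc] at hm
      rw [← mul_assoc]
      convert hm using 2
      have hn : ‖z‖ ^ 2 = z.re * z.re + |z.im| * |z.im| := by
        rw [abs_mul_abs_self, ← Complex.normSq_eq_norm_sq, Complex.normSq_apply]
      have e1 : (H + |z.im| • Q - algebraMap ℝ A z.re) * (H + |z.im| • R - algebraMap ℝ A z.re) =
          (H * H - (2 * z.re) • H + (z.re * z.re) • (1 : A)) + |z.im| • ((Q + R) * H) +
            (|z.im| * |z.im|) • (Q * R) - (|z.im| * z.re) • (Q + R) := by
        simp only [Algebra.algebraMap_eq_smul_one, sub_mul, add_mul, mul_sub, mul_add,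
          smul_mul_assoc, mul_smul_comm, one_mul, mul_one, smul_add, smul_sub, smul_smul, two_mul, 
          _root_.add_smul, ← hR.2.1.eq, mul_comm z.re]
        abel
      have e2 : e * (Q + R) = 0 := by rw [mul_add, he, neg_add_cancel]
      have e3 : e * (Q * R) = e := by rw [← mul_assoc, he, neg_mul, mul_assoc, hR.1]; simp
      rw [e1, mul_sub, mul_add, mul_add, mul_smul_comm, ← mul_assoc e, e2, zero_mul, smul_zero,
        mul_smul_comm, e3, mul_smul_comm, e2, smul_zero, sub_zero, add_zero]
      rw [map_add, map_sub, _root_.map_mul (Polynomial.aeval H), map_pow, Polynomial.aeval_X,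
        Polynomial.aeval_C, Polynomial.aeval_C, hn, Algebra.algebraMap_eq_smul_one,
        Algebra.algebraMap_eq_smul_one, smul_mul_assoc, one_mul, pow_two, _root_.add_smul, ← add_assoc,
        mul_add _ _ ((|z.im| * |z.im|) • (1 : A)), mul_smul_comm, mul_one]

/-- The idempotent (1 + RQ)/2 projects to the part where R = -Q. It vanishes on every level, so RQ =
-1. -/
theorem IsPol.unique {H Q R : A} (hQ : IsPol H Q) (hR : IsPol H R) (hQR : Commute Q R) : Q = R := by
  set e : A := (2⁻¹ : ℝ) • (1 + R * Q) with he
  have hRQ := hQR.symm.eq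
  have heH : Commute e H :=
    ((Commute.one_left H).add_left (hR.2.1.mul_left hQ.2.1)).smul_left _
  have heQ : Commute e Q :=
    ((Commute.one_left Q).add_left (hQR.symm.mul_left (Commute.refl Q))).smul_left _
  have heR : Commute e R :=
    ((Commute.one_left R).add_left ((Commute.refl R).mul_left hQR)).smul_left _
  have h1 : e * Q = -(e * R) := by
    rw [he, smul_mul_assoc, smul_mul_assoc, ← smul_neg, add_mul, add_mul, mul_assoc, hQ.1, hRQ,
      mul_assoc, hR.1]
    simp only [one_mul, mul_neg, mul_one, neg_add, neg_neg]
    rw [add_comm]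
  have h0 : e = 0 := by
    refine eq_zero_of_forall_mem_filt fun i => ?_
    -- Levels are finite-dimensional, so H satisfies a nonzero polynomial equation on each of them.
    refine mem_filt_of_aeval_mem hQ hR heH heQ heR h1 i _ (minpoly ℝ (rep A i H)) le_rfl
      (minpoly.ne_zero (Algebra.IsIntegral.isIntegral (R := ℝ) _)) ?_
    refine mul_mem_filt_left _ (rep_eq_zero_iff.1 ?_)
    rw [← Polynomial.aeval_algHom_apply, minpoly.aeval]
  have h2 : 1 + R * Q = 0 := by
    have := congrArg (fun x => (2 : ℝ) • x) h0
    simpa [he, smul_smul] using this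
  have h3 := congrArg (fun x => R * x) h2
  simp only [mul_add, mul_one, ← mul_assoc, hR.1, mul_zero, neg_mul, one_mul] at h3
  exact (add_neg_eq_zero.1 h3).symm

/-- The commutation needed for uniqueness is automatic when one candidate is `pol H`, which commutes
with everything that commutes with H. -/
theorem isPol_iff {H Q : A} : IsPol H Q ↔ PolDom H ∧ pol H = Q := by
  constructor
  · intro h
    have hd := h.polDom
    exact ⟨hd, ((h.unique (isPol_pol hd) (commute_pol hd h.2.1)).symm)⟩
  · rintro ⟨h, rfl⟩
    exact isPol_pol h

end Convenient
end FQ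
end

/-! ### Antisymmetrization and the algebraic form of Gram-Schmidt. -/

noncomputable section
namespace FQ

section Antisymm

variable {A : Type*} [Ring A] [Algebra ℝ A]

theorem antisymm_eq {Q : A} (hQ : Q * Q = -1) (R : A) :
    antisymm R Q = (2⁻¹ : ℝ) • (R + Q * R * Q) := by
  rw [antisymm, inverse_of_mul_self_eq_neg_one hQ, neg_mul, neg_mul, sub_neg_eq_add]

/-- Antisymmetrization as a linear map. -/
def antisymmHom (Q : A) : A →ₗ[ℝ] A where
  toFun R := antisymm R Q
  map_add' R S := by simp only [antisymm, mul_add, add_mul, ← smul_add]; congr 1; abel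
  map_smul' c R := by
    simp only [antisymm, RingHom.id_apply, mul_smul_comm, smul_mul_assoc, ← smul_sub]
    rw [smul_comm]

/-- Iterated antisymmetrization as a linear map. -/
def antisymmListHom (l : List A) : A →ₗ[ℝ] A where
  toFun R := antisymmList R l
  map_add' R S := by
    induction l generalizing R S with
    | nil => rfl
    | cons q l ih =>
      change antisymmList (antisymmHom q (R + S)) l = _
      rw [map_add, ih]
      rfl
  map_smul' c R := by
    induction l generalizing R with
    | nil => rfl
    | cons q l ih =>
      change antisymmList (antisymmHom q (c • R)) l = _
      rw [map_smul, ih]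
      rfl

theorem antisymmListHom_apply (l : List A) (R : A) : antisymmListHom l R = antisymmList R l := rfl

theorem antisymmList_append (R : A) (l l' : List A) :
    antisymmList R (l ++ l') = antisymmList (antisymmList R l) l' := List.foldl_append

theorem antisymm_of_commute {R Q : A} (hQ : IsUnit Q) (h : Commute R Q) : antisymm R Q = 0 := by
  rw [antisymm, mul_assoc, h.eq, Ring.inverse_mul_cancel_left _ _ hQ, sub_self, smul_zero]

theorem antisymm_of_anticommute {R Q : A} (hQ : Q * Q = -1) (h : R * Q = -(Q * R)) :
    antisymm R Q = R := by
  rw [antisymm_eq hQ, mul_assoc, h, mul_neg, ← mul_assoc, hQ, neg_mul, one_mul, neg_neg, ← two_smul ℝ,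
    smul_smul]
  norm_num

theorem antisymm_anticommute {R Q : A} (hQ : Q * Q = -1) :
    antisymm R Q * Q = -(Q * antisymm R Q) := by
  rw [antisymm_eq hQ, smul_mul_assoc, mul_smul_comm, ← smul_neg, add_mul, mul_add, mul_assoc _ Q Q, hQ,
    ← mul_assoc, ← mul_assoc, hQ]
  congr 1
  simp only [mul_neg, mul_one, neg_mul, one_mul, neg_add, neg_neg]
  rw [add_comm]

theorem antisymm_anticommute_of {R Q X : A} (hQ : Q * Q = -1) (hXQ : X * Q = -(Q * X))
    (hXR : R * X = -(X * R)) : antisymm R Q * X = -(X * antisymm R Q) := by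
  have e : Q * R * Q * X = -(X * (Q * R * Q)) := by
    have hQX : Q * X = -(X * Q) := by rw [hXQ, neg_neg]
    rw [mul_assoc, hQX, mul_neg, mul_assoc, ← mul_assoc R, hXR, neg_mul, mul_neg, ← mul_assoc,
      ← mul_assoc, hQX]
    simp [mul_assoc]
  rw [antisymm_eq hQ, smul_mul_assoc, mul_smul_comm, ← smul_neg, add_mul, mul_add, e, hXR, neg_add]

theorem antisymmList_of_anticommute {R : A} {l : List A} (hl : ∀ q ∈ l, q * q = -1)
    (h : ∀ q ∈ l, R * q = -(q * R)) : antisymmList R l = R := by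
  induction l with
  | nil => rfl
  | cons q l ih =>
    change antisymmList (antisymm R q) l = R
    rw [antisymm_of_anticommute (hl q (by simp)) (h q (by simp))]
    exact ih (fun q hq => hl q (by simp [hq])) (fun q hq => h q (by simp [hq]))

theorem antisymmList_anticommute_of {R X : A} {l : List A} (hl : ∀ q ∈ l, q * q = -1)
    (h : ∀ q ∈ l, X * q = -(q * X)) (hR : R * X = -(X * R)) :
    antisymmList R l * X = -(X * antisymmList R l) := by
  induction l generalizing R with
  | nil => exact hR
  | cons q l ih =>
    exact ih (fun q hq => hl q (by simp [hq])) (fun q hq => h q (by simp [hq]))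
      (antisymm_anticommute_of (hl q (by simp)) (h q (by simp)) hR)

/-- Antisymmetrization by q creates anticommutation with q, and the later ones preserve it because
their elements anticommute with q. -/
theorem antisymmList_anticommute {R : A} {l : List A} (hl : ∀ q ∈ l, q * q = -1)
    (h : l.Pairwise fun q q' => q * q' = -(q' * q)) :
    ∀ q ∈ l, antisymmList R l * q = -(q * antisymmList R l) := by
  induction l generalizing R with
  | nil => simp
  | cons q l ih =>
    rw [List.pairwise_cons] at h
    intro q' hq'
    rcases List.mem_cons.1 hq' with rfl | hq'
    · exact antisymmList_anticommute_of (l := l) (fun q hq => hl q (by simp [hq])) h.1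
        (antisymm_anticommute (hl _ (by simp)))
    · exact ih (fun q hq => hl q (by simp [hq])) h.2 q' hq'

theorem map_antisymmList {B : Type*} [Ring B] [Algebra ℝ B] (φ : A →ₐ[ℝ] B) (R : A) {l : List A}
    (hl : ∀ q ∈ l, IsUnit q) : φ (antisymmList R l) = antisymmList (φ R) (l.map φ) := by
  induction l generalizing R with
  | nil => rfl
  | cons q l ih =>
    change φ (antisymmList (antisymm R q) l) = antisymmList (antisymm (φ R) (φ q)) (l.map φ)
    rw [ih _ fun q hq => hl q (by simp [hq])]
    congr 1
    rw [antisymm, antisymm, map_smul, map_sub, map_mul, map_mul]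
    congr 4
    exact map_ringInverse φ.toRingHom (hl q (by simp))

/-- The first antisymmetrization kills a central element, so a scalar survives only the empty list.
-/
theorem exists_antisymmList_algebraMap (c : ℝ) {l : List A} (hl : ∀ q ∈ l, IsUnit q) :
    ∃ c' : ℝ, antisymmList (algebraMap ℝ A c) l = algebraMap ℝ A c' := by
  induction l generalizing c with
  | nil => exact ⟨c, rfl⟩
  | cons q l ih =>
    obtain ⟨c', h⟩ := ih 0 fun q hq => hl q (by simp [hq])
    refine ⟨c', ?_⟩
    rw [← h]
    change antisymmList (antisymm _ q) l = _
    rw [antisymm_of_commute (hl q (by simp)) (Algebra.commutes c q), map_zero]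

/-- The list of the first `m` components. -/
def prefixList {α : Type*} {n : ℕ} (B : Fin n → α) (m : ℕ) (hm : m ≤ n) : List α :=
  List.ofFn fun i : Fin m => B ⟨i, i.isLt.trans_le hm⟩

theorem prefixList_succ {α : Type*} {n : ℕ} (B : Fin n → α) (m : ℕ) (hm : m + 1 ≤ n) :
    prefixList B (m + 1) hm = prefixList B m (Nat.le_of_succ_le hm) ++ [B ⟨m, hm⟩] := by
  rw [prefixList, List.ofFn_succ_last]
  rfl

theorem mem_prefixList {α : Type*} {n : ℕ} {B : Fin n → α} {m : ℕ} {hm : m ≤ n} {x : α} :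
    x ∈ prefixList B m hm ↔ ∃ i : Fin n, i.val < m ∧ B i = x := by
  rw [prefixList, List.mem_ofFn]
  exact ⟨fun ⟨i, h⟩ => ⟨⟨i, i.isLt.trans_le hm⟩, i.isLt, h⟩, fun ⟨i, hi, h⟩ => ⟨⟨i, hi⟩, h⟩⟩

theorem map_prefixList {α β : Type*} {n : ℕ} (f : α → β) (B : Fin n → α) (m : ℕ) (hm : m ≤ n) :
    (prefixList B m hm).map f = prefixList (fun i => f (B i)) m hm := by
  rw [prefixList, List.map_ofFn]
  rfl

theorem prefixList_congr {α : Type*} {n : ℕ} {B B' : Fin n → α} {m : ℕ} (hm : m ≤ n)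
    (h : ∀ i : Fin n, i.val < m → B i = B' i) : prefixList B m hm = prefixList B' m hm := by
  rw [prefixList, prefixList]
  congr 1
  funext i
  exact h _ i.isLt

theorem isClifford_iff {n : ℕ} {Q : Fin n → A} :
    IsClifford Q ↔ (∀ i, Q i * Q i = -1) ∧ ∀ i j, i < j → Q j * Q i = -(Q i * Q j) := by
  constructor
  · intro h
    refine ⟨fun i => ?_, fun i j hij => ?_⟩
    · have h1 := h i i
      rw [if_pos rfl, ← two_smul ℝ, show (-2 : A) = (2 : ℝ) • (-1 : A) by
        rw [two_smul, ← neg_add, one_add_one_eq_two]] at h1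
      exact smul_right_injective A (two_ne_zero (α := ℝ)) h1
    · have h1 := h j i
      rw [if_neg hij.ne'] at h1
      exact eq_neg_of_add_eq_zero_left h1
  · rintro ⟨h1, h2⟩ i j
    rcases lt_trichotomy i j with h | rfl | h
    · rw [if_neg h.ne, h2 i j h, add_neg_cancel]
    · rw [if_pos rfl, h1, ← neg_add, one_add_one_eq_two]
    · rw [if_neg h.ne', h2 j i h, neg_add_cancel]

theorem IsClifford.anticommute {A : Type*} [Ring A] {n : ℕ} {Q : Fin n → A}
    (h : IsClifford Q) {i j : Fin n}
    (hij : i ≠ j) : Q i * Q j = -(Q j * Q i) := by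
  have h1 := h i j
  rw [if_neg hij] at h1
  exact eq_neg_of_add_eq_zero_left h1

/-- The algebraic characterization of the Gram-Schmidt orthogonalization. -/
def IsGS {n : ℕ} (a B : Fin n → A) : Prop :=
  ∀ k : Fin n, IsPol (antisymmList (a k) (prefixList B k k.isLt.le)) (B k)

namespace IsGS

variable {n : ℕ} {a B : Fin n → A}

theorem mul_self (h : IsGS a B) (k : Fin n) : B k * B k = -1 := (h k).1

theorem mul_self_of_mem (h : IsGS a B) {m : ℕ} {hm : m ≤ n} {q : A} (hq : q ∈ prefixList B m hm) :
    q * q = -1 := by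
  obtain ⟨i, _, rfl⟩ := mem_prefixList.1 hq
  exact h.mul_self i

theorem isUnit_of_mem (h : IsGS a B) {m : ℕ} {hm : m ≤ n} {q : A} (hq : q ∈ prefixList B m hm) :
    IsUnit q := isUnit_of_mul_self_eq_neg_one (h.mul_self_of_mem hq)

theorem map {A' : Type*} [Ring A'] [Algebra ℝ A'] (φ : A →ₐ[ℝ] A') (h : IsGS a B) :
    IsGS (fun i => φ (a i)) (fun i => φ (B i)) := fun k => by
  have := (h k).map φ
  rwa [map_antisymmList φ _ fun q hq => h.isUnit_of_mem hq, map_prefixList] at this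

theorem prod {A' : Type*} [Ring A'] [Algebra ℝ A'] {a' B' : Fin n → A'} (h : IsGS a B)
    (h' : IsGS a' B') : IsGS (fun i => (a i, a' i)) (fun i => (B i, B' i)) := by
  intro k
  have hu : ∀ q ∈ prefixList (fun i => (B i, B' i)) k k.isLt.le, IsUnit q := by
    intro q hq
    obtain ⟨i, _, rfl⟩ := mem_prefixList.1 hq
    refine isUnit_of_mul_self_eq_neg_one (Prod.ext (h.mul_self i) (h'.mul_self i))
  have e1 := map_antisymmList (AlgHom.fst ℝ A A') (a k, a' k) hu
  have e2 := map_antisymmList (AlgHom.snd ℝ A A') (a k, a' k) hu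
  rw [map_prefixList] at e1 e2
  have e : antisymmList (a k, a' k) (prefixList (fun i => (B i, B' i)) k k.isLt.le) =
      (antisymmList (a k) (prefixList B k k.isLt.le),
        antisymmList (a' k) (prefixList B' k k.isLt.le)) := Prod.ext e1 e2
  rw [e]
  refine ⟨Prod.ext (h k).1 (h' k).1, Prod.ext (h k).2.1 (h' k).2.1, fun t ht r => ?_⟩
  exact Prod.isUnit_iff.2 ⟨(h k).2.2 t ht r, (h' k).2.2 t ht r⟩

/-- Antisymmetrization is quadratic in Q, hence the same for Q and -Q; only the last polarization
sees the sign. -/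
theorem sign {a' B' : Fin n → A} (h : IsGS a B)
    (hs : ∀ i, a' i = a i ∧ B' i = B i ∨ a' i = -a i ∧ B' i = -B i) : IsGS a' B' := by
  have key : ∀ (m : ℕ) (hm : m ≤ n) (R : A),
      antisymmList R (prefixList B' m hm) = antisymmList R (prefixList B m hm) := by
    intro m
    induction m with
    | zero => intro _ _; rfl
    | succ m ih =>
      intro hm R
      rw [prefixList_succ, prefixList_succ, antisymmList_append, antisymmList_append, ih]
      change antisymm _ _ = antisymm _ _
      have h1 := h.mul_self ⟨m, hm⟩
      have h2 : B' ⟨m, hm⟩ * B' ⟨m, hm⟩ = -1 := by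
        rcases hs ⟨m, hm⟩ with h | h <;> rw [h.2]
        · exact h1
        · rw [neg_mul_neg, h1]
      rw [antisymm_eq h1, antisymm_eq h2]
      rcases hs ⟨m, hm⟩ with h | h <;> rw [h.2]
      rw [neg_mul, neg_mul_neg]
  intro k
  rw [key]
  rcases hs k with e | e <;> rw [e.1, e.2]
  · exact h k
  · rw [← antisymmListHom_apply, map_neg]
    exact (h k).neg

theorem smul (h : IsGS a B) {t : ℝ} (ht : 0 < t) : IsGS (t • a) B := fun k => by
  rw [Pi.smul_apply, ← antisymmListHom_apply, map_smul]
  exact (h k).smul ht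

/-- After the first k antisymmetrizations one has the term whose polarization is `B k`. It commutes
with `B k`, so the next antisymmetrization annihilates it. -/
theorem antisymmList_eq_zero (h : IsGS a B) (k : Fin n) (m : ℕ) (hm : m ≤ n) (hkm : k.val < m) :
    antisymmList (a k) (prefixList B m hm) = 0 := by
  induction m with
  | zero => omega
  | succ m ih =>
    rw [prefixList_succ, antisymmList_append]
    change antisymm _ _ = 0
    rcases (Nat.lt_succ_iff.1 hkm).eq_or_lt with e | hlt
    · obtain ⟨k, hk⟩ := k
      obtain rfl : k = m := e
      exact antisymm_of_commute (isUnit_of_mul_self_eq_neg_one (h.mul_self _)) (h ⟨k, hk⟩).2.1.symm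
    · rw [ih _ hlt]
      exact (antisymmHom _).map_zero

/-- Earlier components are annihilated by antisymmetrization and later ones have coefficient 0, so
only a positive multiple of the old term remains. -/
theorem lower (h : IsGS a B) {U : Matrix (Fin n) (Fin n) ℝ} (hU : IsLowerPos U) :
    IsGS (fun k => ∑ j, U k j • a j) B := fun k => by
  rw [← antisymmListHom_apply, map_sum, Finset.sum_eq_single k]
  · rw [map_smul]
    exact (h k).smul (hU.2 k)
  · intro j _ hj
    rcases lt_or_gt_of_ne hj with hj | hj
    · rw [map_smul, antisymmListHom_apply, h.antisymmList_eq_zero j k k.isLt.le hj, smul_zero]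
    · rw [hU.1 k j hj, zero_smul, map_zero]
  · simp

/-- Needed in the conform case, where multiples of A_1 become real scalars after division by A_1. -/
theorem add_algebraMap (h : IsGS a B) (c : Fin n → ℝ) :
    IsGS (fun k => a k + algebraMap ℝ A (c k)) B := fun k => by
  rw [← antisymmListHom_apply, map_add, antisymmListHom_apply, antisymmListHom_apply]
  obtain ⟨c', hc⟩ := exists_antisymmList_algebraMap (A := A) (c k)
    (l := prefixList B k k.isLt.le) fun q hq => h.isUnit_of_mem hq
  rw [hc]
  exact (h k).add_algebraMap c'

end IsGS

theorem IsClifford.antisymmList_self {n : ℕ} {Q : Fin n → A} (hQ : IsClifford Q) (k : Fin n) :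
    antisymmList (Q k) (prefixList Q k k.isLt.le) = Q k := by
  apply antisymmList_of_anticommute
  · intro q hq
    obtain ⟨i, _, rfl⟩ := mem_prefixList.1 hq
    exact (isClifford_iff.1 hQ).1 i
  · intro q hq
    obtain ⟨i, hi, rfl⟩ := mem_prefixList.1 hq
    exact (isClifford_iff.1 hQ).2 i k hi

theorem IsClifford.isGS {n : ℕ} {Q : Fin n → A} (hQ : IsClifford Q) : IsGS Q Q := fun k => by
  rw [hQ.antisymmList_self]
  exact isPol_self ((isClifford_iff.1 hQ).1 k)

end Antisymm

section Convenient

variable {A : Type u} [Ring A] [Algebra ℝ A] [ConvenientAlgebra A]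

/-- Conjugation by X sends H to -H, so the conjugate of Q and -Q are both the polarization of -H. -/
theorem IsPol.anticommute {H Q X : A} (h : IsPol H Q) (hX : X * X = -1) (hXH : H * X = -(X * H)) :
    Q * X = -(X * Q) := by
  obtain ⟨u, rfl⟩ := isUnit_of_mul_self_eq_neg_one hX
  have h1 := h.map (innerAlgHom u)
  have e : innerAlgHom u H = -H := by
    rw [innerAlgHom_apply, ← neg_eq_iff_eq_neg.2 hXH, neg_mul, mul_assoc, Units.mul_inv, mul_one]
  rw [e, isPol_iff] at h1
  have h2 := h1.2.symm.trans (isPol_iff.1 h.neg).2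
  rw [innerAlgHom_apply, Units.mul_inv_eq_iff_eq_mul, neg_mul] at h2
  rw [h2, neg_neg]

theorem IsGS.isClifford {n : ℕ} {a B : Fin n → A} (h : IsGS a B) : IsClifford B := by
  refine isClifford_iff.2 ⟨h.mul_self, ?_⟩
  suffices H : ∀ (m : ℕ) (hm : m < n) (i : Fin n), i.val < m →
      B ⟨m, hm⟩ * B i = -(B i * B ⟨m, hm⟩) from fun i j hij => H j j.isLt i hij
  intro m
  induction m using Nat.strong_induction_on with
  | _ m ih =>
    intro hm i hi
    refine (h ⟨m, hm⟩).anticommute (h.mul_self i) ?_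
    refine antisymmList_anticommute (fun q hq => h.mul_self_of_mem hq) ?_ _
      (mem_prefixList.2 ⟨i, hi, rfl⟩)
    rw [prefixList, List.pairwise_ofFn]
    intro j l hjl
    rw [ih l l.isLt (l.isLt.trans hm) ⟨j, j.isLt.trans hm⟩ hjl, neg_neg]

theorem IsGS.convex {n : ℕ} {a B : Fin n → A} (h : IsGS a B) {t : ℝ}
    (ht : t ∈ Set.Icc (0 : ℝ) 1) : IsGS (t • a + (1 - t) • B) B := fun k => by
  rw [Pi.add_apply, Pi.smul_apply, Pi.smul_apply, ← antisymmListHom_apply, map_add, map_smul, map_smul,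
    antisymmListHom_apply, antisymmListHom_apply, h.isClifford.antisymmList_self]
  exact (h k).convex ht

theorem gsTerm_eq {n : ℕ} (a : Fin n → A) (k : Fin n) :
    gsTerm a k = antisymmList (a k) (prefixList (gsSeq a) k k.isLt.le) := rfl

theorem gsSeq_eq {n : ℕ} (a : Fin n → A) (k : Fin n) : gsSeq a k = pol (gsTerm a k) := by
  rw [gsSeq, gsTerm]

theorem isGS_iff {n : ℕ} {a B : Fin n → A} :
    IsGS a B ↔ (∀ k, PolDom (gsTerm a k)) ∧ gsSeq a = B := by
  constructor
  · intro h
    have e : ∀ (m : ℕ) (hm : m < n), gsSeq a ⟨m, hm⟩ = B ⟨m, hm⟩ := by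
      intro m
      induction m using Nat.strong_induction_on with
      | _ m ih =>
        intro hm
        rw [gsSeq_eq, gsTerm_eq, prefixList_congr _ fun i hi => ih i hi i.isLt]
        exact (isPol_iff.1 (h ⟨m, hm⟩)).2
    have e' : gsSeq a = B := funext fun k => e k k.isLt
    refine ⟨fun k => ?_, e'⟩
    rw [gsTerm_eq, e']
    exact (h k).polDom
  · rintro ⟨h, rfl⟩ k
    rw [← gsTerm_eq]
    exact isPol_iff.2 ⟨h k, (gsSeq_eq a k).symm⟩

theorem mem_gramSchmidt_iff {n : ℕ} {a B : Fin n → A} : B ∈ gramSchmidt n A a ↔ IsGS a B := by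
  rw [isGS_iff]
  exact ⟨fun ⟨h, e⟩ => ⟨h, e⟩, fun ⟨h, e⟩ => ⟨h, e⟩⟩

/-- The algebraic characterization of the Gram-Schmidt conform-orthogonalization. -/
def IsConformGS {A : Type*} [Ring A] [Algebra ℝ A] {n : ℕ} (a B : Fin (n + 1) → A) : Prop :=
  IsUnit (a 0) ∧ B 0 = a 0 ∧ IsGS (unfloat a) (unfloat B)

theorem mem_conformGramSchmidt_iff {n : ℕ} {a B : Fin (n + 1) → A} :
    B ∈ conformGramSchmidt n A a ↔ IsConformGS a B := by
  constructor
  · rintro ⟨⟨h1, h2⟩, rfl⟩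
    refine ⟨h1, rfl, ?_⟩
    have h3 : gsSeq (unfloat a) ∈ gramSchmidt n A (unfloat a) := ⟨h2, rfl⟩
    have e : unfloat ((conformGramSchmidt n A a).get ⟨h1, h2⟩) = gsSeq (unfloat a) := by
      funext i
      exact Ring.mul_inverse_cancel_right _ _ h1
    rw [e]
    exact mem_gramSchmidt_iff.1 h3
  · rintro ⟨h1, h2, h3⟩
    obtain ⟨h4, h5⟩ := mem_gramSchmidt_iff.2 h3
    refine ⟨⟨h1, h4⟩, ?_⟩
    change (Fin.cons (a 0) fun i => (gramSchmidt n A (unfloat a)).get h4 i * a 0 :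
      Fin (n + 1) → A) = B
    rw [h5]
    funext i
    refine Fin.cases h2.symm (fun i => ?_) i
    change unfloat B i * a 0 = B i.succ
    rw [unfloat, h2, Ring.inverse_mul_cancel_right _ _ h1]

end Convenient

section Operations

theorem natural_gramSchmidt (n : ℕ) : Natural (gramSchmidt.{u} n) := by
  constructor
  · intro A A' _ _ _ _ _ _ φ a B h
    exact mem_gramSchmidt_iff.2 ((mem_gramSchmidt_iff.1 h).map φ)
  · intro A A' _ _ _ _ _ _ a a' h h'
    have h1 : gsSeq a ∈ gramSchmidt n A a := ⟨h, rfl⟩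
    have h2 : gsSeq a' ∈ gramSchmidt n A' a' := ⟨h', rfl⟩
    exact (mem_gramSchmidt_iff.2 ((mem_gramSchmidt_iff.1 h1).prod (mem_gramSchmidt_iff.1 h2))).1

theorem cliffordProductive_gramSchmidt (n : ℕ) : CliffordProductive (gramSchmidt.{u} n) :=
  fun _ _ _ _ _ _ h => (mem_gramSchmidt_iff.1 h).isClifford

theorem cliffordConservative_gramSchmidt (n : ℕ) : CliffordConservative (gramSchmidt.{u} n) :=
  fun _ _ _ _ _ h => mem_gramSchmidt_iff.2 h.isGS

theorem neg_one_pow_fin_two_mul {A : Type*} [Ring A] (e : Fin 2) :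
    (∀ x : A, (-1) ^ e.val * x = x) ∨ ∀ x : A, (-1) ^ e.val * x = -x := by
  fin_cases e <;> simp

theorem signLinear_gramSchmidt (n : ℕ) : SignLinear (gramSchmidt.{u} n) :=
  fun A _ _ _ _ _ e h => mem_gramSchmidt_iff.2 ((mem_gramSchmidt_iff.1 h).sign fun i => by
    rcases neg_one_pow_fin_two_mul (A := A) (e i) with h | h <;> simp [h])

theorem zeroHomogeneous_gramSchmidt (n : ℕ) : ZeroHomogeneous (gramSchmidt.{u} n) :=
  fun _ _ _ _ _ _ _ ht h => mem_gramSchmidt_iff.2 ((mem_gramSchmidt_iff.1 h).smul ht)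

theorem parabolic_gramSchmidt (n : ℕ) : Parabolic (gramSchmidt.{u} n) :=
  fun _ _ _ _ _ _ _ hU h => mem_gramSchmidt_iff.2 ((mem_gramSchmidt_iff.1 h).lower hU)

theorem fiberStar_gramSchmidt (n : ℕ) : FiberStar (gramSchmidt.{u} n) :=
  fun _ _ _ _ _ _ _ ht h => mem_gramSchmidt_iff.2 ((mem_gramSchmidt_iff.1 h).convex ht)

theorem gsSeq_congr {A : Type u} [Ring A] [Algebra ℝ A] [ConvenientAlgebra A] {n : ℕ}
    {a a' : Fin n → A} (m : ℕ) (hm : m < n) (h : ∀ i : Fin n, i.val ≤ m → a i = a' i) :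
    gsSeq a ⟨m, hm⟩ = gsSeq a' ⟨m, hm⟩ := by
  induction m using Nat.strong_induction_on with
  | _ m ih =>
    rw [gsSeq_eq, gsSeq_eq, gsTerm_eq, gsTerm_eq, h _ le_rfl, prefixList_congr _ fun i hi =>
      ih i hi i.isLt fun j hj => h j (hj.trans hi.le)]

theorem pointwiseFiltered_gramSchmidt (n : ℕ) : PointwiseFiltered (gramSchmidt.{u} n) := by
  rintro A _ _ _ a a' _ _ k ⟨_, rfl⟩ ⟨_, rfl⟩ h
  exact gsSeq_congr k k.isLt fun i hi => h i hi

theorem natural_conformGramSchmidt (n : ℕ) : Natural (conformGramSchmidt.{u} n) := by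
  constructor
  · intro A A' _ _ _ _ _ _ φ a B h
    obtain ⟨h1, h2, h3⟩ := mem_conformGramSchmidt_iff.1 h
    refine mem_conformGramSchmidt_iff.2 ⟨h1.map φ, congrArg φ h2, ?_⟩
    have h4 := h3.map φ
    have hi : φ (Ring.inverse (a 0)) = Ring.inverse (φ (a 0)) := map_ringInverse φ.toRingHom h1
    simp only [unfloat, map_mul, h2, hi] at h4
    unfold unfloat
    beta_reduce
    rw [h2]
    exact h4
  · intro A A' _ _ _ _ _ _ a a' h h'
    have h3 := (mem_gramSchmidt_iff.1 (⟨h.2, rfl⟩ : gsSeq (unfloat a) ∈ gramSchmidt n A _)).prod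
      (mem_gramSchmidt_iff.1 (⟨h'.2, rfl⟩ : gsSeq (unfloat a') ∈ gramSchmidt n A' _))
    have hu : IsUnit (a 0, a' 0) := Prod.isUnit_iff.2 ⟨h.1, h'.1⟩
    refine ⟨hu, ?_⟩
    have e : unfloat (fun i => (a i, a' i)) = fun i => (unfloat a i, unfloat a' i) := by
      funext i
      refine Prod.ext ?_ ?_
      · exact congrArg (a i.succ * ·) (map_ringInverse (RingHom.fst A A') hu)
      · exact congrArg (a' i.succ * ·) (map_ringInverse (RingHom.snd A A') hu)
    rw [e]
    exact (mem_gramSchmidt_iff.2 h3).1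

/-- In the quotients A_j A_1⁻¹ the right factor y cancels and the left factor x acts by conjugation,
so naturality for inner automorphisms applies. -/
theorem bivariant_conformGramSchmidt (n : ℕ) : Bivariant (conformGramSchmidt.{u} n) := by
  rintro A _ _ _ a B _ _ ⟨x, rfl⟩ ⟨y, rfl⟩ h
  obtain ⟨⟨v, hv⟩, h2, h3⟩ := mem_conformGramSchmidt_iff.1 h
  rw [← hv] at h2
  have hi : Ring.inverse ((x : A) * v * y) = ↑y⁻¹ * ↑v⁻¹ * ↑x⁻¹ := by
    rw [show (x : A) * v * y = ↑(x * v * y) by simp, Ring.inverse_unit]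
    simp [mul_assoc]
  refine mem_conformGramSchmidt_iff.2 ⟨by beta_reduce; rw [← hv]; exact (x * v * y).isUnit,
    by beta_reduce; rw [h2, hv], ?_⟩
  have key : ∀ b : Fin (n + 1) → A, b 0 = v →
      unfloat (fun i => ↑x * b i * ↑y) = fun i => innerAlgHom x (unfloat b i) := by
    intro b hb
    funext i
    simp only [unfloat, hb, hi, Ring.inverse_unit, innerAlgHom_apply]
    simp only [mul_assoc, Units.mul_inv_cancel_left]
  rw [key a hv.symm, key B h2]
  exact h3.map _

theorem floatingCliffordProductive_conformGramSchmidt (n : ℕ) :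
    FloatingCliffordProductive (conformGramSchmidt.{u} n) := by
  intro A _ _ _ a B h
  obtain ⟨h1, h2, h3⟩ := mem_conformGramSchmidt_iff.1 h
  exact ⟨h2 ▸ h1, h3.isClifford⟩

theorem floatingCliffordConservative_conformGramSchmidt (n : ℕ) :
    FloatingCliffordConservative (conformGramSchmidt.{u} n) :=
  fun _ _ _ _ _ h => mem_conformGramSchmidt_iff.2 ⟨h.1, rfl, h.2.isGS⟩

theorem signLinear_conformGramSchmidt (n : ℕ) : SignLinear (conformGramSchmidt.{u} n) := by
  intro A _ _ _ a B e h
  obtain ⟨h1, h2, h3⟩ := mem_conformGramSchmidt_iff.1 h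
  obtain ⟨v, hv⟩ := h1
  have hneg : Ring.inverse (-(v : A)) = -Ring.inverse (v : A) := by
    rw [← Units.val_neg, Ring.inverse_unit, Ring.inverse_unit]
    simp
  refine mem_conformGramSchmidt_iff.2 ⟨?_, by beta_reduce; rw [h2], h3.sign fun i => ?_⟩
  · beta_reduce
    rw [← hv]
    exact ((isUnit_one.neg).pow _).mul v.isUnit
  · simp only [unfloat, h2, ← hv]
    rcases neg_one_pow_fin_two_mul (A := A) (e 0) with h | h <;>
      rcases neg_one_pow_fin_two_mul (A := A) (e i.succ) with h' | h' <;> simp [h, h', hneg]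

/-- The condition U_11 = 1 keeps A_1 fixed. After division by it, the lower right block acts as a
triangular matrix and the first column adds real scalars. -/
theorem conformParabolic_conformGramSchmidt (n : ℕ) :
    ConformParabolic (conformGramSchmidt.{u} n) := by
  intro A _ _ _ a B U hU hU1 h
  obtain ⟨h1, h2, h3⟩ := mem_conformGramSchmidt_iff.1 h
  have e0 : ∑ j, U 0 j • a j = a 0 := by
    rw [Fin.sum_univ_succ, hU1, one_smul, Finset.sum_eq_zero, add_zero]
    intro j _
    rw [hU.1 0 j.succ (Fin.succ_pos j), zero_smul]
  refine mem_conformGramSchmidt_iff.2 ⟨by beta_reduce; rwa [e0], by beta_reduce; rw [e0, h2], ?_⟩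
  let W : Matrix (Fin n) (Fin n) ℝ := fun k j => U k.succ j.succ
  have hW : IsLowerPos W :=
    ⟨fun i j hij => hU.1 _ _ (Fin.succ_lt_succ_iff.2 hij), fun i => hU.2 _⟩
  have e : unfloat (fun k => ∑ j, U k j • a j) =
      fun k => ∑ j, W k j • unfloat a j + algebraMap ℝ A (U k.succ 0) := by
    funext k
    simp only [unfloat]
    rw [e0, Fin.sum_univ_succ, add_mul, smul_mul_assoc, Ring.mul_inverse_cancel _ h1,
      Algebra.algebraMap_eq_smul_one, add_comm, Finset.sum_mul]
    simp only [smul_mul_assoc]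
    rfl
  rw [e]
  exact (h3.lower hW).add_algebraMap _

theorem fiberStar_conformGramSchmidt (n : ℕ) : FiberStar (conformGramSchmidt.{u} n) := by
  intro A _ _ _ a B t ht h
  obtain ⟨h1, h2, h3⟩ := mem_conformGramSchmidt_iff.1 h
  have e0 : (t • a + (1 - t) • B) 0 = a 0 := by
    rw [Pi.add_apply, Pi.smul_apply, Pi.smul_apply, h2, ← add_smul]
    simp
  refine mem_conformGramSchmidt_iff.2 ⟨by rwa [e0], by rw [e0, h2], ?_⟩
  have e : unfloat (t • a + (1 - t) • B) = t • unfloat a + (1 - t) • unfloat B := by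
    funext i
    rw [unfloat, e0]
    simp only [Pi.add_apply, Pi.smul_apply, unfloat, add_mul, smul_mul_assoc, h2]
  rw [e]
  exact h3.convex ht

theorem pointwiseFiltered_conformGramSchmidt (n : ℕ) :
    PointwiseFiltered (conformGramSchmidt.{u} n) := by
  intro A _ _ _ a a' B B' k h h' hk
  obtain ⟨h1, h2, h3⟩ := mem_conformGramSchmidt_iff.1 h
  obtain ⟨h1', h2', h3'⟩ := mem_conformGramSchmidt_iff.1 h'
  have e0 : a 0 = a' 0 := hk 0 (Fin.zero_le k)
  induction k using Fin.cases with
  | zero => rw [h2, h2', e0]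
  | succ k =>
    have := pointwiseFiltered_gramSchmidt n A _ _ _ _ k (mem_gramSchmidt_iff.2 h3)
      (mem_gramSchmidt_iff.2 h3') fun i hi => by
        rw [unfloat, unfloat, e0, hk i.succ (Fin.succ_le_succ_iff.2 hi)]
    rw [unfloat, unfloat, h2, h2', ← e0] at this
    exact (h1.ringInverse).mul_right_cancel this

end Operations
end FQ
end

/-! ### Classical Gram-Schmidt and openness of the domains. -/

noncomputable section
namespace FQ

section ClassicalGramSchmidt

open InnerProductSpace

theorem cl_mul_cl_add_swap {V : Type u} [NormedAddCommGroup V] [InnerProductSpace ℝ V] (v w : V) :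
    cl v * cl w + cl w * cl v = algebraMap ℝ _ (-2 * inner ℝ v w) := by
  rw [cl, cl, CliffordAlgebra.ι_mul_ι_add_swap]
  congr 1
  simp [negForm, QuadraticMap.polar, inner_add_right, real_inner_comm v w]
  ring

theorem cl_mul_self {V : Type u} [NormedAddCommGroup V] [InnerProductSpace ℝ V] (v : V) :
    cl v * cl v = algebraMap ℝ _ (-inner ℝ v v) := by
  rw [cl, CliffordAlgebra.ι_sq_scalar]
  simp [negForm]

theorem cl_smul {V : Type u} [NormedAddCommGroup V] [InnerProductSpace ℝ V] (c : ℝ) (v : V) :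
    cl (c • v) = c • cl v := map_smul _ c v

theorem cl_sum {V ι : Type*} [NormedAddCommGroup V] [InnerProductSpace ℝ V] (s : Finset ι)
    (f : ι → V) : cl (∑ i ∈ s, f i) = ∑ i ∈ s, cl (f i) := map_sum (CliffordAlgebra.ι (negForm V)) f s

/-- The coefficients that recover a family from its rescaled Gram-Schmidt process. -/
theorem exists_lower_gramSchmidt {V : Type*} [NormedAddCommGroup V] [InnerProductSpace ℝ V] {n : ℕ}
    (a : Fin n → V) (s : Fin n → ℝ) (hs : ∀ i, 0 < s i) :
    ∃ U : Matrix (Fin n) (Fin n) ℝ, IsLowerPos U ∧ (∀ i, U i i = (s i)⁻¹) ∧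
      ∀ k, a k = ∑ j, U k j • (s j • InnerProductSpace.gramSchmidt ℝ a j) := by
  refine ⟨fun k j => if j < k then
      (s j)⁻¹ * (inner ℝ (InnerProductSpace.gramSchmidt ℝ a j) (a k) / ‖InnerProductSpace.gramSchmidt ℝ a j‖ ^ 2)
    else if j = k then (s k)⁻¹ else 0, ⟨fun i j hij => ?_, fun i => ?_⟩, fun i => ?_, fun k => ?_⟩
  · simp [hij.not_gt, hij.ne']
  · simp [hs i]
  · simp
  · have h1 : ∀ j, s j ≠ 0 := fun j => (hs j).ne'
    have key : ∀ j, (if j < k then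
        (s j)⁻¹ * (inner ℝ (InnerProductSpace.gramSchmidt ℝ a j) (a k) / ‖InnerProductSpace.gramSchmidt ℝ a j‖ ^ 2)
      else if j = k then (s k)⁻¹ else 0) • (s j • InnerProductSpace.gramSchmidt ℝ a j) =
      (if j = k then InnerProductSpace.gramSchmidt ℝ a k else 0) + if j ∈ Finset.Iio k then
        (inner ℝ (InnerProductSpace.gramSchmidt ℝ a j) (a k) / ‖InnerProductSpace.gramSchmidt ℝ a j‖ ^ 2) •
          InnerProductSpace.gramSchmidt ℝ a j else 0 := by
      intro j
      rcases lt_trichotomy j k with h | rfl | h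
      · rw [if_pos h, if_neg h.ne, if_pos (Finset.mem_Iio.2 h), zero_add, smul_smul,
          mul_right_comm, inv_mul_cancel₀ (h1 j), one_mul]
      · simp [smul_smul, h1]
      · simp [h.not_gt, h.ne']
    have e := gramSchmidt_def'' ℝ a k
    simp only [RCLike.ofReal_real_eq_id, id] at e
    simp only [key, Finset.sum_add_distrib, Finset.sum_ite_eq', Finset.mem_univ, if_true,
      Finset.sum_ite_mem, Finset.univ_inter]
    exact e

/-- An orthonormal family is a Clifford system and is fixed; the given family arises from it by a
triangular matrix with positive diagonal. -/
theorem permanenceGS_gramSchmidt (n : ℕ) : PermanenceGS (FQ.gramSchmidt.{u} n) := by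
  intro V _ _ _ a ha
  have hpos : ∀ i, 0 < ‖InnerProductSpace.gramSchmidt ℝ a i‖ := fun i => norm_pos_iff.2 (gramSchmidt_ne_zero i ha)
  obtain ⟨U, hU, -, h⟩ := exists_lower_gramSchmidt a (fun i => ‖InnerProductSpace.gramSchmidt ℝ a i‖⁻¹)
    fun i => inv_pos.2 (hpos i)
  have hn := gramSchmidtNormed_orthonormal (𝕜 := ℝ) ha
  rw [orthonormal_iff_ite] at hn
  have hQ : IsClifford (fun k => cl (gramSchmidtNormed ℝ a k)) := fun i j => by
    rw [cl_mul_cl_add_swap, hn]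
    split_ifs <;> simp [Algebra.algebraMap_eq_smul_one, two_smul, one_add_one_eq_two]
  have h1 := parabolic_gramSchmidt n _ _ _ U hU (cliffordConservative_gramSchmidt n _ _ hQ)
  convert h1 using 2
  funext k
  conv_lhs => rw [h k]
  rw [cl_sum]
  simp only [gramSchmidtNormed, RCLike.ofReal_real_eq_id, id, cl_smul]

/-- The rescaled orthogonal vectors have equal length, which makes them a floating Clifford system.
The scale of the first vector is 1, so the triangular matrix has upper left entry 1. -/
theorem permanenceConformGS_conformGramSchmidt (n : ℕ) :
    PermanenceConformGS (conformGramSchmidt.{u} n) := by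
  intro V _ _ _ a ha
  set g := InnerProductSpace.gramSchmidt ℝ a
  have hg0 : ∀ i, g i ≠ 0 := fun i => gramSchmidt_ne_zero i ha
  have hpos : ∀ i, 0 < inner ℝ (g i) (g i) := fun i => real_inner_self_pos.2 (hg0 i)
  set s : Fin (n + 1) → ℝ := fun k => Real.sqrt (inner ℝ (g 0) (g 0) / inner ℝ (g k) (g k)) with hs
  have hs0 : s 0 = 1 := by rw [hs]; simp [hg0 0]
  have hspos : ∀ i, 0 < s i := fun i => Real.sqrt_pos.2 (div_pos (hpos 0) (hpos i))
  obtain ⟨U, hU, hU1, h⟩ := exists_lower_gramSchmidt a s hspos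
  set q := inner ℝ (g 0) (g 0) with hq
  have hin : ∀ i j, inner ℝ (s i • g i) (s j • g j) = if i = j then q else 0 := by
    intro i j
    rw [real_inner_smul_left, real_inner_smul_right]
    split_ifs with hij
    · subst hij
      rw [← mul_assoc, Real.mul_self_sqrt (div_nonneg (hpos 0).le (hpos i).le),
        div_mul_cancel₀ _ (hpos i).ne']
    · rw [gramSchmidt_orthogonal ℝ a hij]; simp
  set Q : Fin (n + 1) → CliffordAlgebra (negForm V) := fun k => cl (s k • g k) with hQdef
  have hsq : ∀ k, Q k * Q k = algebraMap ℝ _ (-q) := fun k => by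
    rw [hQdef]; beta_reduce; rw [cl_mul_self, hin, if_pos rfl]
  have hac : ∀ i j, i ≠ j → Q i * Q j = -(Q j * Q i) := fun i j hij => by
    refine eq_neg_of_add_eq_zero_left ?_
    rw [hQdef]; beta_reduce; rw [cl_mul_cl_add_swap, hin, if_neg hij]; simp
  have hq0 : q ≠ 0 := (hpos 0).ne'
  have hmul : Q 0 * ((-q⁻¹) • Q 0) = 1 ∧ ((-q⁻¹) • Q 0) * Q 0 = 1 := by
    rw [mul_smul_comm, smul_mul_assoc, hsq, Algebra.algebraMap_eq_smul_one, smul_smul]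
    simp [hq0]
  have hinv : Ring.inverse (Q 0) = (-q⁻¹) • Q 0 := Ring.inverse_unit ⟨_, _, hmul.1, hmul.2⟩
  -- The inverse of `Q 0` is a multiple of `Q 0`, which anticommutes with the other components and
  -- has square -q.
  have hsucc : ∀ i j : Fin n, unfloat Q i * unfloat Q j = q⁻¹ • (Q i.succ * Q j.succ) := by
    intro i j
    simp only [unfloat, hinv]
    have e : Q i.succ * Q 0 * (Q j.succ * Q 0) = q • (Q i.succ * Q j.succ) := by
      rw [mul_assoc, ← mul_assoc (Q 0), hac 0 j.succ (Fin.succ_ne_zero j).symm, neg_mul,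
        mul_assoc (Q j.succ), hsq, Algebra.algebraMap_eq_smul_one, mul_smul_comm, mul_one, neg_smul,
        neg_neg, mul_smul_comm]
    rw [mul_smul_comm, mul_smul_comm, smul_mul_smul_comm, e, smul_smul]
    congr 1
    field_simp
  have hfl : IsFloatingClifford Q := by
    refine ⟨⟨⟨_, _, hmul.1, hmul.2⟩, rfl⟩, isClifford_iff.2 ⟨fun i => ?_, fun i j hij => ?_⟩⟩
    · rw [hsucc, hsq, Algebra.algebraMap_eq_smul_one, smul_smul]
      simp [hq0]
    · rw [hsucc, hsucc, hac _ _ fun e => hij.ne' (Fin.succ_injective _ e), smul_neg]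
  have h1 := conformParabolic_conformGramSchmidt n _ _ _ U hU (by rw [hU1, hs0, inv_one])
    (floatingCliffordConservative_conformGramSchmidt n _ _ hfl)
  convert h1 using 2
  funext k
  conv_lhs => rw [h k]
  rw [cl_sum]
  simp only [cl_smul, hQdef]
  rfl

end ClassicalGramSchmidt

section Open

open Filter Topology

variable {A : Type u} [Ring A] [Algebra ℝ A] [ConvenientAlgebra A]

theorem rep_one_antisymmList (R : A) (l : List A) :
    rep A 1 (antisymmList R l) = antisymmList (rep A 1 R) (l.map (rep A 1)) := by
  induction l generalizing R with
  | nil => rfl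
  | cons q l ih =>
    change rep A 1 (antisymmList (antisymm R q) l) =
      antisymmList (antisymm (rep A 1 R) (rep A 1 q)) (l.map (rep A 1))
    rw [ih, antisymm, map_smul, map_sub, map_mul, map_mul, rep_one_inverse]
    rfl

theorem polDom_iff_rep {H : A} : PolDom H ↔ PolDom (rep A 1 H) := by
  rw [PolDom, PolDom, invSqrtDom_iff_rep, map_neg, map_pow]

theorem isOpen_polDom {E : Type*} [NormedRing E] [NormedAlgebra ℝ E] [CompleteSpace E] :
    IsOpen {H : E | PolDom H} :=
  isOpen_invSqrtDom.preimage (f := fun H : E => -H ^ 2) (by fun_prop)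

theorem rep_pol {H : A} (hH : PolDom H) (i : ℕ) :
    rep A i (pol H) = rep A i H * banachInvSqrt (-rep A i H ^ 2) := by
  rw [pol, map_mul, rep_invSqrt hH, map_neg, map_pow]

theorem continuousAt_antisymmList {X E : Type*} [TopologicalSpace X] [NormedRing E]
    [NormedAlgebra ℝ E] [CompleteSpace E] {x : X} (l : List (X → E)) {f : X → E}
    (hf : ContinuousAt f x) (hl : ∀ g ∈ l, ContinuousAt g x ∧ IsUnit (g x)) :
    ContinuousAt (fun y => antisymmList (f y) (l.map fun g => g y)) x := by
  induction l generalizing f with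
  | nil => exact hf
  | cons g l ih =>
    refine ih (f := fun y => antisymm (f y) (g y)) ?_ fun g' hg' => hl g' (by simp [hg'])
    obtain ⟨hg, u, hu⟩ := hl g (by simp)
    have hi : ContinuousAt (fun y => Ring.inverse (g y)) x :=
      ContinuousAt.comp (g := Ring.inverse) (f := g) (hu ▸ NormedRing.inverse_continuousAt u) hg
    exact (hf.sub ((hi.mul hf).mul hg)).const_smul _

/-- Continuity and persistence of the domain must run through the recursion together, all on level
1. An arbitrary parameter space X lets the conform case reuse the result with `unfloat`. -/
theorem continuousAt_gramSchmidt {X : Type*} [TopologicalSpace X] {n : ℕ} {a : X → Fin n → A} {x : X}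
    (ha : ∀ i, ContinuousAt (fun y => rep A 1 (a y i)) x) (hx : ∀ k, PolDom (gsTerm (a x) k)) :
    ∀ (m : ℕ) (hm : m < n), ContinuousAt (fun y => rep A 1 (gsSeq (a y) ⟨m, hm⟩)) x ∧
      ∀ᶠ y in 𝓝 x, PolDom (gsTerm (a y) ⟨m, hm⟩) := by
  have hu : ∀ k, IsUnit (gsSeq (a x) k) := fun k => by
    rw [gsSeq_eq]
    exact isUnit_of_mul_self_eq_neg_one (isPol_pol (hx k)).1
  intro m
  induction m using Nat.strong_induction_on with
  | _ m ih =>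
    intro hm
    have hT : ContinuousAt (fun y => rep A 1 (gsTerm (a y) ⟨m, hm⟩)) x := by
      have h := continuousAt_antisymmList (x := x) (List.ofFn fun (i : Fin m) y =>
        rep A 1 (gsSeq (a y) ⟨i, i.isLt.trans hm⟩)) (ha ⟨m, hm⟩) (by
          intro g hg
          obtain ⟨i, rfl⟩ := List.mem_ofFn.1 hg
          exact ⟨(ih i i.isLt _).1, (hu _).map _⟩)
      refine h.congr (Eventually.of_forall fun y => ?_)
      beta_reduce
      rw [gsTerm_eq, rep_one_antisymmList, map_prefixList, List.map_ofFn]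
      rfl
    have hev : ∀ᶠ y in 𝓝 x, PolDom (gsTerm (a y) ⟨m, hm⟩) := by
      have := hT.eventually (isOpen_polDom.mem_nhds (polDom_iff_rep.1 (hx ⟨m, hm⟩)))
      exact this.mono fun y hy => polDom_iff_rep.2 hy
    refine ⟨?_, hev⟩
    have h1 : ContinuousAt (fun y => rep A 1 (gsTerm (a y) ⟨m, hm⟩) *
        banachInvSqrt (-rep A 1 (gsTerm (a y) ⟨m, hm⟩) ^ 2)) x := by
      refine hT.mul (ContinuousAt.comp (g := banachInvSqrt) (f := fun y =>
        -rep A 1 (gsTerm (a y) ⟨m, hm⟩) ^ 2) ?_ (hT.pow 2).neg)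
      exact continuousAt_banachInvSqrt (polDom_iff_rep.1 (hx ⟨m, hm⟩))
    refine h1.congr (hev.mono fun y hy => ?_)
    beta_reduce
    rw [gsSeq_eq, rep_pol hy]

theorem eventually_gramSchmidt_dom {X : Type*} [TopologicalSpace X] {n : ℕ} {a : X → Fin n → A} {x : X}
    (ha : ∀ i, ContinuousAt (fun y => rep A 1 (a y i)) x)
    (hx : a x ∈ (gramSchmidt n A).Dom) : ∀ᶠ y in 𝓝 x, a y ∈ (gramSchmidt n A).Dom :=
  eventually_all.2 fun k => (continuousAt_gramSchmidt ha hx k k.isLt).2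

theorem isZeroOpen_gramSchmidt_dom (n : ℕ) : IsZeroOpen (gramSchmidt n A).Dom := by
  let _ : TopologicalSpace A := zeroTopology A
  change IsOpen (gramSchmidt n A).Dom
  refine isOpen_iff_eventually.2 fun a ha => ?_
  refine eventually_gramSchmidt_dom (a := id) (fun i => ?_) ha
  exact ((continuous_rep_levelTopology A 1).comp (continuous_apply i)).continuousAt

theorem isZeroOpen_conformGramSchmidt_dom (n : ℕ) : IsZeroOpen (conformGramSchmidt n A).Dom := by
  let _ : TopologicalSpace A := zeroTopology A
  change IsOpen (conformGramSchmidt n A).Dom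
  refine isOpen_iff_eventually.2 fun a ha => ?_
  have hc : ∀ i, ContinuousAt (fun b : Fin (n + 1) → A => rep A 1 (b i)) a := fun i =>
    ((continuous_rep_levelTopology A 1).comp (continuous_apply i)).continuousAt
  have h0 : ∀ᶠ b : Fin (n + 1) → A in 𝓝 a, IsUnit (b 0) := by
    have := (hc 0).eventually (Units.isOpen.mem_nhds (isUnit_iff_rep.1 ha.1))
    exact this.mono fun b hb => isUnit_iff_rep.2 hb
  have h1 : ∀ᶠ b : Fin (n + 1) → A in 𝓝 a, unfloat b ∈ (gramSchmidt n A).Dom := by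
    refine eventually_gramSchmidt_dom (a := unfloat) (fun i => ?_) ha.2
    simp only [unfloat, map_mul, rep_one_inverse]
    obtain ⟨u, hu⟩ := isUnit_iff_rep.1 ha.1
    have hi := (hu ▸ NormedRing.inverse_continuousAt u : ContinuousAt Ring.inverse (rep A 1 (a 0)))
    exact (hc i.succ).mul (ContinuousAt.comp (f := fun b : Fin (n + 1) → A => rep A 1 (b 0)) hi (hc 0))
  exact h0.and h1

end Open
end FQ
end

/-! ### Substitution into real power series over noncommutative rings. -/

noncomputable section
namespace FQ

section Substitution

open PowerSeries

variable {S : Type*} [Ring S] [Algebra ℝ S] {E : PowerSeries S}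

theorem coeff_real_smul (c : ℝ) (f : PowerSeries S) (N : ℕ) : coeff N (c • f) = c • coeff N f := rfl

theorem coeff_pow_of_lt {S : Type*} [Ring S] {E : PowerSeries S} (hE : constantCoeff E = 0)
    {N k : ℕ} (h : N < k) : coeff N (E ^ k) = 0 := by
  induction k generalizing N with
  | zero => omega
  | succ k ih =>
    rw [pow_succ, coeff_mul]
    refine Finset.sum_eq_zero fun p hp => ?_
    rw [Finset.HasAntidiagonal.mem_antidiagonal] at hp
    rcases Nat.eq_zero_or_pos p.2 with h2 | h2
    · rw [h2, coeff_zero_eq_constantCoeff, hE, mul_zero]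
    · rw [ih (by omega), zero_mul]

/-- The coefficients of the result of the substitution of `E` into a real power series. -/
def substFun (E : PowerSeries S) (f : PowerSeries ℝ) : PowerSeries S :=
  PowerSeries.mk fun N => ∑ k ∈ Finset.range (N + 1), coeff k f • coeff N (E ^ k)

theorem coeff_substFun (f : PowerSeries ℝ) (N : ℕ) :
    coeff N (substFun E f) = ∑ k ∈ Finset.range (N + 1), coeff k f • coeff N (E ^ k) :=
  coeff_mk _ _

theorem coeff_aeval (hE : constantCoeff E = 0) (p : Polynomial ℝ) (N : ℕ) :
    coeff N (Polynomial.aeval E p) =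
      ∑ k ∈ Finset.range (N + 1), p.coeff k • coeff N (E ^ k) := by
  rw [Polynomial.aeval_eq_sum_range' (n := p.natDegree + 1 + (N + 1)) (by omega), map_sum]
  symm
  refine Finset.sum_subset_zero_on_sdiff (fun k hk => ?_) (fun k hk => ?_) (fun k _ => rfl)
  · rw [Finset.mem_range] at hk ⊢
    omega
  · rw [Finset.mem_sdiff, Finset.mem_range, Finset.mem_range] at hk
    change p.coeff k • coeff N (E ^ k) = 0
    rw [coeff_pow_of_lt hE (by omega), smul_zero]

/-- Since E ^ k starts in degree k, a coefficient of the substitution sees only a truncation of f.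
Multiplicativity and commutation are thereby inherited from polynomial evaluation. -/
theorem coeff_substFun_eq (hE : constantCoeff E = 0) {f : PowerSeries ℝ} {p : Polynomial ℝ} {N : ℕ}
    (h : ∀ k ≤ N, p.coeff k = coeff k f) :
    coeff N (substFun E f) = coeff N (Polynomial.aeval E p) := by
  rw [coeff_substFun, coeff_aeval hE]
  refine Finset.sum_congr rfl fun k hk => ?_
  rw [h k (Nat.lt_succ_iff.1 (Finset.mem_range.1 hk))]

/-- Substitution of a power series without constant term, over a possibly noncommutative ring,
into real power series. -/
def substHom (E : PowerSeries S) (hE : constantCoeff E = 0) : PowerSeries ℝ →ₐ[ℝ] PowerSeries S :=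
  AlgHom.ofLinearMap
    { toFun := substFun E
      map_add' := fun f g => by
        ext N
        simp only [coeff_substFun, map_add, add_smul, Finset.sum_add_distrib]
      map_smul' := fun c f => by
        ext N
        rw [RingHom.id_apply, coeff_real_smul, coeff_substFun, coeff_substFun, Finset.smul_sum]
        simp only [map_smul, smul_assoc] }
    (by
      ext N
      change coeff N (substFun E 1) = _
      rw [coeff_substFun_eq hE (p := 1) fun k _ => by
        rw [Polynomial.coeff_one, PowerSeries.coeff_one]]
      simp)
    (fun f g => by
      ext N
      change coeff N (substFun E (f * g)) = coeff N (substFun E f * substFun E g)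
      have hl : ∀ (h : PowerSeries ℝ) (k : ℕ), k ≤ N → (trunc (N + 1) h).coeff k = coeff k h :=
        fun h k hk => by rw [coeff_trunc, if_pos (by omega)]
      rw [coeff_substFun_eq hE (p := trunc (N + 1) f * trunc (N + 1) g), map_mul, coeff_mul, coeff_mul]
      · refine Finset.sum_congr rfl fun p hp => ?_
        rw [Finset.HasAntidiagonal.mem_antidiagonal] at hp
        rw [coeff_substFun_eq hE fun k hk => hl f k (by omega),
          coeff_substFun_eq hE fun k hk => hl g k (by omega)]
      · intro k hk
        rw [coeff_mul_eq_coeff_trunc_mul_trunc (n := N + 1) f g (by omega), ← Polynomial.coe_mul,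
          Polynomial.coeff_coe])

theorem coeff_substHom (hE : constantCoeff E = 0) (f : PowerSeries ℝ) (N : ℕ) :
    coeff N (substHom E hE f) = ∑ k ∈ Finset.range (N + 1), coeff k f • coeff N (E ^ k) :=
  coeff_substFun f N

theorem substHom_X (hE : constantCoeff E = 0) : substHom E hE X = E := by
  ext N
  change coeff N (substFun E X) = _
  rw [coeff_substFun_eq hE (p := Polynomial.X) fun k _ => by
    rw [Polynomial.coeff_X, coeff_X]; simp [eq_comm], Polynomial.aeval_X]

theorem constantCoeff_substHom (hE : constantCoeff E = 0) (f : PowerSeries ℝ) :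
    constantCoeff (substHom E hE f) = algebraMap ℝ S (constantCoeff f) := by
  rw [← coeff_zero_eq_constantCoeff_apply, coeff_substHom]
  simp [Algebra.algebraMap_eq_smul_one]

theorem commute_substHom (hE : constantCoeff E = 0) {y : PowerSeries S} (h : Commute y E)
    (f : PowerSeries ℝ) : Commute y (substHom E hE f) := by
  ext N
  have hf : ∀ k ≤ N, (trunc (N + 1) f).coeff k = coeff k f :=
    fun k hk => by rw [coeff_trunc, if_pos (by omega)]
  have hc : Commute y (Polynomial.aeval E (trunc (N + 1) f)) := by
    rw [Polynomial.aeval_eq_sum_range]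
    exact Commute.sum_right _ _ _ fun k _ => (h.pow_right k).smul_right _
  have := congrArg (coeff N) hc.eq
  rw [coeff_mul, coeff_mul] at this ⊢
  refine Eq.trans (Finset.sum_congr rfl fun p hp => ?_) (this.trans
    (Finset.sum_congr rfl fun p hp => ?_)) <;> rw [Finset.HasAntidiagonal.mem_antidiagonal] at hp
  · congr 1
    exact coeff_substFun_eq hE fun k hk => hf k (by omega)
  · congr 1
    exact (coeff_substFun_eq hE fun k hk => hf k (by omega)).symm

theorem binomialSeries_sq_mul :
    PowerSeries.binomialSeries ℝ (-1 / 2 : ℝ) ^ 2 * (1 + X) = 1 := by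
  have h := binomialSeries_nat (R := ℝ) (A := ℝ) 1
  rw [pow_one, Nat.cast_one] at h
  rw [pow_two, ← h, ← binomialSeries_add, ← binomialSeries_add]
  norm_num

theorem binomialSeries_neg_one_mul : PowerSeries.binomialSeries ℝ (-1 : ℝ) * (1 + X) = 1 := by
  have h := binomialSeries_nat (R := ℝ) (A := ℝ) 1
  rw [pow_one, Nat.cast_one] at h
  rw [← h, ← binomialSeries_add]
  norm_num

/-- Consecutive coefficients have ratio (r - k)/(k + 1), of absolute value at most 1 in this range
of r. -/
theorem norm_coeff_binomialSeries_le {r : ℝ} (h : -1 ≤ r) (h' : r ≤ 0) (k : ℕ) :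
    ‖coeff k (PowerSeries.binomialSeries ℝ r)‖ ≤ 1 := by
  rw [binomialSeries_coeff, smul_eq_mul, mul_one]
  induction k with
  | zero => simp
  | succ k ih =>
    have e : Ring.choose r (k + 1) = (r - k) / (k + 1) * Ring.choose r k := by
      rw [Ring.choose_eq_smul, Ring.choose_eq_smul, descPochhammer_succ_right, Polynomial.smeval_mul,
        Nat.factorial_succ]
      simp only [smul_eq_mul, Polynomial.smeval_sub, Polynomial.smeval_X, Polynomial.smeval_natCast]
      push_cast
      have : (k : ℝ) + 1 ≠ 0 := by positivity
      field_simp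
      simp
    rw [e, norm_mul]
    refine mul_le_one₀ ?_ (norm_nonneg _) ih
    have hk : (0 : ℝ) < k + 1 := by positivity
    rw [Real.norm_eq_abs, abs_div, abs_of_pos hk, div_le_one hk, abs_le]
    constructor <;> linarith [(Nat.cast_nonneg k : (0 : ℝ) ≤ k)]

end Substitution
end FQ
end

/-! ### Weighted norms and convergent series of words. -/

noncomputable section
namespace FQ

section WeightedNorm

open PowerSeries
open scoped ENNReal NNReal

variable {M : Type*}

/-- The `ℓ¹`-norm on a monoid algebra. -/
def wnorm (f : MonoidAlgebra ℝ M) : ℝ≥0∞ := ∑' w, ‖f.coeff w‖ₑ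

theorem wnorm_zero : wnorm (0 : MonoidAlgebra ℝ M) = 0 := by
  simp [wnorm]

theorem wnorm_add_le (f g : MonoidAlgebra ℝ M) : wnorm (f + g) ≤ wnorm f + wnorm g := by
  rw [wnorm, wnorm, wnorm, ← ENNReal.tsum_add]
  refine ENNReal.tsum_le_tsum fun w => ?_
  rw [MonoidAlgebra.coeff_add, Finsupp.add_apply]
  exact enorm_add_le _ _

theorem wnorm_smul_le (c : ℝ) (f : MonoidAlgebra ℝ M) : wnorm (c • f) ≤ ‖c‖ₑ * wnorm f := by
  rw [wnorm, wnorm, ← ENNReal.tsum_mul_left]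
  refine ENNReal.tsum_le_tsum fun w => ?_
  rw [MonoidAlgebra.coeff_smul, Finsupp.smul_apply, enorm_smul]

theorem wnorm_sum_le {ι : Type*} (s : Finset ι) (f : ι → MonoidAlgebra ℝ M) :
    wnorm (∑ i ∈ s, f i) ≤ ∑ i ∈ s, wnorm (f i) :=
  Finset.le_sum_of_subadditive wnorm wnorm_zero.le wnorm_add_le s f

theorem wnorm_single (w : M) (c : ℝ) : wnorm (MonoidAlgebra.single w c) = ‖c‖ₑ := by
  rw [wnorm, tsum_eq_single w]
  · simp
  · intro v hv
    rw [MonoidAlgebra.coeff_single, Finsupp.single_eq_of_ne hv, enorm_zero]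

theorem wnorm_eq_sum (f : MonoidAlgebra ℝ M) : wnorm f = ∑ w ∈ f.coeff.support, ‖f.coeff w‖ₑ :=
  tsum_eq_sum fun w hw => by rw [Finsupp.notMem_support_iff.1 hw, enorm_zero]

theorem wnorm_ne_top (f : MonoidAlgebra ℝ M) : wnorm f ≠ ∞ := by
  rw [wnorm_eq_sum]
  exact ENNReal.sum_ne_top.2 fun w _ => enorm_ne_top

theorem wnorm_mul_le [Monoid M] (f g : MonoidAlgebra ℝ M) : wnorm (f * g) ≤ wnorm f * wnorm g := by
  rw [MonoidAlgebra.mul_def, Finsupp.sum, wnorm_eq_sum f, wnorm_eq_sum g, Finset.sum_mul]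
  refine (wnorm_sum_le _ _).trans (Finset.sum_le_sum fun u _ => ?_)
  rw [Finsupp.sum, Finset.mul_sum]
  refine (wnorm_sum_le _ _).trans (Finset.sum_le_sum fun v _ => ?_)
  rw [wnorm_single, enorm_mul]

variable [Monoid M]

/-- The weighted `ℓ¹`-norm on power series with coefficients in a monoid algebra. -/
def pnorm (ρ : ℝ≥0) (f : PowerSeries (MonoidAlgebra ℝ M)) : ℝ≥0∞ :=
  ∑' r, (ρ : ℝ≥0∞) ^ r * wnorm (coeff r f)

theorem pnorm_add_le (ρ : ℝ≥0) (f g : PowerSeries (MonoidAlgebra ℝ M)) :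
    pnorm ρ (f + g) ≤ pnorm ρ f + pnorm ρ g := by
  rw [pnorm, pnorm, pnorm, ← ENNReal.tsum_add]
  refine ENNReal.tsum_le_tsum fun r => ?_
  rw [← mul_add, map_add]
  gcongr
  exact wnorm_add_le _ _

theorem pnorm_C (ρ : ℝ≥0) (f : MonoidAlgebra ℝ M) : pnorm ρ (C f) = wnorm f := by
  rw [pnorm, tsum_eq_single 0]
  · simp
  · intro r hr
    rw [coeff_C, if_neg hr, wnorm_zero, mul_zero]

theorem pnorm_one (ρ : ℝ≥0) : pnorm ρ (1 : PowerSeries (MonoidAlgebra ℝ M)) = 1 := by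
  rw [← map_one (C (R := MonoidAlgebra ℝ M)), pnorm_C, MonoidAlgebra.one_def, wnorm_single, enorm_one]

theorem pnorm_mul_le (ρ : ℝ≥0) (f g : PowerSeries (MonoidAlgebra ℝ M)) :
    pnorm ρ (f * g) ≤ pnorm ρ f * pnorm ρ g := by
  have h1 : ∀ r, (ρ : ℝ≥0∞) ^ r * wnorm (coeff r (f * g)) ≤
      ∑' p : Finset.HasAntidiagonal.antidiagonal r, ((ρ : ℝ≥0∞) ^ p.1.1 * wnorm (coeff p.1.1 f)) *
        ((ρ : ℝ≥0∞) ^ p.1.2 * wnorm (coeff p.1.2 g)) := by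
    intro r
    rw [coeff_mul, Finset.tsum_subtype (Finset.HasAntidiagonal.antidiagonal r) fun p =>
      ((ρ : ℝ≥0∞) ^ p.1 * wnorm (coeff p.1 f)) * ((ρ : ℝ≥0∞) ^ p.2 * wnorm (coeff p.2 g))]
    refine (mul_le_mul_right (wnorm_sum_le _ _) _).trans ?_
    rw [Finset.mul_sum]
    refine Finset.sum_le_sum fun p hp => ?_
    rw [← Finset.HasAntidiagonal.mem_antidiagonal.1 hp, pow_add, mul_mul_mul_comm]
    gcongr
    exact wnorm_mul_le _ _
  refine (ENNReal.tsum_le_tsum h1).trans ?_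
  rw [← ENNReal.tsum_sigma' fun p : (Σ r, Finset.HasAntidiagonal.antidiagonal r) =>
    ((ρ : ℝ≥0∞) ^ p.2.1.1 * wnorm (coeff p.2.1.1 f)) *
      ((ρ : ℝ≥0∞) ^ p.2.1.2 * wnorm (coeff p.2.1.2 g))]
  refine (Finset.HasAntidiagonal.sigmaAntidiagonalEquivProd.tsum_eq fun p : ℕ × ℕ =>
    ((ρ : ℝ≥0∞) ^ p.1 * wnorm (coeff p.1 f)) * ((ρ : ℝ≥0∞) ^ p.2 * wnorm (coeff p.2 g))).le.trans ?_
  rw [ENNReal.tsum_prod', pnorm, pnorm, ← ENNReal.tsum_mul_right]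
  exact ENNReal.tsum_le_tsum fun r => ENNReal.tsum_mul_left.le

theorem pnorm_pow_le (ρ : ℝ≥0) (f : PowerSeries (MonoidAlgebra ℝ M)) (k : ℕ) :
    pnorm ρ (f ^ k) ≤ pnorm ρ f ^ k := by
  induction k with
  | zero => rw [pow_zero, pow_zero, pnorm_one]
  | succ k ih =>
    rw [pow_succ, pow_succ]
    exact (pnorm_mul_le _ _ _).trans (by gcongr)

theorem pnorm_mono {ρ σ : ℝ≥0} (h : ρ ≤ σ) (f : PowerSeries (MonoidAlgebra ℝ M)) :
    pnorm ρ f ≤ pnorm σ f :=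
  ENNReal.tsum_le_tsum fun r => by gcongr

/-- Without constant term every coefficient gains at least one factor t. -/
theorem pnorm_mul_radius_le {f : PowerSeries (MonoidAlgebra ℝ M)} (hf : constantCoeff f = 0)
    {t : ℝ≥0} (ht : t ≤ 1) (ρ : ℝ≥0) : pnorm (t * ρ) f ≤ t * pnorm ρ f := by
  rw [pnorm, pnorm, ← ENNReal.tsum_mul_left]
  refine ENNReal.tsum_le_tsum fun r => ?_
  rcases r with _ | r
  · rw [coeff_zero_eq_constantCoeff, hf, wnorm_zero]
    simp
  · rw [ENNReal.coe_mul, mul_pow, ← mul_assoc]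
    gcongr
    rw [pow_succ]
    refine mul_le_of_le_one_left' (pow_le_one' ?_ r)
    exact_mod_cast ht

theorem exists_pnorm_le {f : PowerSeries (MonoidAlgebra ℝ M)} (hf : constantCoeff f = 0)
    {ρ : ℝ≥0} (hρ : 0 < ρ) (h : pnorm ρ f ≠ ∞) {ε : ℝ≥0} (hε : 0 < ε) :
    ∃ σ : ℝ≥0, 0 < σ ∧ pnorm σ f ≤ ε := by
  lift pnorm ρ f to ℝ≥0 using h with K hK
  refine ⟨min 1 (ε / (K + 1)) * ρ, by positivity, ?_⟩
  refine (pnorm_mul_radius_le hf (min_le_left _ _) ρ).trans ?_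
  rw [← hK]
  norm_cast
  calc min 1 (ε / (K + 1)) * K ≤ ε / (K + 1) * (K + 1) := by
        gcongr
        · exact min_le_right _ _
        · exact le_self_add
    _ = ε := div_mul_cancel₀ _ (by positivity)

/-- Comparison with the geometric series of ratio 1/2. -/
theorem pnorm_substHom_le {E : PowerSeries (MonoidAlgebra ℝ M)} (hE : constantCoeff E = 0)
    {c : PowerSeries ℝ} (hc : ∀ k, ‖coeff k c‖ ≤ 1) {ρ : ℝ≥0} (h : pnorm ρ E ≤ 2⁻¹) :
    pnorm ρ (substHom E hE c) ≤ 2 := by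
  have h1 : ∀ r, (ρ : ℝ≥0∞) ^ r * wnorm (coeff r (substHom E hE c)) ≤
      ∑' k, (ρ : ℝ≥0∞) ^ r * wnorm (coeff r (E ^ k)) := by
    intro r
    rw [coeff_substHom, ENNReal.tsum_mul_left]
    gcongr
    refine (wnorm_sum_le _ _).trans ((Finset.sum_le_sum fun k _ => ?_).trans
      (ENNReal.sum_le_tsum (Finset.range (r + 1))))
    refine (wnorm_smul_le _ _).trans (mul_le_of_le_one_left' ?_)
    rw [← ofReal_norm, ← ENNReal.ofReal_one]
    exact ENNReal.ofReal_le_ofReal (hc k)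
  refine (ENNReal.tsum_le_tsum h1).trans ?_
  rw [ENNReal.tsum_comm]
  calc ∑' k, pnorm ρ (E ^ k) ≤ ∑' k : ℕ, (2⁻¹ : ℝ≥0∞) ^ k :=
        ENNReal.tsum_le_tsum fun k => (pnorm_pow_le _ _ _).trans (by gcongr)
    _ = 2 := by rw [ENNReal.tsum_geometric, ENNReal.one_sub_inv_two, inv_inv]

end WeightedNorm

section ConvergentSeries

open PowerSeries
open scoped ENNReal NNReal

variable {m p : ℕ}

/-- Words in letters `inl i`, which stand for the elements of a Clifford system, and `inr j`, which
stand for perturbations. -/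
abbrev Words (m p : ℕ) : Type := FreeMonoid (Fin m ⊕ Fin p)

/-- The number of perturbation letters in a word. -/
def pdeg (w : Words m p) : ℕ := w.toList.countP Sum.isRight

theorem pdeg_mul (u v : Words m p) : pdeg (u * v) = pdeg u + pdeg v := by
  rw [pdeg, FreeMonoid.toList_mul, List.countP_append]
  rfl

/-- Formal power series with positive radius of convergence whose `r`-th coefficient is a combination
of words in the letters from `s` with `r` perturbation letters. -/
def convSeries (s : Set (Fin m ⊕ Fin p)) :
    Subalgebra ℝ (PowerSeries (MonoidAlgebra ℝ (Words m p))) where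
  carrier := {f | (∀ r w, (coeff r f).coeff w ≠ 0 → pdeg w = r ∧ ∀ x ∈ w.toList, x ∈ s) ∧
    ∃ ρ : ℝ≥0, 0 < ρ ∧ pnorm ρ f ≠ ∞}
  mul_mem' := by
    classical
    rintro f g ⟨hf, ρ, hρ, hfρ⟩ ⟨hg, σ, hσ, hgσ⟩
    refine ⟨fun r w hw => ?_, min ρ σ, lt_min hρ hσ, ?_⟩
    · rw [coeff_mul, MonoidAlgebra.coeff_sum, Finsupp.finsetSum_apply] at hw
      obtain ⟨q, hq, hw⟩ := Finset.exists_ne_zero_of_sum_ne_zero hw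
      rw [MonoidAlgebra.coeff_mul, Finsupp.sum] at hw
      obtain ⟨u, hu, hw⟩ := Finset.exists_ne_zero_of_sum_ne_zero hw
      rw [Finsupp.sum] at hw
      obtain ⟨v, hv, hw⟩ := Finset.exists_ne_zero_of_sum_ne_zero hw
      rw [Finsupp.mem_support_iff] at hu hv
      obtain ⟨hu1, hu2⟩ := hf _ _ hu
      obtain ⟨hv1, hv2⟩ := hg _ _ hv
      obtain rfl : u * v = w := by
        by_contra h
        exact hw (if_neg h)
      refine ⟨?_, fun x hx => ?_⟩
      · rw [pdeg_mul, hu1, hv1, Finset.HasAntidiagonal.mem_antidiagonal.1 hq]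
      · rw [FreeMonoid.toList_mul, List.mem_append] at hx
        exact hx.elim (hu2 x) (hv2 x)
    · refine ne_top_of_le_ne_top (ENNReal.mul_ne_top (ne_top_of_le_ne_top hfρ ?_)
        (ne_top_of_le_ne_top hgσ ?_)) (pnorm_mul_le _ f g)
      · exact pnorm_mono (min_le_left _ _) f
      · exact pnorm_mono (min_le_right _ _) g
  add_mem' := by
    rintro f g ⟨hf, ρ, hρ, hfρ⟩ ⟨hg, σ, hσ, hgσ⟩
    refine ⟨fun r w hw => ?_, min ρ σ, lt_min hρ hσ, ?_⟩
    · by_cases h : (coeff r f).coeff w = 0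
      · refine hg r w fun h' => hw ?_
        rw [map_add, MonoidAlgebra.coeff_add, Finsupp.add_apply, h, h', add_zero]
      · exact hf r w h
    · refine ne_top_of_le_ne_top (ENNReal.add_ne_top.2 ⟨ne_top_of_le_ne_top hfρ ?_,
        ne_top_of_le_ne_top hgσ ?_⟩) (pnorm_add_le _ f g)
      · exact pnorm_mono (min_le_left _ _) f
      · exact pnorm_mono (min_le_right _ _) g
  algebraMap_mem' c := by
    rw [PowerSeries.algebraMap_apply]
    refine ⟨fun r w hw => ?_, 1, one_pos, ?_⟩
    · rw [coeff_C] at hw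
      rcases eq_or_ne r 0 with rfl | hr
      · rw [if_pos rfl] at hw
        obtain rfl : w = 1 := by
          by_contra h
          apply hw
          change (MonoidAlgebra.single 1 c).coeff w = 0
          rw [MonoidAlgebra.coeff_single, Finsupp.single_eq_of_ne h]
        exact ⟨rfl, fun x hx => by cases hx⟩
      · rw [if_neg hr] at hw
        exact absurd rfl hw
    · rw [pnorm_C]
      exact wnorm_ne_top _

theorem mem_convSeries_iff {s : Set (Fin m ⊕ Fin p)}
    {f : PowerSeries (MonoidAlgebra ℝ (Words m p))} : f ∈ convSeries s ↔
      (∀ r w, (coeff r f).coeff w ≠ 0 → pdeg w = r ∧ ∀ x ∈ w.toList, x ∈ s) ∧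
        ∃ ρ : ℝ≥0, 0 < ρ ∧ pnorm ρ f ≠ ∞ := Iff.rfl

/-- The formal power series represented by a letter. -/
def letter (x : Fin m ⊕ Fin p) : PowerSeries (MonoidAlgebra ℝ (Words m p)) :=
  PowerSeries.monomial (if x.isRight then 1 else 0) (MonoidAlgebra.single (FreeMonoid.of x) 1)

theorem letter_mem {s : Set (Fin m ⊕ Fin p)} {x : Fin m ⊕ Fin p} (hx : x ∈ s) :
    letter x ∈ convSeries s := by
  refine mem_convSeries_iff.2 ⟨fun r w hw => ?_, 1, one_pos, ?_⟩
  · rw [letter, coeff_monomial] at hw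
    by_cases h : r = if x.isRight then 1 else 0
    · rw [if_pos h] at hw
      obtain rfl : w = FreeMonoid.of x := by
        by_contra h'
        rw [MonoidAlgebra.coeff_single, Finsupp.single_eq_of_ne h'] at hw
        exact hw rfl
      refine ⟨?_, fun y hy => ?_⟩
      · rw [h, pdeg, FreeMonoid.toList_of]
        cases x <;> rfl
      · rw [FreeMonoid.toList_of, List.mem_singleton] at hy
        rwa [hy]
    · rw [if_neg h] at hw
      exact absurd rfl hw
  · rw [pnorm, tsum_eq_single (if x.isRight then 1 else 0)]
    · rw [letter, coeff_monomial_same, wnorm_single]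
      simp
    · intro r hr
      rw [letter, coeff_monomial, if_neg hr, wnorm_zero, mul_zero]

theorem convSeries_mono {s t : Set (Fin m ⊕ Fin p)} (h : s ⊆ t) : convSeries s ≤ convSeries t :=
  fun _ hf => mem_convSeries_iff.2
    ⟨fun r w hw => ⟨(hf.1 r w hw).1, fun x hx => h ((hf.1 r w hw).2 x hx)⟩, hf.2⟩

/-- A positive radius survives substitution: shrinking it brings the norm of E below 1/2, because E
has no constant term. -/
theorem substHom_mem {s : Set (Fin m ⊕ Fin p)} {E : PowerSeries (MonoidAlgebra ℝ (Words m p))}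
    (hE : constantCoeff E = 0) (h : E ∈ convSeries s) {c : PowerSeries ℝ}
    (hc : ∀ k, ‖coeff k c‖ ≤ 1) : substHom E hE c ∈ convSeries s := by
  refine mem_convSeries_iff.2 ⟨?_, ?_⟩
  · intro r w hw
    rw [coeff_substHom, MonoidAlgebra.coeff_sum, Finsupp.finsetSum_apply] at hw
    obtain ⟨k, _, hw⟩ := Finset.exists_ne_zero_of_sum_ne_zero hw
    refine (pow_mem h k).1 r w fun h0 => hw ?_
    rw [MonoidAlgebra.coeff_smul, Finsupp.smul_apply, h0, smul_zero]
  · obtain ⟨ρ, hρ, hfin⟩ := h.2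
    obtain ⟨σ, hσ, hle⟩ := exists_pnorm_le hE hρ hfin (ε := 2⁻¹) (by positivity)
    refine ⟨σ, hσ, ne_top_of_le_ne_top ENNReal.ofNat_ne_top (pnorm_substHom_le hE hc (hle.trans ?_))⟩
    rw [ENNReal.coe_inv two_ne_zero]
    rfl

end ConvergentSeries
end FQ
end

/-! ### The formal Gram-Schmidt procedure. -/

noncomputable section
namespace FQ

section FormalGramSchmidt

open PowerSeries

variable {S : Type*} [Ring S] [Algebra ℝ S]

/-- Antisymmetrization with respect to `x.2`, in terms of the deviation `y` from `q`, under the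
assumption that `x.1` and `q` are anticommuting with square `-1`. -/
def formalStep (q y : PowerSeries S) (x : PowerSeries S × PowerSeries S) : PowerSeries S :=
  (2⁻¹ : ℝ) • (y + x.2 * (q + y) * x.2 - x.1 * q * x.1)

/-- Iterated antisymmetrization in terms of the deviation from `q`. -/
def formalDev (q y : PowerSeries S) (l : List (PowerSeries S × PowerSeries S)) : PowerSeries S :=
  l.foldl (formalStep q) y

/-- The polarization of `q + y`, under the assumption that `q` has square `-1`. -/
def formalPol (q y : PowerSeries S) : PowerSeries S :=
  (q + y) * substFun (q * q - (q + y) * (q + y)) (PowerSeries.binomialSeries ℝ (-1 / 2 : ℝ))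

/-- The letters satisfy no Clifford relations, so the deviation from q is formed with x.1 q x.1,
which equals q only after evaluation. This makes the constant terms cancel already in the free
algebra. -/
theorem constantCoeff_formalDev {q y : PowerSeries S} {l : List (PowerSeries S × PowerSeries S)}
    (hl : ∀ x ∈ l, constantCoeff x.2 = constantCoeff x.1) (hy : constantCoeff y = 0) :
    constantCoeff (formalDev q y l) = 0 := by
  induction l generalizing y with
  | nil => exact hy
  | cons x l ih =>
    refine ih (fun z hz => hl z (List.mem_cons_of_mem _ hz)) ?_
    rw [formalStep, ← coeff_zero_eq_constantCoeff_apply, coeff_real_smul,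
      coeff_zero_eq_constantCoeff_apply]
    simp [hy, hl x List.mem_cons_self]

/-- After evaluation -(q + y)² is 1 plus this series. Writing q² for -1 lets the binomial series be
substituted before the relation q² = -1 is available. -/
theorem constantCoeff_sub_add_sq {S : Type*} [Ring S] {q y : PowerSeries S} (hy : constantCoeff y = 0) :
    constantCoeff (q * q - (q + y) * (q + y)) = 0 := by
  simp [hy]

theorem formalPol_eq {q y : PowerSeries S} (hy : constantCoeff y = 0) :
    formalPol q y = (q + y) * substHom _ (constantCoeff_sub_add_sq (q := q) hy)
      (PowerSeries.binomialSeries ℝ (-1 / 2 : ℝ)) := rfl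

theorem constantCoeff_formalPol {q y : PowerSeries S} (hy : constantCoeff y = 0) :
    constantCoeff (formalPol q y) = constantCoeff q := by
  rw [formalPol_eq hy, map_mul, constantCoeff_substHom, binomialSeries_constantCoeff, map_one, mul_one,
    map_add, hy, add_zero]

theorem formalDev_mem {U : Subalgebra ℝ (PowerSeries S)} {q y : PowerSeries S}
    {l : List (PowerSeries S × PowerSeries S)} (hq : q ∈ U) (hl : ∀ x ∈ l, x.1 ∈ U ∧ x.2 ∈ U)
    (hy : y ∈ U) : formalDev q y l ∈ U := by
  induction l generalizing y with
  | nil => exact hy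
  | cons x l ih =>
    obtain ⟨h1, h2⟩ := hl x List.mem_cons_self
    exact ih (fun z hz => hl z (List.mem_cons_of_mem _ hz)) (U.smul_mem
      (sub_mem (add_mem hy (mul_mem (mul_mem h2 (add_mem hq hy)) h2)) (mul_mem (mul_mem h1 hq) h1)) _)

variable {A : Type*} [Ring A] [Algebra ℝ A] (Φ : PowerSeries S →ₐ[ℝ] A)

theorem map_formalDev {q : PowerSeries S} {l : List (PowerSeries S × PowerSeries S)}
    (h1 : ∀ x ∈ l, Φ x.1 * Φ x.1 = -1 ∧ Φ q * Φ x.1 = -(Φ x.1 * Φ q))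
    (h2 : ∀ x ∈ l, Φ x.2 * Φ x.2 = -1) (y : PowerSeries S) :
    Φ q + Φ (formalDev q y l) = antisymmList (Φ q + Φ y) (l.map fun x => Φ x.2) := by
  induction l generalizing y with
  | nil => rfl
  | cons x l ih =>
    change Φ q + Φ (formalDev q (formalStep q y x) l) =
      antisymmList (antisymm (Φ q + Φ y) (Φ x.2)) (l.map fun x => Φ x.2)
    rw [ih (fun z hz => h1 z (List.mem_cons_of_mem _ hz))
      fun z hz => h2 z (List.mem_cons_of_mem _ hz)]
    congr 1
    obtain ⟨h3, h4⟩ := h1 x List.mem_cons_self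
    have h5 : Φ x.1 * Φ q * Φ x.1 = Φ q := by
      rw [mul_assoc, h4, mul_neg, ← mul_assoc, h3, neg_one_mul, neg_neg]
    rw [antisymm_eq (h2 x List.mem_cons_self), formalStep, map_smul, map_sub, map_add, map_mul, map_mul,
      map_mul, map_mul, map_add, h5]
    generalize Φ x.2 * (Φ q + Φ y) * Φ x.2 = z
    have h6 : Φ q = (2⁻¹ : ℝ) • (Φ q + Φ q) := by
      rw [← two_smul ℝ, smul_smul]
      norm_num
    nth_rw 1 [h6]
    rw [← smul_add]
    congr 1
    abel

variable (φ : S →ₐ[ℝ] A)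

theorem mapAlgHom_substHom {E : PowerSeries S} (hE : constantCoeff E = 0) (f : PowerSeries ℝ) :
    mapAlgHom φ (substHom E hE f) = substHom (mapAlgHom φ E) (by
      change constantCoeff (PowerSeries.map φ.toRingHom E) = 0
      rw [← coeff_zero_eq_constantCoeff_apply, coeff_map, coeff_zero_eq_constantCoeff_apply, hE,
        map_zero]) f := by
  ext N
  change φ (coeff N (substHom E hE f)) = _
  rw [coeff_substHom, coeff_substHom, map_sum]
  refine Finset.sum_congr rfl fun k _ => ?_
  rw [map_smul, ← map_pow]
  rfl

/-- The two equations in `IsPol` hold as identities of power series over the target algebra; they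
come from the binomial identity and need no convergence. -/
theorem map_formalPol {q y : PowerSeries S} (hy : constantCoeff y = 0)
    (hq : mapAlgHom φ q * mapAlgHom φ q = -1) :
    mapAlgHom φ (formalPol q y) * mapAlgHom φ (formalPol q y) = -1 ∧
      Commute (mapAlgHom φ (formalPol q y)) (mapAlgHom φ q + mapAlgHom φ y) := by
  rw [formalPol_eq hy, map_mul, mapAlgHom_substHom, map_add]
  have hE : mapAlgHom φ (q * q - (q + y) * (q + y)) = -1 -
      (mapAlgHom φ q + mapAlgHom φ y) * (mapAlgHom φ q + mapAlgHom φ y) := by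
    rw [map_sub, map_mul, map_mul, map_add, hq]
  generalize_proofs h
  have hc : Commute (mapAlgHom φ q + mapAlgHom φ y)
      (mapAlgHom φ (q * q - (q + y) * (q + y))) := by
    rw [hE]
    exact ((Commute.one_right _).neg_right).sub_right ((Commute.refl _).mul_right (Commute.refl _))
  have hF := congrArg (substHom _ h) binomialSeries_sq_mul
  rw [map_mul, map_pow, map_add, map_one, substHom_X] at hF
  have hF' := commute_substHom h hc (PowerSeries.binomialSeries ℝ (-1 / 2 : ℝ))
  generalize substHom _ h (PowerSeries.binomialSeries ℝ (-1 / 2 : ℝ)) = F at hF hF'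
  rw [hE] at hF
  generalize mapAlgHom φ q + mapAlgHom φ y = T at hF hF'
  refine ⟨?_, (Commute.refl T).mul_left hF'.symm⟩
  have h2 : T * T * F ^ 2 = F ^ 2 * (T * T) := ((hF'.mul_left hF').pow_right 2).eq
  have h3 : T * F * (T * F) = T * T * F ^ 2 := by
    rw [mul_assoc, ← mul_assoc F T F, ← hF'.eq, pow_two]
    simp only [mul_assoc]
  rw [h3, h2, ← neg_eq_iff_eq_neg, ← hF, add_sub_assoc', add_neg_cancel, zero_sub, mul_neg]

end FormalGramSchmidt

section FormalProcedure

open PowerSeries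

variable {m p : ℕ}

/-- Formal power series in words. -/
abbrev FSeries (m p : ℕ) : Type := PowerSeries (MonoidAlgebra ℝ (Words m p))

/-- The Gram-Schmidt orthogonalization of `Q + Y`, as formal power series, where the Clifford system
`Q` consists of the letters `inl i`. -/
def formalGS (Y : Fin m → FSeries m p) (k : Fin m) : FSeries m p :=
  formalPol (letter (.inl k)) (formalDev (letter (.inl k)) (Y k) (List.ofFn fun i : Fin k.val =>
    (letter (.inl ⟨i.val, i.isLt.trans k.isLt⟩), formalGS Y ⟨i.val, i.isLt.trans k.isLt⟩)))
termination_by k.val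

/-- The deviation from the `k`-th letter of the term to be polarized in the `k`-th step. -/
def formalTerm (Y : Fin m → FSeries m p) (k : Fin m) : FSeries m p :=
  formalDev (letter (.inl k)) (Y k)
    (prefixList (fun i => (letter (.inl i), formalGS Y i)) k k.isLt.le)

theorem formalGS_eq (Y : Fin m → FSeries m p) (k : Fin m) :
    formalGS Y k = formalPol (letter (.inl k)) (formalTerm Y k) := by
  rw [formalGS]
  rfl

variable {Y : Fin m → FSeries m p}

theorem constantCoeff_formalGS_aux (hY : ∀ i, constantCoeff (Y i) = 0) (k : Fin m) :
    constantCoeff (formalTerm Y k) = 0 ∧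
      constantCoeff (formalGS Y k) = constantCoeff (letter (p := p) (.inl k)) := by
  suffices H : ∀ (n : ℕ) (hn : n < m), constantCoeff (formalTerm Y ⟨n, hn⟩) = 0 ∧
      constantCoeff (formalGS Y ⟨n, hn⟩) = constantCoeff (letter (p := p) (.inl ⟨n, hn⟩)) from
    H k k.isLt
  intro n
  induction n using Nat.strong_induction_on with
  | _ n ih =>
    intro hn
    have h : constantCoeff (formalTerm Y ⟨n, hn⟩) = 0 := by
      refine constantCoeff_formalDev (fun x hx => ?_) (hY _)
      obtain ⟨i, hi, rfl⟩ := mem_prefixList.1 hx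
      exact (ih i hi i.isLt).2
    exact ⟨h, by rw [formalGS_eq, constantCoeff_formalPol h]⟩

theorem constantCoeff_formalTerm (hY : ∀ i, constantCoeff (Y i) = 0) (k : Fin m) :
    constantCoeff (formalTerm Y k) = 0 := (constantCoeff_formalGS_aux hY k).1

theorem constantCoeff_formalGS (hY : ∀ i, constantCoeff (Y i) = 0) (k : Fin m) :
    constantCoeff (formalGS Y k) = constantCoeff (letter (p := p) (.inl k)) :=
  (constantCoeff_formalGS_aux hY k).2

/-- The monotone family of letter sets records which Q_i and R_j can occur in the k-th component;
this yields the filtration property of the expansion. -/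
theorem formalTerm_mem_and_formalGS_mem (hY : ∀ i, constantCoeff (Y i) = 0)
    {s : Fin m → Set (Fin m ⊕ Fin p)}
    (hs : Monotone s) (hq : ∀ i, Sum.inl i ∈ s i) (hYs : ∀ i, Y i ∈ convSeries (s i)) (k : Fin m) :
    formalTerm Y k ∈ convSeries (s k) ∧ formalGS Y k ∈ convSeries (s k) := by
  suffices H : ∀ (n : ℕ) (hn : n < m), formalTerm Y ⟨n, hn⟩ ∈ convSeries (s ⟨n, hn⟩) ∧
      formalGS Y ⟨n, hn⟩ ∈ convSeries (s ⟨n, hn⟩) from H k k.isLt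
  intro n
  induction n using Nat.strong_induction_on with
  | _ n ih =>
    intro hn
    have h : formalTerm Y ⟨n, hn⟩ ∈ convSeries (s ⟨n, hn⟩) := by
      refine formalDev_mem (letter_mem (hq _)) (fun x hx => ?_) (hYs _)
      obtain ⟨i, hi, rfl⟩ := mem_prefixList.1 hx
      have hle : s i ⊆ s ⟨n, hn⟩ := hs hi.le
      exact ⟨letter_mem (hle (hq i)), convSeries_mono hle (ih i hi i.isLt).2⟩
    refine ⟨h, ?_⟩
    rw [formalGS_eq, formalPol_eq (constantCoeff_formalTerm hY _)]
    have hl := letter_mem (hq ⟨n, hn⟩)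
    exact mul_mem (add_mem hl h) (substHom_mem _ (sub_mem (mul_mem hl hl)
      (mul_mem (add_mem hl h) (add_mem hl h)))
      (norm_coeff_binomialSeries_le (by norm_num) (by norm_num)))

variable {A : Type*} [Ring A] [Algebra ℝ A] (φ : MonoidAlgebra ℝ (Words m p) →ₐ[ℝ] A)

theorem map_formalGS (hY : ∀ i, constantCoeff (Y i) = 0)
    (hQ : IsClifford fun i => mapAlgHom φ (letter (.inl i))) (k : Fin m) :
    mapAlgHom φ (formalGS Y k) * mapAlgHom φ (formalGS Y k) = -1 ∧
      Commute (mapAlgHom φ (formalGS Y k))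
        (mapAlgHom φ (letter (.inl k)) + mapAlgHom φ (formalTerm Y k)) := by
  rw [formalGS_eq]
  exact map_formalPol φ (constantCoeff_formalTerm hY k) ((isClifford_iff.1 hQ).1 k)

theorem map_formalTerm (hY : ∀ i, constantCoeff (Y i) = 0)
    (hQ : IsClifford fun i => mapAlgHom φ (letter (.inl i))) (k : Fin m) :
    mapAlgHom φ (letter (.inl k)) + mapAlgHom φ (formalTerm Y k) =
      antisymmList (mapAlgHom φ (letter (.inl k)) + mapAlgHom φ (Y k))
        (prefixList (fun i => mapAlgHom φ (formalGS Y i)) k k.isLt.le) := by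
  rw [formalTerm, map_formalDev, map_prefixList]
  · intro x hx
    obtain ⟨i, hi, rfl⟩ := mem_prefixList.1 hx
    exact ⟨(isClifford_iff.1 hQ).1 i, (isClifford_iff.1 hQ).2 i k hi⟩
  · intro x hx
    obtain ⟨i, hi, rfl⟩ := mem_prefixList.1 hx
    exact (map_formalGS φ hY hQ i).1

end FormalProcedure
end FQ
end

/-! ### Reduction of words by the Clifford relations. -/

noncomputable section
namespace FQ

section Reduction

variable {m p : ℕ}

theorem mpow_succ {A : Type*} [Ring A] (Q : Fin (m + 1) → A) (e : Fin (m + 1) → Fin 2) :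
    mpow Q e = Q 0 ^ (e 0).val * mpow (fun i => Q i.succ) (fun i => e i.succ) := by
  rw [mpow, List.ofFn_succ, List.prod_cons]
  rfl

theorem mpow_zero {A : Type*} [Ring A] (Q : Fin m → A) : mpow Q 0 = 1 := by
  rw [mpow]
  refine List.prod_eq_one fun x hx => ?_
  obtain ⟨i, rfl⟩ := List.mem_ofFn.1 hx
  exact pow_zero _

theorem IsClifford.tail {A : Type*} [Ring A] {Q : Fin (m + 1) → A} (hQ : IsClifford Q) :
    IsClifford fun i => Q i.succ := fun i j => by
  rw [hQ]
  simp only [Fin.succ_inj]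

/-- The product of an element of a Clifford system and a multipower is a multipower up to sign. -/
theorem exists_mul_mpow (e : Fin m → Fin 2) (i : Fin m) :
    ∃ σ : ℝ, ‖σ‖ ≤ 1 ∧ ∃ e' : Fin m → Fin 2, (∀ k, e' k ≠ 0 → k = i ∨ e k ≠ 0) ∧
      ∀ (A : Type u) [Ring A] [Algebra ℝ A] (Q : Fin m → A), IsClifford Q →
        Q i * mpow Q e = σ • mpow Q e' := by
  induction m with
  | zero => exact i.elim0
  | succ m ih =>
    refine Fin.cases ?_ (fun i => ?_) i
    · rcases Fin.exists_fin_two.1 ⟨e 0, rfl⟩ with h | h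
      · refine ⟨1, norm_one.le, Fin.cons 1 fun k => e k.succ, fun k => Fin.cases (fun _ => Or.inl rfl)
          (fun k hk => Or.inr hk) k, fun A _ _ Q hQ => ?_⟩
        rw [mpow_succ, mpow_succ, ← mul_assoc, h]
        simp
      · refine ⟨-1, by simp, Fin.cons 0 fun k => e k.succ, fun k => Fin.cases (fun _ => Or.inl rfl)
          (fun k hk => Or.inr hk) k, fun A _ _ Q hQ => ?_⟩
        rw [mpow_succ, mpow_succ, ← mul_assoc, h]
        simp [(isClifford_iff.1 hQ).1 0]
    · obtain ⟨σ, hσ, e', he', h⟩ := ih (fun k => e k.succ) i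
      refine ⟨(-1) ^ (e 0).val * σ, by simpa using hσ, Fin.cons (e 0) e', fun k => ?_, fun A _ _ Q hQ => ?_⟩
      · refine Fin.cases (fun h0 => Or.inr h0) (fun k hk => ?_) k
        rcases he' k hk with rfl | hk
        · exact Or.inl rfl
        · exact Or.inr hk
      · have hc : Q i.succ * Q 0 ^ (e 0).val =
            (-1 : ℝ) ^ (e 0).val • (Q 0 ^ (e 0).val * Q i.succ) := by
          rcases Fin.exists_fin_two.1 ⟨e 0, rfl⟩ with h | h <;> rw [h]
          · simp
          · simp [hQ.anticommute (Fin.succ_ne_zero i)]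
        rw [mpow_succ, mpow_succ, ← mul_assoc, hc, smul_mul_assoc, mul_assoc, h A _ hQ.tail, mul_smul_comm,
          smul_smul]
        rfl

theorem word_cons {A : Type*} [Ring A] {r : ℕ} (Q : Fin m → A) (R : Fin p → A)
    (e : Fin (r + 1) → Fin m → Fin 2) (j : Fin r → Fin p) (j₀ : Fin p) :
    word Q R (Fin.cons 0 e : Fin (r + 2) → Fin m → Fin 2) (Fin.cons j₀ j : Fin (r + 1) → Fin p) =
      R j₀ * word Q R e j := by
  rw [word, word, List.ofFn_succ, List.prod_cons]
  simp only [Fin.cons_zero, Fin.cons_succ]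
  rw [mpow_zero, one_mul, mul_assoc]

/-- The evaluation of letters. -/
def evalWord {A : Type*} [Ring A] (Q : Fin m → A) (R : Fin p → A) : Words m p →* A :=
  FreeMonoid.lift (Sum.elim Q R)

/-- Words are, up to sign, of the form `Q ^ ι_0 R_{j_1} Q ^ ι_1 ... R_{j_r} Q ^ ι_r`. -/
theorem exists_evalWord_eq (w : Words m p) (r : ℕ) (hr : pdeg w = r) :
    ∃ σ : ℝ, ‖σ‖ ≤ 1 ∧ ∃ (e : Fin (r + 1) → Fin m → Fin 2) (j : Fin r → Fin p),
      (∀ t, Sum.inr (j t) ∈ w.toList) ∧ (∀ t i, e t i ≠ 0 → Sum.inl i ∈ w.toList) ∧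
      ∀ (A : Type u) [Ring A] [Algebra ℝ A] (Q : Fin m → A) (R : Fin p → A), IsClifford Q →
        evalWord Q R w = σ • word Q R e j := by
  induction w using FreeMonoid.inductionOn' generalizing r with
  | one =>
    obtain rfl : 0 = r := hr
    refine ⟨1, norm_one.le, 0, Fin.elim0, fun t => t.elim0, fun t i h => absurd rfl h,
      fun A _ _ Q R _ => ?_⟩
    rw [map_one, word, List.ofFn_zero, List.prod_nil, mul_one, one_smul]
    exact (mpow_zero Q).symm
  | of_mul x w ih =>
    rw [pdeg_mul] at hr
    rcases x with i | j₀
    · obtain ⟨σ, hσ, e, j, h1, h2, h3⟩ := ih r (by rw [← hr]; exact (zero_add _).symm)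
      obtain ⟨τ, hτ, e', he', h4⟩ := exists_mul_mpow.{u} (e 0) i
      refine ⟨σ * τ, by rw [norm_mul]; exact mul_le_one₀ hσ (norm_nonneg _) hτ,
        Fin.cons e' fun t => e t.succ, j, fun t => List.mem_cons_of_mem _ (h1 t),
        fun t k => ?_, fun A _ _ Q R hQ => ?_⟩
      · refine Fin.cases (fun hk => ?_) (fun t hk => List.mem_cons_of_mem _ (h2 t.succ k hk)) t
        rcases he' k hk with rfl | hk
        · exact List.mem_cons_self
        · exact List.mem_cons_of_mem _ (h2 0 k hk)
      · rw [map_mul, h3 A Q R hQ]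
        change Q i * _ = _
        rw [word, word, Fin.cons_zero, mul_smul_comm, ← mul_assoc, h4 A Q hQ, smul_mul_assoc, smul_smul]
        rfl
    · obtain ⟨r, rfl⟩ : ∃ r', r = r' + 1 := ⟨pdeg w, by rw [← hr, add_comm]; rfl⟩
      obtain ⟨σ, hσ, e, j, h1, h2, h3⟩ := ih r (by rw [add_comm] at hr; exact Nat.succ_injective hr)
      refine ⟨σ, hσ, Fin.cons 0 e, Fin.cons j₀ j, fun t => Fin.cases List.mem_cons_self
        (fun t => List.mem_cons_of_mem _ (h1 t)) t, fun t k => Fin.cases (fun hk => absurd rfl hk)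
        (fun t hk => List.mem_cons_of_mem _ (h2 t k hk)) t, fun A _ _ Q R hQ => ?_⟩
      rw [map_mul, h3 A Q R hQ, word_cons, mul_smul_comm]
      rfl

/-- The evaluation of combinations of words. -/
def evalHom {A : Type*} [Ring A] [Algebra ℝ A] (Q : Fin m → A) (R : Fin p → A) :
    MonoidAlgebra ℝ (Words m p) →ₐ[ℝ] A :=
  MonoidAlgebra.lift ℝ A (Words m p) (evalWord Q R)

theorem evalHom_eq_sum {A : Type*} [Ring A] [Algebra ℝ A] (Q : Fin m → A) (R : Fin p → A)
    (g : MonoidAlgebra ℝ (Words m p)) :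
    evalHom Q R g = ∑ w ∈ g.coeff.support, g.coeff w • evalWord Q R w :=
  MonoidAlgebra.lift_apply _ _

/-- Each word adds its coefficient, up to sign, at its normal form. Normal forms depend only on the
word, so the data serve all algebras and all Clifford systems at once. -/
theorem exists_coeff_of_words (r : ℕ) (T : Finset (Words m p)) (g : Words m p → ℝ)
    (s : Set (Fin m ⊕ Fin p)) (hT : ∀ w ∈ T, pdeg w = r ∧ ∀ x ∈ w.toList, x ∈ s) :
    ∃ c : (Fin (r + 1) → Fin m → Fin 2) → (Fin r → Fin p) → ℝ,
      (∀ e j, c e j ≠ 0 → (∀ t, Sum.inr (j t) ∈ s) ∧ ∀ t i, e t i ≠ 0 → Sum.inl i ∈ s) ∧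
      ∀ (A : Type u) [Ring A] [Algebra ℝ A] (Q : Fin m → A) (R : Fin p → A), IsClifford Q →
        ∑ w ∈ T, g w • evalWord Q R w = ∑ e, ∑ j, c e j • word Q R e j := by
  classical
  induction T using Finset.induction_on with
  | empty => exact ⟨0, fun e j h => absurd rfl h, fun A _ _ Q R _ => by simp⟩
  | insert w T hw ih =>
    obtain ⟨c, hc1, hc2⟩ := ih fun v hv => hT v (Finset.mem_insert_of_mem hv)
    obtain ⟨hr, hs⟩ := hT w (Finset.mem_insert_self _ _)
    obtain ⟨σ, _, e₀, j₀, h1, h2, h3⟩ := exists_evalWord_eq.{u} w r hr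
    refine ⟨fun e j => (if e = e₀ then if j = j₀ then g w * σ else 0 else 0) + c e j,
      fun e j h => ?_, fun A _ _ Q R hQ => ?_⟩
    · by_cases h0 : c e j = 0
      · by_cases he : e = e₀
        · by_cases hj : j = j₀
          · subst he hj
            exact ⟨fun t => hs _ (h1 t), fun t i hi => hs _ (h2 t i hi)⟩
          · simp [h0, hj] at h
        · simp [h0, he] at h
      · exact hc1 e j h0
    · rw [Finset.sum_insert hw, hc2 A Q R hQ, h3 A Q R hQ]
      simp only [add_smul, Finset.sum_add_distrib, ite_smul, zero_smul]
      congr 1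
      rw [Finset.sum_eq_single e₀ (fun e _ he => by simp [he]) (by simp)]
      simp [smul_smul]

/-- Convergent series in words are expansions in the sense of the analyticity conditions. -/
theorem exists_coeff_of_mem_convSeries (g : Fin p → FSeries m p) (s : Fin p → Set (Fin m ⊕ Fin p))
    (hg : ∀ k, g k ∈ convSeries (s k)) :
    ∃ c : Coeff m p,
      (∀ k r e j, c k r e j ≠ 0 → (∀ t, Sum.inr (j t) ∈ s k) ∧
        ∀ t i, e t i ≠ 0 → Sum.inl i ∈ s k) ∧
      ∀ (A : Type u) [Ring A] [Algebra ℝ A] (Q : Fin m → A) (R : Fin p → A), IsClifford Q →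
        ∀ k r, expTerm c Q R k r = evalHom Q R (PowerSeries.coeff r (g k)) := by
  have h : ∀ k r, _ := fun k r => exists_coeff_of_words.{u} r
    (PowerSeries.coeff r (g k)).coeff.support (PowerSeries.coeff r (g k)).coeff (s k)
    fun w hw => (mem_convSeries_iff.1 (hg k)).1 r w (Finsupp.mem_support_iff.1 hw)
  choose c hc1 hc2 using h
  refine ⟨c, hc1, fun A _ _ Q R hQ k r => ?_⟩
  rw [evalHom_eq_sum, hc2 k r A Q R hQ]
  rfl

end Reduction
end FQ
end

/-! ### Growth of long products on all levels. -/

noncomputable section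
namespace FQ

section JointBound

variable {A : Type u} [Ring A] [Algebra ℝ A] [ConvenientAlgebra A]

theorem norm_rep_one_list_prod_le {X : Finset A} {δ : ℝ} (hX : ∀ x ∈ X, ‖rep A 1 x‖ ≤ δ)
    (l : List A) (hl : ∀ x ∈ l, x ∈ X) : ‖rep A 1 l.prod‖ ≤ δ ^ l.length := by
  induction l with
  | nil =>
    rw [List.prod_nil, map_one, List.length_nil, pow_zero]
    exact ContinuousLinearMap.norm_id_le
  | cons x l ih =>
    rw [List.prod_cons, map_mul, List.length_cons, pow_succ']
    have h1 := hX x (hl x List.mem_cons_self)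
    exact (norm_mul_le _ _).trans (mul_le_mul h1 (ih fun z hz => hl z (List.mem_cons_of_mem _ hz))
      (norm_nonneg _) ((norm_nonneg _).trans h1))

set_option maxHeartbeats 1000000 in
/-- Products of elements that are small on the first level are, up to polynomial factors, small
on all levels. -/
theorem exists_norm_rep_list_prod_le {X : Finset A} {δ : ℝ} (hδ : 0 < δ)
    (hX : ∀ x ∈ X, ‖rep A 1 x‖ ≤ δ) (i : ℕ) :
    ∃ C, 0 ≤ C ∧ ∀ l : List A, (∀ x ∈ l, x ∈ X) →
      ‖rep A i l.prod‖ ≤ C * (l.length + 1 : ℝ) ^ i * δ ^ l.length := by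
  induction i with
  | zero =>
    refine ⟨0, le_rfl, fun l _ => ?_⟩
    have : rep A 0 l.prod = 0 := rep_eq_zero_iff.2 (by rw [filt, ConvenientAlgebra.filt_zero]; trivial)
    rw [this, norm_zero, zero_mul, zero_mul]
  | succ i ih =>
    rcases Nat.eq_zero_or_pos i with rfl | hi
    · refine ⟨1, zero_le_one, fun l hl => (norm_rep_one_list_prod_le hX l hl).trans ?_⟩
      rw [one_mul]
      refine le_mul_of_one_le_left (by positivity) (one_le_pow₀ ?_)
      linarith [(Nat.cast_nonneg l.length : (0 : ℝ) ≤ l.length)]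
    obtain ⟨C, hC, hCl⟩ := ih
    obtain ⟨s, hs⟩ := exists_section (A := A) i
    -- A product splits into σ, a linear lift of its class on level i and bounded by induction, and
    -- the rest d in `filt A i`.
    let σ : A →ₗ[ℝ] A := s ∘ₗ (rep A i).toLinearMap
    have hσ : ∀ a, σ a = s (rep A i a) := fun _ => rfl
    let d : A →ₗ[ℝ] A := LinearMap.id - σ
    have hd : ∀ a, d a = a - σ a := fun _ => rfl
    have hd_mem : ∀ a, d a ∈ filt A i := fun a => rep_eq_iff.1 (hs a).symm
    have hσ_zero : ∀ a ∈ filt A i, σ a = 0 := fun a ha => by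
      rw [hσ, rep_eq_zero_iff.2 ha, map_zero]
    -- On level i + 1 the product y · d a depends on y only modulo `filt A 1`, since filt 1 · filt i
    -- lies in filt (i + 1). Hence left factors are measured by their level-1 norm.
    obtain ⟨K, hK, hKb⟩ := exists_bound_of_filt_le_ker₂ (A := A) 1 (i + 1)
      (((LinearMap.mul ℝ A).compr₂ (rep A (i + 1)).toLinearMap).compl₂ d)
      (fun y hy => by
        ext1 a
        change rep A (i + 1) (y * d a) = 0
        rw [rep_eq_zero_iff, add_comm]
        exact ConvenientAlgebra.mul_mem_filt hy (hd_mem a))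
      (fun y a ha => by
        change rep A (i + 1) (y * d a) = 0
        rw [rep_eq_zero_iff, hd, hσ_zero a (ConvenientAlgebra.filt_antitone (Nat.le_succ i) ha),
          sub_zero]
        exact mul_mem_filt_left y ha)
    replace hKb : ∀ y a, ‖rep A (i + 1) (y * d a)‖ ≤ K * ‖rep A 1 y‖ * ‖rep A (i + 1) a‖ := hKb
    obtain ⟨K', hK', hKb'⟩ := exists_bound_of_filt_le_ker i
      ((rep A (i + 1)).toLinearMap ∘ₗ σ) (fun a ha => by
        change rep A (i + 1) (σ a) = 0
        rw [hσ_zero a ha, map_zero])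
    replace hKb' : ∀ a, ‖rep A (i + 1) (σ a)‖ ≤ K' * ‖rep A i a‖ := hKb'
    set L : ℝ := ∑ x ∈ X, ‖rep A (i + 1) x‖ with hL
    have hL0 : 0 ≤ L := Finset.sum_nonneg fun x _ => norm_nonneg _
    have hLx : ∀ x ∈ X, ‖rep A (i + 1) x‖ ≤ L := fun x hx =>
      Finset.single_le_sum (f := fun x => ‖rep A (i + 1) x‖) (fun x _ => norm_nonneg _) hx
    -- The first summand covers the empty product, the second the increment when one factor is
    -- added.
    set N : ℝ := K * ‖rep A (i + 1) 1‖ + K * (L * (K' * C)) / δ with hN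
    have hN0 : 0 ≤ N := by positivity
    have key : ∀ l : List A, (∀ x ∈ l, x ∈ X) → ∀ y,
        ‖rep A (i + 1) (y * d l.prod)‖ ≤
          ‖rep A 1 y‖ * (N * (l.length + 1 : ℝ) ^ (i + 1) * δ ^ l.length) := by
      intro l
      induction l with
      | nil =>
        intro _ y
        refine (hKb y _).trans ?_
        rw [List.prod_nil, List.length_nil, Nat.cast_zero, zero_add, one_pow, pow_zero, mul_one,
          mul_one, mul_comm K, mul_assoc]
        gcongr
        rw [hN]
        exact le_add_of_nonneg_right (by positivity)
      | cons x l ihl =>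
        intro hl y
        have hx := hl x List.mem_cons_self
        have hl' : ∀ z ∈ l, z ∈ X := fun z hz => hl z (List.mem_cons_of_mem _ hz)
        -- The first factor is shifted into the left multiplier, where it costs only δ; the
        -- remaining term is controlled by the previous level.
        have e : y * d (x * l.prod) = y * x * d l.prod + y * d (x * σ l.prod) := by
          have h1 : d (x * d l.prod) = x * d l.prod := by
            rw [hd (x * d l.prod), hσ_zero _ (mul_mem_filt_left x (hd_mem _)), sub_zero]
          rw [mul_assoc, ← mul_add, ← h1, ← map_add, ← mul_add, hd l.prod, sub_add_cancel]
        have h2 : ‖rep A (i + 1) (x * σ l.prod)‖ ≤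
            L * (K' * (C * (l.length + 1 : ℝ) ^ i * δ ^ l.length)) := by
          rw [map_mul]
          refine (norm_mul_le _ _).trans ?_
          gcongr
          · exact hLx x hx
          · exact (hKb' _).trans (by gcongr; exact hCl l hl')
        have h3 : ‖rep A 1 (y * x)‖ ≤ ‖rep A 1 y‖ * δ := by
          rw [map_mul]
          exact (norm_mul_le _ _).trans (by gcongr; exact hX x hx)
        rw [List.prod_cons, e, map_add]
        set n : ℝ := (l.length : ℝ) + 1 with hn
        have hn0 : 0 ≤ n := by positivity
        calc _ ≤ ‖rep A 1 y‖ * δ * (N * n ^ (i + 1) * δ ^ l.length) +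
              K * ‖rep A 1 y‖ * (L * (K' * (C * n ^ i * δ ^ l.length))) := by
              refine (norm_add_le _ _).trans (add_le_add ?_ ?_)
              · exact (ihl hl' (y * x)).trans (by gcongr)
              · exact (hKb y _).trans (by gcongr)
          _ = ‖rep A 1 y‖ * ((N * n + K * (L * (K' * C)) / δ) * n ^ i * δ ^ (l.length + 1)) := by
              field_simp
              ring
          -- The recursion closes because n · n^i + n^i ≤ (n + 1)^(i + 1), which raises the
          -- polynomial degree by one per level.
          _ ≤ ‖rep A 1 y‖ * ((N * n + N) * (n + 1) ^ i * δ ^ (l.length + 1)) := by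
              gcongr
              · rw [hN]
                exact le_add_of_nonneg_left (by positivity)
              · linarith
          _ = _ := by
              rw [List.length_cons, hn]
              push_cast
              ring
    refine ⟨‖rep A 1 1‖ * N + K' * C, by positivity, fun l hl => ?_⟩
    have h1 := key l hl 1
    have h2 : ‖rep A (i + 1) (σ l.prod)‖ ≤ K' * (C * (l.length + 1 : ℝ) ^ i * δ ^ l.length) :=
      (hKb' _).trans (mul_le_mul_of_nonneg_left (hCl l hl) hK')
    have h3 : rep A (i + 1) l.prod = rep A (i + 1) (d l.prod) + rep A (i + 1) (σ l.prod) := by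
      rw [← map_add, hd, sub_add_cancel]
    rw [one_mul] at h1
    rw [h3]
    generalize rep A (i + 1) (d l.prod) = u at h1
    generalize rep A (i + 1) (σ l.prod) = v at h2
    have hn1 : (1 : ℝ) ≤ l.length + 1 := by
      linarith [(Nat.cast_nonneg l.length : (0 : ℝ) ≤ l.length)]
    generalize (l.length + 1 : ℝ) = n at h1 h2 hn1
    have h4 : K' * (C * n ^ i * δ ^ l.length) ≤ K' * (C * n ^ (i + 1) * δ ^ l.length) := by
      gcongr
      exact Nat.le_succ i
    refine (norm_add_le _ _).trans ((add_le_add h1 (h2.trans h4)).trans_eq ?_)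
    ring

end JointBound
end FQ
end

/-! ### Summation of power series in a convenient algebra. -/

noncomputable section
namespace FQ

section SummableSeries

open PowerSeries

section Normed

variable {A : Type*} [Ring A] [Algebra ℝ A] {B : Type*} [NormedRing B] [NormedAlgebra ℝ B]

theorem summable_norm_coeff_mul (φ : A →ₐ[ℝ] B) {f g : PowerSeries A}
    (hf : Summable fun r => ‖φ (coeff r f)‖) (hg : Summable fun r => ‖φ (coeff r g)‖) :
    Summable fun r => ‖φ (coeff r (f * g))‖ := by
  refine (summable_norm_sum_mul_antidiagonal_of_summable_norm hf hg).congr fun r => ?_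
  rw [coeff_mul, map_sum]
  simp only [map_mul]

/-- Power series whose coefficients have absolutely summable images. -/
def absSummable (φ : A →ₐ[ℝ] B) : Subalgebra ℝ (PowerSeries A) where
  carrier := {g | Summable fun r => ‖φ (coeff r g)‖}
  mul_mem' hf hg := summable_norm_coeff_mul φ hf hg
  add_mem' := by
    intro f g hf hg
    refine Summable.of_nonneg_of_le (fun r => norm_nonneg _) (fun r => ?_) (hf.add hg)
    rw [map_add, map_add]
    exact norm_add_le _ _
  algebraMap_mem' c := by
    refine summable_of_ne_finset_zero (s := {0}) fun r hr => ?_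
    rw [PowerSeries.algebraMap_apply, coeff_C, if_neg (by simpa using hr), map_zero, norm_zero]

theorem mem_absSummable_iff {φ : A →ₐ[ℝ] B} {g : PowerSeries A} :
    g ∈ absSummable φ ↔ Summable fun r => ‖φ (coeff r g)‖ := Iff.rfl

theorem monomial_mem_absSummable (φ : A →ₐ[ℝ] B) (k : ℕ) (a : A) :
    monomial k a ∈ absSummable φ :=
  summable_of_ne_finset_zero (s := {k}) fun r hr => by
    rw [coeff_monomial, if_neg (by simpa using hr), map_zero, norm_zero]

variable [CompleteSpace B]

theorem summable_of_mem_absSummable {φ : A →ₐ[ℝ] B} {g : PowerSeries A} (hg : g ∈ absSummable φ) :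
    Summable fun r => φ (coeff r g) := (mem_absSummable_iff.1 hg).of_norm

/-- Summation of absolutely summable power series at the value `1` of the variable. -/
def tsumHom (φ : A →ₐ[ℝ] B) : absSummable φ →ₐ[ℝ] B :=
  AlgHom.ofLinearMap
    { toFun := fun g => ∑' r, φ (coeff r (g : PowerSeries A))
      map_add' := fun f g => by
        rw [← (summable_of_mem_absSummable f.2).tsum_add (summable_of_mem_absSummable g.2)]
        simp
      map_smul' := fun c f => by
        rw [RingHom.id_apply, ← (summable_of_mem_absSummable f.2).tsum_const_smul]
        refine tsum_congr fun r => ?_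
        rw [← map_smul]
        rfl }
    (by
      change ∑' r, φ (coeff r (1 : PowerSeries A)) = 1
      rw [tsum_eq_single 0 fun r hr => by simp [coeff_one, hr]]
      simp)
    (fun f g => by
      change ∑' r, φ (coeff r (f * g : PowerSeries A)) =
        (∑' r, φ (coeff r (f : PowerSeries A))) * ∑' r, φ (coeff r (g : PowerSeries A))
      rw [tsum_mul_tsum_eq_tsum_sum_antidiagonal_of_summable_norm f.2 g.2]
      refine tsum_congr fun r => ?_
      rw [coeff_mul, map_sum]
      simp only [map_mul])

theorem hasSum_tsumHom {φ : A →ₐ[ℝ] B} (g : absSummable φ) :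
    HasSum (fun r => φ (coeff r (g : PowerSeries A))) (tsumHom φ g) :=
  (summable_of_mem_absSummable g.2).hasSum

theorem tsumHom_monomial (φ : A →ₐ[ℝ] B) (k : ℕ) (a : A) :
    tsumHom φ ⟨monomial k a, monomial_mem_absSummable φ k a⟩ = φ a := by
  refine (hasSum_tsumHom _).unique ?_
  have : ∀ r, φ (coeff r (monomial k a)) = if r = k then φ a else 0 := fun r => by
    rw [coeff_monomial]
    split_ifs <;> simp
  simp only [this]
  exact hasSum_ite_eq k _

theorem map_tsumHom {B' : Type*} [NormedRing B'] [NormedAlgebra ℝ B'] [CompleteSpace B']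
    {φ : A →ₐ[ℝ] B} {ψ : A →ₐ[ℝ] B'} (T : B →L[ℝ] B') (hT : ∀ a, T (φ a) = ψ a) {g : PowerSeries A}
    (hφ : g ∈ absSummable φ) (hψ : g ∈ absSummable ψ) :
    T (tsumHom φ ⟨g, hφ⟩) = tsumHom ψ ⟨g, hψ⟩ := by
  refine (HasSum.unique ?_ (hasSum_tsumHom ⟨g, hψ⟩) :)
  simpa only [hT] using T.hasSum (hasSum_tsumHom ⟨g, hφ⟩)

end Normed

variable (A : Type u) [Ring A] [Algebra ℝ A] [ConvenientAlgebra A]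

/-- Power series whose coefficients are absolutely summable on all levels. -/
def summableSeries : Subalgebra ℝ (PowerSeries A) := ⨅ i, absSummable (rep A i)

variable {A}

theorem mem_summableSeries_iff {g : PowerSeries A} :
    g ∈ summableSeries A ↔ ∀ i, g ∈ absSummable (rep A i) := Algebra.mem_iInf

theorem mem_absSummable_of_mem {g : PowerSeries A} (hg : g ∈ summableSeries A) (i : ℕ) :
    g ∈ absSummable (rep A i) := mem_summableSeries_iff.1 hg i

variable (A) in
/-- Summation of power series on a level. -/
def levelSumHom (i : ℕ) : summableSeries A →ₐ[ℝ] Level A i :=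
  (tsumHom (rep A i)).comp (Subalgebra.inclusion (iInf_le _ i))

/-- Lifting to the algebra and projecting to a lower level is a continuous linear map, so it
commutes with the sum; the level sums are coherent. -/
theorem exists_rep_eq_levelSumHom (g : summableSeries A) :
    ∃ a, ∀ i, rep A i a = levelSumHom A i g := by
  choose s hs using exists_section (A := A)
  have key : ∀ i j, i ≤ j → rep A i (s j (levelSumHom A j g)) = levelSumHom A i g := by
    intro i j hij
    exact map_tsumHom (LinearMap.toContinuousLinearMap ((rep A i).toLinearMap ∘ₗ s j))
      (fun a => rep_eq_of_le hij (hs j a)) _ _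
  obtain ⟨a, ha⟩ := exists_rep_eq (fun i => s i (levelSumHom A i g)) fun i => by
    rw [key i (i + 1) (Nat.le_succ i), key i i le_rfl]
  exact ⟨a, fun i => by rw [ha, key i i le_rfl]⟩

variable (A) in
/-- Summation of power series at the value `1` of the variable. -/
def sumHom : summableSeries A →ₐ[ℝ] A :=
  have h : ∀ (g : summableSeries A) (i : ℕ),
      rep A i (exists_rep_eq_levelSumHom g).choose = levelSumHom A i g :=
    fun g => (exists_rep_eq_levelSumHom g).choose_spec
  AlgHom.ofLinearMap
    { toFun := fun g => (exists_rep_eq_levelSumHom g).choose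
      map_add' := fun f g => eq_of_forall_rep fun i => by
        rw [map_add]
        exact ((h (f + g) i).trans (map_add _ _ _)).trans (congrArg₂ _ (h f i).symm (h g i).symm)
      map_smul' := fun c f => eq_of_forall_rep fun i => by
        rw [RingHom.id_apply, map_smul]
        exact ((h (c • f) i).trans (map_smul _ _ _)).trans (congrArg _ (h f i).symm) }
    (eq_of_forall_rep fun i => (h 1 i).trans (by rw [map_one, map_one]))
    (fun f g => eq_of_forall_rep fun i => (h (f * g) i).trans (by
      rw [map_mul, map_mul]
      exact congrArg₂ _ (h f i).symm (h g i).symm))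

theorem rep_sumHom (g : summableSeries A) (i : ℕ) : rep A i (sumHom A g) = levelSumHom A i g :=
  (exists_rep_eq_levelSumHom g).choose_spec i

theorem hasSum_sumHom (g : summableSeries A) (i : ℕ) :
    HasSum (fun r => rep A i (coeff r (g : PowerSeries A))) (rep A i (sumHom A g)) := by
  rw [rep_sumHom]
  exact hasSum_tsumHom (φ := rep A i) ⟨g, mem_absSummable_of_mem g.2 i⟩

theorem monomial_mem_summableSeries (k : ℕ) (a : A) : monomial k a ∈ summableSeries A :=
  mem_summableSeries_iff.2 fun _ => monomial_mem_absSummable _ k a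

theorem sumHom_monomial (k : ℕ) (a : A) :
    sumHom A ⟨monomial k a, monomial_mem_summableSeries k a⟩ = a :=
  eq_of_forall_rep fun i => by
    rw [rep_sumHom]
    exact tsumHom_monomial (rep A i) k a

end SummableSeries
end FQ
end

/-! ### Evaluation of formal series at small perturbations. -/

noncomputable section
namespace FQ

section Evaluation

open PowerSeries Filter Topology
open scoped ENNReal NNReal

variable {m p : ℕ}

theorem evalHom_single_of {A : Type*} [Ring A] [Algebra ℝ A] (Q : Fin m → A) (R : Fin p → A)
    (x : Fin m ⊕ Fin p) :
    evalHom Q R (MonoidAlgebra.single (FreeMonoid.of x) 1) = Sum.elim Q R x := by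
  rw [evalHom, MonoidAlgebra.lift_single, one_smul]
  exact FreeMonoid.lift_eval_of _ _

theorem mapAlgHom_letter {A : Type*} [Ring A] [Algebra ℝ A] (Q : Fin m → A) (R : Fin p → A)
    (x : Fin m ⊕ Fin p) : mapAlgHom (evalHom Q R) (letter x) =
      monomial (if x.isRight then 1 else 0) (Sum.elim Q R x) := by
  ext r
  change evalHom Q R (coeff r (letter x)) = _
  rw [letter, coeff_monomial, coeff_monomial]
  split_ifs <;> first | exact evalHom_single_of Q R x | exact map_zero _

theorem norm_evalHom_le {A : Type*} [Ring A] [Algebra ℝ A] {B : Type*} [NormedRing B] [NormedAlgebra ℝ B]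
    (φ : A →ₐ[ℝ] B) {Q : Fin m → A} {R : Fin p → A} {g : MonoidAlgebra ℝ (Words m p)} {b : ℝ}
    (h : ∀ w, g.coeff w ≠ 0 → ‖φ (evalWord Q R w)‖ ≤ b) :
    ‖φ (evalHom Q R g)‖ ≤ (wnorm g).toReal * b := by
  rw [evalHom_eq_sum, map_sum, wnorm_eq_sum, ENNReal.toReal_sum fun w _ => enorm_ne_top,
    Finset.sum_mul]
  refine norm_sum_le_of_le _ fun w hw => ?_
  rw [map_smul, norm_smul, toReal_enorm]
  gcongr
  exact h w (Finsupp.mem_support_iff.1 hw)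

theorem summable_of_pnorm_ne_top {f : FSeries m p} {ρ : ℝ≥0} (h : pnorm ρ f ≠ ∞) :
    Summable fun r => (ρ : ℝ) ^ r * (wnorm (coeff r f)).toReal := by
  refine (ENNReal.summable_toReal h).congr fun r => ?_
  rw [ENNReal.toReal_mul, ENNReal.toReal_pow, ENNReal.coe_toReal]

theorem tsum_eq_toReal_pnorm (ρ : ℝ≥0) (f : FSeries m p) (h : pnorm ρ f ≠ ∞) :
    ∑' r, (ρ : ℝ) ^ r * (wnorm (coeff r f)).toReal = (pnorm ρ f).toReal := by
  rw [pnorm, ENNReal.tsum_toReal_eq fun r => ENNReal.ne_top_of_tsum_ne_top h r]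
  refine tsum_congr fun r => ?_
  rw [ENNReal.toReal_mul, ENNReal.toReal_pow, ENNReal.coe_toReal]

variable {A : Type u} [Ring A] [Algebra ℝ A] [ConvenientAlgebra A]

/-- A bound for the multipowers on the first level. -/
def mpowBound (Q : Fin m → A) : ℝ := 1 + ∑ e, ‖rep A 1 (mpow Q e)‖

theorem one_le_mpowBound (Q : Fin m → A) : 1 ≤ mpowBound Q :=
  le_add_of_nonneg_right (Finset.sum_nonneg fun _ _ => norm_nonneg _)

theorem norm_rep_mpow_le (Q : Fin m → A) (e : Fin m → Fin 2) : ‖rep A 1 (mpow Q e)‖ ≤ mpowBound Q :=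
  (Finset.single_le_sum (f := fun e => ‖rep A 1 (mpow Q e)‖) (fun _ _ => norm_nonneg _)
    (Finset.mem_univ e)).trans (le_add_of_nonneg_left zero_le_one)

/-- The building blocks of words. -/
def blocks (Q : Fin m → A) (R : Fin p → A) : Finset A := by
  classical
  exact Finset.univ.image fun x : Fin p × (Fin m → Fin 2) => R x.1 * mpow Q x.2

theorem norm_rep_of_mem_blocks {Q : Fin m → A} {R : Fin p → A} {δ : ℝ}
    (hR : ∀ j, ‖rep A 1 (R j)‖ * mpowBound Q ≤ δ) {x : A} (hx : x ∈ blocks Q R) : ‖rep A 1 x‖ ≤ δ := by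
  classical
  obtain ⟨y, _, rfl⟩ := Finset.mem_image.1 hx
  rw [map_mul]
  exact (norm_mul_le _ _).trans ((mul_le_mul_of_nonneg_left (norm_rep_mpow_le Q _)
    (norm_nonneg _)).trans (hR _))

theorem mem_blocks_of_mem_ofFn {A : Type*} [Ring A] {Q : Fin m → A} {R : Fin p → A} {r : ℕ}
    {e : Fin r → Fin m → Fin 2} {j : Fin r → Fin p} {x : A}
    (hx : x ∈ List.ofFn fun t => R (j t) * mpow Q (e t)) : x ∈ blocks Q R := by
  classical
  obtain ⟨t, rfl⟩ := List.mem_ofFn.1 hx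
  exact Finset.mem_image.2 ⟨(j t, e t), Finset.mem_univ _, rfl⟩

/-- In normal form a word is one multipower times `pdeg w` blocks R_j Q^ι of norm at most δ, so the
number of Clifford letters plays no role. -/
theorem norm_rep_one_evalWord_le {Q : Fin m → A} (hQ : IsClifford Q) {R : Fin p → A} {δ : ℝ}
    (hR : ∀ j, ‖rep A 1 (R j)‖ * mpowBound Q ≤ δ) (w : Words m p) :
    ‖rep A 1 (evalWord Q R w)‖ ≤ mpowBound Q * δ ^ pdeg w := by
  obtain ⟨σ, hσ, e, j, -, -, h⟩ := exists_evalWord_eq.{u} w _ rfl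
  rw [h A Q R hQ, map_smul, norm_smul, word, map_mul]
  have h1 := norm_rep_one_list_prod_le (fun x hx => norm_rep_of_mem_blocks hR hx) _
    fun x hx => mem_blocks_of_mem_ofFn (e := fun t => e t.succ) (j := j) hx
  rw [List.length_ofFn] at h1
  calc _ ≤ 1 * (‖rep A 1 (mpow Q (e 0))‖ * _) :=
        mul_le_mul hσ (norm_mul_le _ _) (norm_nonneg _) zero_le_one
    _ ≤ _ := by
        rw [one_mul]
        exact mul_le_mul (norm_rep_mpow_le Q _) h1 (norm_nonneg _)
          (zero_le_one.trans (one_le_mpowBound Q))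

theorem exists_norm_rep_evalWord_le {Q : Fin m → A} (hQ : IsClifford Q) {R : Fin p → A} {δ : ℝ}
    (hδ : 0 < δ) (hR : ∀ j, ‖rep A 1 (R j)‖ * mpowBound Q ≤ δ) (i : ℕ) :
    ∃ C, 0 ≤ C ∧ ∀ w : Words m p,
      ‖rep A i (evalWord Q R w)‖ ≤ C * (pdeg w + 1 : ℝ) ^ i * δ ^ pdeg w := by
  obtain ⟨C, hC, hCb⟩ := exists_norm_rep_list_prod_le hδ
    (fun x hx => norm_rep_of_mem_blocks hR hx) i
  have hC' : ∀ e, ‖rep A i (mpow Q e)‖ ≤ ∑ e, ‖rep A i (mpow Q e)‖ := fun e =>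
    Finset.single_le_sum (f := fun e => ‖rep A i (mpow Q e)‖) (fun _ _ => norm_nonneg _)
      (Finset.mem_univ e)
  refine ⟨(∑ e, ‖rep A i (mpow Q e)‖) * C,
    mul_nonneg (Finset.sum_nonneg fun _ _ => norm_nonneg _) hC, fun w => ?_⟩
  obtain ⟨σ, hσ, e, j, -, -, h⟩ := exists_evalWord_eq.{u} w _ rfl
  rw [h A Q R hQ, map_smul, norm_smul, word, map_mul]
  have h1 := hCb _ fun x hx => mem_blocks_of_mem_ofFn (e := fun t => e t.succ) (j := j) hx
  rw [List.length_ofFn] at h1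
  calc _ ≤ 1 * (‖rep A i (mpow Q (e 0))‖ * _) :=
        mul_le_mul hσ (norm_mul_le _ _) (norm_nonneg _) zero_le_one
    _ ≤ (∑ e, ‖rep A i (mpow Q e)‖) * (C * (pdeg w + 1 : ℝ) ^ i * δ ^ pdeg w) := by
        rw [one_mul]
        exact mul_le_mul (hC' _) h1 (norm_nonneg _) ((norm_nonneg _).trans (hC' 0))
    _ = _ := by ring

theorem exists_pow_mul_pow_le (i : ℕ) {t : ℝ} (ht : 0 < t) (ht1 : t < 1) :
    ∃ K, 0 ≤ K ∧ ∀ r : ℕ, (r + 1 : ℝ) ^ i * t ^ r ≤ K := by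
  obtain ⟨K, hK⟩ := (tendsto_pow_const_mul_const_pow_of_lt_one i ht.le ht1).bddAbove_range
  have h : ∀ r : ℕ, (r + 1 : ℝ) ^ i * t ^ r ≤ K / t := fun r => by
    have := hK ⟨r + 1, rfl⟩
    rw [le_div_iff₀ ht]
    simpa [pow_succ, mul_assoc] using this
  exact ⟨K / t, (by positivity : (0 : ℝ) ≤ ((0 : ℕ) + 1 : ℝ) ^ i * t ^ 0).trans (h 0), h⟩

/-- Evaluations of convergent series at small perturbations of Clifford systems are absolutely
summable on all levels. -/
theorem mapAlgHom_mem_summableSeries {Q : Fin m → A} (hQ : IsClifford Q) {R : Fin p → A}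
    {δ ρ : ℝ≥0} (hδ : 0 < δ) (hR : ∀ j, ‖rep A 1 (R j)‖ * mpowBound Q ≤ δ) (hρ : δ < ρ)
    {s : Set (Fin m ⊕ Fin p)} {f : FSeries m p} (hf : f ∈ convSeries s) (hfρ : pnorm ρ f ≠ ∞) :
    mapAlgHom (evalHom Q R) f ∈ summableSeries A := by
  refine mem_summableSeries_iff.2 fun i => mem_absSummable_iff.2 ?_
  obtain ⟨C, hC, hCb⟩ := exists_norm_rep_evalWord_le hQ (NNReal.coe_pos.2 hδ) hR i
  have hρ0 : (0 : ℝ) < ρ := NNReal.coe_pos.2 (hδ.trans hρ)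
  -- The strict inequality δ < ρ absorbs the polynomial factor on level i, so the same δ serves all
  -- levels.
  obtain ⟨K, hK, hKb⟩ := exists_pow_mul_pow_le i (t := δ / ρ) (div_pos (NNReal.coe_pos.2 hδ) hρ0)
    ((div_lt_one hρ0).2 (NNReal.coe_lt_coe.2 hρ))
  refine Summable.of_nonneg_of_le (fun r => norm_nonneg _) (fun r => ?_)
    ((summable_of_pnorm_ne_top hfρ).mul_left (C * K))
  change ‖rep A i (evalHom Q R (coeff r f))‖ ≤ _
  refine (norm_evalHom_le (rep A i) (b := C * (r + 1 : ℝ) ^ i * δ ^ r) fun w hw => ?_).trans ?_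
  · rw [← ((mem_convSeries_iff.1 hf).1 r w hw).1]
    exact hCb w
  · have h1 := hKb r
    rw [div_pow, ← mul_div_assoc, div_le_iff₀ (pow_pos hρ0 r)] at h1
    calc _ = C * (wnorm (coeff r f)).toReal * ((r + 1 : ℝ) ^ i * δ ^ r) := by ring
      _ ≤ C * (wnorm (coeff r f)).toReal * (K * ρ ^ r) := by gcongr
      _ = _ := by ring

theorem norm_rep_one_sumHom_le {Q : Fin m → A} (hQ : IsClifford Q) {R : Fin p → A} {δ : ℝ≥0}
    (hR : ∀ j, ‖rep A 1 (R j)‖ * mpowBound Q ≤ δ) {s : Set (Fin m ⊕ Fin p)} {f : FSeries m p}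
    (hf : f ∈ convSeries s) (hfδ : pnorm δ f ≠ ∞) (h : mapAlgHom (evalHom Q R) f ∈ summableSeries A) :
    ‖rep A 1 (sumHom A ⟨_, h⟩)‖ ≤ mpowBound Q * (pnorm δ f).toReal := by
  rw [← (hasSum_sumHom ⟨_, h⟩ 1).tsum_eq, ← tsum_eq_toReal_pnorm δ f hfδ, ← tsum_mul_left]
  refine tsum_of_norm_bounded ((summable_of_pnorm_ne_top hfδ).mul_left _).hasSum fun r => ?_
  change ‖rep A 1 (evalHom Q R (coeff r f))‖ ≤ _
  refine (norm_evalHom_le (rep A 1) (b := mpowBound Q * δ ^ r) fun w hw => ?_).trans_eq (by ring)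
  rw [← ((mem_convSeries_iff.1 hf).1 r w hw).1]
  exact norm_rep_one_evalWord_le hQ hR w

/-- Compare with x = (1 + a)q - r. Its inverse has norm at most (‖q‖ + ‖1‖)/(1 + a), while the
perturbation has norm at most (1 + a)η. The factors 1 + a cancel, so the bound is uniform in a and
r. -/
theorem isUnit_add_smul_sub_of_norm_le {B : Type*} [NormedRing B] [NormedAlgebra ℝ B] [CompleteSpace B]
    {q t b : B} (hq : q * q = -1) {η : ℝ} (ht : ‖t - q‖ ≤ η) (hb : ‖b - q‖ ≤ η)
    (hη : (‖q‖ + ‖(1 : B)‖) * η < 1) {a : ℝ} (ha : 0 ≤ a) (r : ℝ) :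
    IsUnit (t + a • b - algebraMap ℝ B r) := by
  have hη0 : 0 ≤ η := (norm_nonneg _).trans ht
  have hd : (0 : ℝ) < (1 + a) ^ 2 + r ^ 2 := by positivity
  set x : B := (1 + a) • q - r • 1 with hx
  set x' : B := (-((1 + a) ^ 2 + r ^ 2)⁻¹) • ((1 + a) • q + r • 1) with hx'
  have e : ∀ y z : ℝ, ((1 + a) • q + y • (1 : B)) * ((1 + a) • q + z • (1 : B)) =
      (-(1 + a) ^ 2 + y * z) • (1 : B) + ((1 + a) * (y + z)) • q := fun y z => by
    simp only [add_mul, mul_add, smul_mul_smul_comm, hq, mul_one, one_mul, smul_neg, add_smul, neg_smul]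
    module
  have hxx : x * x' = 1 := by
    rw [hx, hx', mul_smul_comm, sub_eq_add_neg, ← neg_smul, e, neg_add_cancel, mul_zero, zero_smul,
      add_zero, smul_smul]
    have : -((1 + a) ^ 2 + r ^ 2)⁻¹ * (-(1 + a) ^ 2 + -r * r) = 1 := by
      field_simp
      ring
    rw [this, one_smul]
  have hxx' : x' * x = 1 := by
    rw [hx, hx', smul_mul_assoc, sub_eq_add_neg, ← neg_smul, e, add_neg_cancel, mul_zero, zero_smul,
      add_zero, smul_smul]
    have : -((1 + a) ^ 2 + r ^ 2)⁻¹ * (-(1 + a) ^ 2 + r * -r) = 1 := by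
      field_simp
      ring
    rw [this, one_smul]
  have hux : IsUnit x := ⟨⟨x, x', hxx, hxx'⟩, rfl⟩
  have hn' : ‖x'‖ ≤ (‖q‖ + ‖(1 : B)‖) / (1 + a) := by
    rw [hx', norm_smul, norm_neg, norm_inv, Real.norm_of_nonneg hd.le, ← div_eq_inv_mul,
      div_le_div_iff₀ hd (by positivity)]
    have h1 : ‖(1 + a) • q + r • (1 : B)‖ ≤ (1 + a) * ‖q‖ + |r| * ‖(1 : B)‖ := by
      refine (norm_add_le _ _).trans_eq ?_
      rw [norm_smul, norm_smul, Real.norm_of_nonneg (by positivity), Real.norm_eq_abs]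
    have h2 : |r| * (1 + a) ≤ (1 + a) ^ 2 + r ^ 2 := by
      rw [← sq_abs r]
      nlinarith [sq_nonneg (|r| - (1 + a)), sq_nonneg |r|, sq_nonneg (1 + a)]
    calc _ ≤ ((1 + a) * ‖q‖ + |r| * ‖(1 : B)‖) * (1 + a) := by gcongr
      _ = ‖q‖ * (1 + a) ^ 2 + ‖(1 : B)‖ * (|r| * (1 + a)) := by ring
      _ ≤ ‖q‖ * ((1 + a) ^ 2 + r ^ 2) + ‖(1 : B)‖ * ((1 + a) ^ 2 + r ^ 2) := by
          gcongr
          exact le_add_of_nonneg_right (sq_nonneg r)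
      _ = _ := by ring
  set z : B := (t - q) + a • (b - q) with hz
  have hnz : ‖z‖ ≤ (1 + a) * η := by
    rw [add_mul, one_mul]
    refine (norm_add_le _ _).trans (add_le_add ht ?_)
    rw [norm_smul, Real.norm_of_nonneg ha]
    gcongr
  have hu : IsUnit (1 - -(x' * z)) := by
    refine isUnit_one_sub_of_norm_lt_one ?_
    rw [norm_neg]
    calc _ ≤ ‖x'‖ * ‖z‖ := norm_mul_le _ _
      _ ≤ (‖q‖ + ‖(1 : B)‖) / (1 + a) * ((1 + a) * η) := by gcongr
      _ = (‖q‖ + ‖(1 : B)‖) * η := by field_simp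
      _ < 1 := hη
  have e2 : t + a • b - algebraMap ℝ B r = x * (1 - -(x' * z)) := by
    rw [sub_neg_eq_add, mul_add, mul_one, ← mul_assoc, hxx, one_mul, hx, hz,
      Algebra.algebraMap_eq_smul_one]
    module
  rw [e2]
  exact hux.mul hu

theorem isPol_of_norm_le {T B Q : A} (hQ : Q * Q = -1) (hB : B * B = -1) (hBT : Commute B T) {η : ℝ}
    (hT' : ‖rep A 1 (T - Q)‖ ≤ η) (hB' : ‖rep A 1 (B - Q)‖ ≤ η)
    (hη : (‖rep A 1 Q‖ + ‖(1 : Level A 1)‖) * η < 1) : IsPol T B := by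
  refine ⟨hB, hBT, fun a ha r => isUnit_iff_rep.2 ?_⟩
  rw [map_sub] at hT' hB'
  rw [map_sub, map_add, map_smul, AlgHom.commutes]
  exact isUnit_add_smul_sub_of_norm_le (by rw [← map_mul, hQ, map_neg, map_one]) hT' hB' hη ha r

end Evaluation
end FQ
end

/-! ### Identification of the sums and the expansions. -/

noncomputable section
namespace FQ

section Convergence

open PowerSeries Filter Topology
open scoped ENNReal NNReal

variable {m p : ℕ} {A : Type u} [Ring A] [Algebra ℝ A] [ConvenientAlgebra A]

theorem eventually_mem_summableSeries {Q : Fin m → A} (hQ : IsClifford Q) {s : Set (Fin m ⊕ Fin p)}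
    {f : FSeries m p} (hf : f ∈ convSeries s) :
    ∀ᶠ δ : ℝ≥0 in 𝓝[>] 0, ∀ R : Fin p → A, (∀ j, ‖rep A 1 (R j)‖ * mpowBound Q ≤ δ) →
      mapAlgHom (evalHom Q R) f ∈ summableSeries A := by
  obtain ⟨ρ, hρ, hfρ⟩ := (mem_convSeries_iff.1 hf).2
  filter_upwards [Ioo_mem_nhdsGT hρ] with δ hδ R hR
  exact mapAlgHom_mem_summableSeries hQ hδ.1 hR hδ.2 hf hfρ

theorem eventually_norm_rep_one_sumHom_le {Q : Fin m → A} (hQ : IsClifford Q)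
    {s : Set (Fin m ⊕ Fin p)} {f : FSeries m p} (hf : f ∈ convSeries s) (hf0 : constantCoeff f = 0)
    {ε : ℝ} (hε : 0 < ε) :
    ∀ᶠ δ : ℝ≥0 in 𝓝[>] 0, ∀ R : Fin p → A, (∀ j, ‖rep A 1 (R j)‖ * mpowBound Q ≤ δ) →
      ∀ h : mapAlgHom (evalHom Q R) f ∈ summableSeries A, ‖rep A 1 (sumHom A ⟨_, h⟩)‖ ≤ ε := by
  obtain ⟨ρ, hρ, hfρ⟩ := (mem_convSeries_iff.1 hf).2
  have hb := zero_lt_one.trans_le (one_le_mpowBound Q)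
  obtain ⟨σ, hσ, hfσ⟩ := exists_pnorm_le hf0 hρ hfρ
    (ε := (ε / mpowBound Q).toNNReal) (Real.toNNReal_pos.2 (by positivity))
  filter_upwards [Ioc_mem_nhdsGT hσ] with δ hδ R hR h
  have hfδ := (pnorm_mono hδ.2 f).trans hfσ
  refine (norm_rep_one_sumHom_le hQ hR hf (ne_top_of_le_ne_top ENNReal.coe_ne_top hfδ) h).trans ?_
  have h1 : (pnorm δ f).toReal ≤ ε / mpowBound Q :=
    ENNReal.toReal_le_of_le_ofReal (by positivity) hfδ
  calc _ ≤ mpowBound Q * (ε / mpowBound Q) := by gcongr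
    _ = ε := mul_div_cancel₀ _ hb.ne'

theorem letter_mem_summableSeries (Q : Fin m → A) (R : Fin p → A) (x : Fin m ⊕ Fin p) :
    mapAlgHom (evalHom Q R) (letter x) ∈ summableSeries A := by
  rw [mapAlgHom_letter]
  exact monomial_mem_summableSeries _ _

theorem sumHom_letter (Q : Fin m → A) (R : Fin p → A) (x : Fin m ⊕ Fin p) :
    sumHom A ⟨_, letter_mem_summableSeries Q R x⟩ = Sum.elim Q R x := by
  rw [← sumHom_monomial (if x.isRight then 1 else 0) (Sum.elim Q R x)]
  congr 1
  exact Subtype.ext (mapAlgHom_letter Q R x)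

theorem isClifford_mapAlgHom_letter {A : Type*} [Ring A] [Algebra ℝ A] {Q : Fin m → A}
    (hQ : IsClifford Q) (R : Fin p → A) :
    IsClifford fun i => mapAlgHom (evalHom Q R) (letter (.inl i)) := by
  have e : ∀ i, mapAlgHom (evalHom Q R) (letter (.inl i)) = C (Q i) := fun i =>
    (mapAlgHom_letter Q R (.inl i)).trans (monomial_zero_eq_C_apply _)
  intro i j
  simp only [e]
  rw [← map_mul, ← map_mul, ← map_add, hQ i j]
  split_ifs
  · rw [map_neg]
    exact congrArg _ (map_ofNat C 2)
  · exact map_zero _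

/-- The formal Gram-Schmidt orthogonalization sums up to the Gram-Schmidt orthogonalization. -/
theorem eventually_isGS_sumHom {Q : Fin m → A} (hQ : IsClifford Q) {Y : Fin m → FSeries m p}
    (hY : ∀ i, constantCoeff (Y i) = 0) {s : Fin m → Set (Fin m ⊕ Fin p)} (hs : Monotone s)
    (hq : ∀ i, Sum.inl i ∈ s i) (hYs : ∀ i, Y i ∈ convSeries (s i)) :
    ∀ᶠ δ : ℝ≥0 in 𝓝[>] 0, ∀ R : Fin p → A, (∀ j, ‖rep A 1 (R j)‖ * mpowBound Q ≤ δ) →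
      ∃ (h : ∀ i, mapAlgHom (evalHom Q R) (Y i) ∈ summableSeries A)
        (h' : ∀ i, mapAlgHom (evalHom Q R) (formalGS Y i) ∈ summableSeries A),
        IsGS (fun i => Q i + sumHom A ⟨_, h i⟩) (fun i => sumHom A ⟨_, h' i⟩) := by
  have hmem := formalTerm_mem_and_formalGS_mem hY hs hq hYs
  -- The closeness to Q_i required by `isPol_of_norm_le`.
  have hη : ∀ i, ∃ η : ℝ, 0 < η ∧ (‖rep A 1 (Q i)‖ + ‖(1 : Level A 1)‖) * η < 1 := fun i =>
    ⟨(‖rep A 1 (Q i)‖ + ‖(1 : Level A 1)‖ + 1)⁻¹, by positivity, by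
      rw [← div_eq_mul_inv, div_lt_one (by positivity)]
      exact lt_add_one _⟩
  choose η hη0 hη1 using hη
  have hdev : ∀ i, formalGS Y i - letter (.inl i) ∈ convSeries (s i) := fun i =>
    sub_mem (hmem i).2 (letter_mem (hq i))
  have hdev0 : ∀ i, constantCoeff (formalGS Y i - letter (.inl i)) = 0 := fun i => by
    rw [map_sub, constantCoeff_formalGS hY, sub_self]
  filter_upwards [eventually_all.2 fun i => eventually_mem_summableSeries hQ (hYs i),
    eventually_all.2 fun i => eventually_mem_summableSeries hQ (hmem i).1,
    eventually_all.2 fun i => eventually_mem_summableSeries hQ (hmem i).2,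
    eventually_all.2 fun i => eventually_norm_rep_one_sumHom_le hQ (hmem i).1
      (constantCoeff_formalTerm hY i) (hη0 i),
    eventually_all.2 fun i => eventually_norm_rep_one_sumHom_le hQ (hdev i) (hdev0 i) (hη0 i)]
    with δ h1 h2 h3 h4 h5 R hR
  replace h1 := fun i => h1 i R hR
  replace h2 := fun i => h2 i R hR
  replace h3 := fun i => h3 i R hR
  refine ⟨h1, h3, fun k => ?_⟩
  have hQ' := isClifford_mapAlgHom_letter hQ R
  let q : Fin m → summableSeries A := fun i => ⟨_, letter_mem_summableSeries Q R (.inl i)⟩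
  let y : Fin m → summableSeries A := fun i => ⟨_, h1 i⟩
  let t : Fin m → summableSeries A := fun i => ⟨_, h2 i⟩
  let b : Fin m → summableSeries A := fun i => ⟨_, h3 i⟩
  have hsq : ∀ i, sumHom A (q i) = Q i := fun i => sumHom_letter Q R (.inl i)
  -- The identities below hold in the algebra of summable series, and the homomorphism `sumHom`
  -- carries them to A.
  have hbb : ∀ i, b i * b i = -1 := fun i => Subtype.ext (map_formalGS _ hY hQ' i).1
  have hbt : Commute (b k) (q k + t k) := Subtype.ext (map_formalGS _ hY hQ' k).2
  have hu : ∀ x ∈ prefixList b k k.isLt.le, IsUnit x := fun x hx => by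
    obtain ⟨i, _, rfl⟩ := mem_prefixList.1 hx
    exact isUnit_of_mul_self_eq_neg_one (hbb i)
  have hqt : q k + t k = antisymmList (q k + y k) (prefixList b k k.isLt.le) := by
    apply Subtype.ext
    have := map_antisymmList (summableSeries A).val (q k + y k) hu
    rw [map_prefixList] at this
    exact (map_formalTerm _ hY hQ' k).trans this.symm
  have hT : Q k + sumHom A (t k) = antisymmList (Q k + sumHom A (y k))
      (prefixList (fun i => sumHom A (b i)) k k.isLt.le) := by
    have := congrArg (sumHom A) hqt
    rwa [map_antisymmList (sumHom A) _ hu, map_prefixList, map_add, map_add, hsq] at this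
  change IsPol (antisymmList (Q k + sumHom A (y k))
    (prefixList (fun i => sumHom A (b i)) k k.isLt.le)) (sumHom A (b k))
  rw [← hT]
  have hB : sumHom A (b k) - Q k = sumHom A (b k - q k) := by rw [map_sub, hsq]
  have hbq : mapAlgHom (evalHom Q R) (formalGS Y k - letter (.inl k)) ∈ summableSeries A := by
    rw [map_sub]
    exact (b k - q k).2
  have hbq' : b k - q k = ⟨_, hbq⟩ := Subtype.ext (map_sub _ _ _).symm
  -- The remaining condition is analytic: the term and its polarization both stay near Q_k on level
  -- 1, since their deviations are series without constant term.
  refine isPol_of_norm_le ((isClifford_iff.1 hQ).1 k) ?_ ?_ ?_ ?_ (hη1 k)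
  · rw [← map_mul, hbb, map_neg, map_one]
  · have := hbt.map (sumHom A)
    rwa [map_add, hsq] at this
  · rw [add_sub_cancel_left]
    exact h4 k R hR (h2 k)
  · rw [hB, hbq']
    exact h5 k R hR hbq

end Convergence

section Expansion

open PowerSeries Filter Topology
open scoped ENNReal NNReal

variable {A : Type u} [Ring A] [Algebra ℝ A] [ConvenientAlgebra A]

theorem isOpen_setOf_norm_rep_one_mul_lt (x : A) (ε : ℝ) :
    @IsOpen A (zeroTopology A) {a | ‖rep A 1 (a * x)‖ < ε} := by
  let _ : TopologicalSpace A := zeroTopology A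
  have h : Continuous (rep A 1) := continuous_rep_levelTopology A 1
  simp only [map_mul]
  exact isOpen_lt ((h.mul continuous_const).norm) continuous_const

theorem exists_radius {P : ℝ≥0 → Prop} (h : ∀ᶠ δ : ℝ≥0 in 𝓝[>] 0, P δ) : ∃ δ, 0 < δ ∧ P δ := by
  obtain ⟨δ, h1, h2⟩ := (h.and self_mem_nhdsWithin).exists
  exact ⟨δ, h2, h1⟩

theorem hasExpansion_gramSchmidt (n : ℕ) : ∃ c, HasExpansion (gramSchmidt.{u} n) c ∧
    ∀ k r e j, c k r e j ≠ 0 → (∀ s, j s ≤ k) ∧ ∀ s i, e s i ≠ 0 → i ≤ k := by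
  let Y : Fin n → FSeries n n := fun i => letter (.inr i)
  -- The letters Q_i and R_i with i ≤ k.
  let s : Fin n → Set (Fin n ⊕ Fin n) := fun k => {x | Sum.elim id id x ≤ k}
  have hs : Monotone s := fun k l hkl x hx => le_trans hx hkl
  have hY : ∀ i, constantCoeff (Y i) = 0 := fun i => by
    rw [← coeff_zero_eq_constantCoeff_apply]
    exact (coeff_monomial _ _ _).trans (if_neg Nat.zero_ne_one)
  have hYs : ∀ i, Y i ∈ convSeries (s i) := fun i => letter_mem (le_refl i)
  have hq : ∀ i, Sum.inl i ∈ s i := fun i => le_refl i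
  obtain ⟨c, hc1, hc2⟩ := exists_coeff_of_mem_convSeries.{u} (formalGS Y) s
    fun k => (formalTerm_mem_and_formalGS_mem hY hs hq hYs k).2
  refine ⟨c, fun A _ _ _ Q hQ => ?_, hc1⟩
  obtain ⟨δ, hδ, h⟩ := exists_radius (eventually_isGS_sumHom hQ hY hs hq hYs)
  have hb := zero_lt_one.trans_le (one_le_mpowBound Q)
  refine ⟨{a | ‖rep A 1 (a * 1)‖ < δ / mpowBound Q}, isOpen_setOf_norm_rep_one_mul_lt 1 _, ?_,
    fun R hR => ?_⟩
  · rw [Set.mem_ofPred_eq, zero_mul, map_zero, norm_zero]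
    exact div_pos hδ hb
  · obtain ⟨h1, h2, h3⟩ := h R fun j => by
      have := hR j
      rw [Set.mem_ofPred_eq, mul_one] at this
      exact (le_div_iff₀ hb).1 this.le
    refine ⟨fun i => sumHom A ⟨_, h2 i⟩, mem_gramSchmidt_iff.2 ?_, fun k => ?_⟩
    · convert h3 using 1
      funext i
      exact congrArg (Q i + ·) (sumHom_letter Q R (.inr i)).symm
    · refine hasSum_infTopology fun i => ?_
      simp only [hc2 A Q R hQ]
      exact hasSum_sumHom ⟨_, h2 k⟩ i

theorem hasFloatingExpansion_conformGramSchmidt (n : ℕ) :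
    ∃ c, HasFloatingExpansion (conformGramSchmidt.{u} n) c ∧
      ∀ k r e j, c k r e j ≠ 0 → (∀ s, j s ≤ k) ∧ ∀ s i, e s i ≠ 0 → i.succ ≤ k := by
  let x : Fin (n + 1) → FSeries n (n + 1) := fun j => letter (.inr j)
  have hx : ∀ j, constantCoeff (x j) = 0 := fun i => by
    rw [← coeff_zero_eq_constantCoeff_apply]
    exact (coeff_monomial _ _ _).trans (if_neg Nat.zero_ne_one)
  -- The inverse of 1 + R̃_1.
  let g : FSeries n (n + 1) := substHom (x 0) (hx 0) (PowerSeries.binomialSeries ℝ (-1 : ℝ))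
  have hg : g * (1 + x 0) = 1 := by
    have := congrArg (substHom (x 0) (hx 0)) binomialSeries_neg_one_mul
    rwa [map_mul, map_add, map_one, substHom_X] at this
  have hg' : (1 + x 0) * g = 1 := by
    have hc : Commute (1 + x 0) g := commute_substHom (hx 0)
      ((Commute.one_left _).add_left (Commute.refl _)) _
    rw [hc.eq, hg]
  have hg0 : constantCoeff g = 1 := by
    rw [constantCoeff_substHom, binomialSeries_constantCoeff, map_one]
  -- For A = Q + R one has A_j A_1⁻¹ = (Q̃_j + R̃_j)(1 + R̃_1)⁻¹, and Y is its deviation from Q̃_j.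
  let Y : Fin n → FSeries n (n + 1) := fun i =>
    (letter (.inl i) + x i.succ) * g - letter (.inl i)
  let s' : Fin (n + 1) → Set (Fin n ⊕ Fin (n + 1)) := fun k => {x | Sum.elim Fin.succ id x ≤ k}
  have hs' : Monotone s' := fun k l hkl x hx => le_trans hx hkl
  let s : Fin n → Set (Fin n ⊕ Fin (n + 1)) := fun k => s' k.succ
  have hs : Monotone s := fun k l hkl => hs' (Fin.succ_le_succ_iff.2 hkl)
  have hY : ∀ i, constantCoeff (Y i) = 0 := fun i => by
    rw [map_sub, map_mul, map_add, hx, hg0, add_zero, mul_one, sub_self]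
  have hq : ∀ i, Sum.inl i ∈ s i := fun i => le_refl i.succ
  have hx0 : ∀ k, x 0 ∈ convSeries (s' k) := fun k => letter_mem (Fin.zero_le k)
  have hgs : ∀ k, g ∈ convSeries (s' k) := fun k =>
    substHom_mem _ (hx0 k) (norm_coeff_binomialSeries_le (by norm_num) (by norm_num))
  have hYs : ∀ i, Y i ∈ convSeries (s i) := fun i =>
    sub_mem (mul_mem (add_mem (letter_mem (hq i)) (letter_mem (le_refl i.succ))) (hgs _))
      (letter_mem (hq i))
  -- The result is multiplied back by A_1 = (1 + R̃_1)Q_1. The factor Q_1 stays outside the series.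
  let F : Fin (n + 1) → FSeries n (n + 1) :=
    Fin.cons (1 + x 0) fun i => formalGS Y i * (1 + x 0)
  have hF : ∀ k, F k ∈ convSeries (s' k) := fun k => Fin.cases
    (add_mem (one_mem _) (hx0 0))
    (fun i => mul_mem (formalTerm_mem_and_formalGS_mem hY hs hq hYs i).2 (add_mem (one_mem _) (hx0 _))) k
  obtain ⟨c, hc1, hc2⟩ := exists_coeff_of_mem_convSeries.{u} F s' hF
  refine ⟨c, fun A _ _ _ P hP => ?_, hc1⟩
  obtain ⟨hP0, hQ⟩ := hP
  set Q := unfloat P with hQdef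
  obtain ⟨δ, hδ, h, hgδ⟩ := exists_radius ((eventually_isGS_sumHom hQ hY hs hq hYs).and
    (eventually_mem_summableSeries hQ (hgs 0)))
  have hb := zero_lt_one.trans_le (one_le_mpowBound Q)
  refine ⟨{a | ‖rep A 1 (a * Ring.inverse (P 0))‖ < δ / mpowBound Q},
    isOpen_setOf_norm_rep_one_mul_lt _ _, ?_, fun R hR => ?_⟩
  · rw [Set.mem_ofPred_eq, zero_mul, map_zero, norm_zero]
    exact div_pos hδ hb
  set R' : Fin (n + 1) → A := fun j => R j * Ring.inverse (P 0) with hR'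
  have hR'δ : ∀ j, ‖rep A 1 (R' j)‖ * mpowBound Q ≤ δ := fun j => by
    have := hR j
    rw [Set.mem_ofPred_eq] at this
    exact (le_div_iff₀ hb).1 this.le
  obtain ⟨h1, h2, h3⟩ := h R' hR'δ
  let gs : summableSeries A := ⟨_, hgδ R' hR'δ⟩
  let xs : Fin (n + 1) → summableSeries A := fun j => ⟨_, letter_mem_summableSeries Q R' (.inr j)⟩
  let qs : Fin n → summableSeries A := fun i => ⟨_, letter_mem_summableSeries Q R' (.inl i)⟩
  let b : Fin n → summableSeries A := fun i => ⟨_, h2 i⟩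
  have hsx : ∀ j, sumHom A (xs j) = R' j := fun j => sumHom_letter Q R' (.inr j)
  have hsq : ∀ i, sumHom A (qs i) = Q i := fun i => sumHom_letter Q R' (.inl i)
  have hgh : gs * (1 + xs 0) = 1 := Subtype.ext (by
    have := congrArg (mapAlgHom (evalHom Q R')) hg
    rwa [map_mul, map_add, map_one] at this)
  have hgh' : (1 + xs 0) * gs = 1 := Subtype.ext (by
    have := congrArg (mapAlgHom (evalHom Q R')) hg'
    rwa [map_mul, map_add, map_one] at this)
  have hY' : ∀ i, (⟨_, h1 i⟩ : summableSeries A) = (qs i + xs i.succ) * gs - qs i := fun i =>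
    Subtype.ext (by
      change mapAlgHom (evalHom Q R') ((letter (.inl i) + x i.succ) * g - letter (.inl i)) = _
      rw [map_sub, map_mul, map_add]
      rfl)
  have hG := congrArg (sumHom A) hgh
  have hG' := congrArg (sumHom A) hgh'
  rw [map_mul, map_add, map_one, hsx] at hG hG'
  have hu : IsUnit (1 + R' 0) := ⟨⟨_, _, hG', hG⟩, rfl⟩
  have hinv : Ring.inverse (1 + R' 0) = sumHom A gs := Ring.inverse_unit ⟨_, _, hG', hG⟩
  have hPR : ∀ j, R j = R' j * P 0 := fun j => (Ring.inverse_mul_cancel_right _ _ hP0).symm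
  have ha0 : (P + R) 0 = (1 + R' 0) * P 0 := by
    rw [Pi.add_apply, hPR, add_mul, one_mul]
  have hinv' : Ring.inverse ((P + R) 0) = Ring.inverse (P 0) * sumHom A gs := by
    rw [ha0, ← hinv]
    obtain ⟨u, hu⟩ := hu
    obtain ⟨v, hv⟩ := hP0
    rw [← hu, ← hv, ← Units.val_mul, Ring.inverse_unit, Ring.inverse_unit, Ring.inverse_unit,
      mul_inv_rev, Units.val_mul]
  have hua : IsUnit ((P + R) 0) := by
    rw [ha0]
    exact hu.mul hP0
  let B : Fin (n + 1) → A := Fin.cons ((P + R) 0) fun i => sumHom A (b i) * (P + R) 0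
  refine ⟨B, mem_conformGramSchmidt_iff.2 ⟨hua, rfl, ?_⟩, fun k => ?_⟩
  · have e1 : unfloat B = fun i => sumHom A (b i) := funext fun i =>
      Ring.mul_inverse_cancel_right _ _ hua
    have e2 : unfloat (P + R) = fun i => Q i + sumHom A ⟨_, h1 i⟩ := funext fun i => by
      rw [hY', map_sub, map_mul, map_add, hsq, hsx, add_sub_cancel, unfloat, hinv', ← mul_assoc,
        Pi.add_apply, add_mul]
      rfl
    rw [e1, e2]
    exact h3
  · let f : Fin (n + 1) → summableSeries A := Fin.cons (1 + xs 0) fun i => b i * (1 + xs 0)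
    have hf : ∀ k, (f k : PowerSeries A) = mapAlgHom (evalHom Q R') (F k) := fun k => Fin.cases
      (by
        change _ = mapAlgHom (evalHom Q R') (1 + x 0)
        rw [map_add, map_one]
        rfl)
      (fun i => by
        change _ = mapAlgHom (evalHom Q R') (formalGS Y i * (1 + x 0))
        rw [map_mul, map_add, map_one]
        rfl) k
    have hB : B k = sumHom A (f k) * P 0 := Fin.cases
      (by
        change (P + R) 0 = sumHom A (1 + xs 0) * P 0
        rw [map_add, map_one, hsx, ha0])
      (fun i => by
        change sumHom A (b i) * (P + R) 0 = sumHom A (b i * (1 + xs 0)) * P 0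
        rw [map_mul, map_add, map_one, hsx, ha0, mul_assoc]) k
    refine hasSum_infTopology fun i => ?_
    have e : ∀ r, rep A i (expTerm c Q R' k r * P 0) =
        rep A i (coeff r (f k : PowerSeries A)) * rep A i (P 0) := fun r => by
      rw [map_mul, hc2 A Q R' hQ, hf]
      rfl
    simp only [e]
    rw [hB, map_mul]
    exact (hasSum_sumHom (f k) i).mul_right _

end Expansion
end FQ
end

theorem theorem3p5 (n : ℕ) :
    (FQ.IsOrthogonalization (FQ.gramSchmidt.{u} n) ∧
      FQ.CliffordConservative (FQ.gramSchmidt.{u} n) ∧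
      FQ.SignLinear (FQ.gramSchmidt.{u} n) ∧
      FQ.ZeroHomogeneous (FQ.gramSchmidt.{u} n) ∧
      FQ.PermanenceGS (FQ.gramSchmidt.{u} n) ∧
      FQ.Filtered (FQ.gramSchmidt.{u} n) ∧
      FQ.Parabolic (FQ.gramSchmidt.{u} n) ∧
      FQ.FiberStar (FQ.gramSchmidt.{u} n)) ∧
    (FQ.IsConformOrthogonalization (FQ.conformGramSchmidt.{u} n) ∧
      FQ.FloatingCliffordConservative (FQ.conformGramSchmidt.{u} n) ∧
      FQ.SignLinear (FQ.conformGramSchmidt.{u} n) ∧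
      FQ.PermanenceConformGS (FQ.conformGramSchmidt.{u} n) ∧
      FQ.ConformFiltered (FQ.conformGramSchmidt.{u} n) ∧
      FQ.ConformParabolic (FQ.conformGramSchmidt.{u} n) ∧
      FQ.FiberStar (FQ.conformGramSchmidt.{u} n)) ∧
    ∀ (A : Type u) [Ring A] [Algebra ℝ A] [FQ.ConvenientAlgebra A],
      FQ.IsZeroOpen (FQ.gramSchmidt.{u} n A).Dom ∧
      FQ.IsZeroOpen (FQ.conformGramSchmidt.{u} n A).Dom := by
  obtain ⟨c, hc, hc'⟩ := FQ.hasExpansion_gramSchmidt.{u} n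
  obtain ⟨d, hd, hd'⟩ := FQ.hasFloatingExpansion_conformGramSchmidt.{u} n
  exact ⟨⟨⟨FQ.natural_gramSchmidt n, ⟨c, hc⟩, FQ.cliffordProductive_gramSchmidt n⟩,
      FQ.cliffordConservative_gramSchmidt n, FQ.signLinear_gramSchmidt n,
      FQ.zeroHomogeneous_gramSchmidt n, FQ.permanenceGS_gramSchmidt n,
      ⟨FQ.pointwiseFiltered_gramSchmidt n, c, hc, hc'⟩, FQ.parabolic_gramSchmidt n,
      FQ.fiberStar_gramSchmidt n⟩,
    ⟨⟨FQ.natural_conformGramSchmidt n, FQ.bivariant_conformGramSchmidt n, ⟨d, hd⟩,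
        FQ.floatingCliffordProductive_conformGramSchmidt n⟩,
      FQ.floatingCliffordConservative_conformGramSchmidt n, FQ.signLinear_conformGramSchmidt n,
      FQ.permanenceConformGS_conformGramSchmidt n,
      ⟨FQ.pointwiseFiltered_conformGramSchmidt n, d, hd, hd'⟩,
      FQ.conformParabolic_conformGramSchmidt n, FQ.fiberStar_conformGramSchmidt n⟩,
    fun A _ _ _ => ⟨FQ.isZeroOpen_gramSchmidt_dom n, FQ.isZeroOpen_conformGramSchmidt_dom n⟩⟩
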